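/- **Setting.** Let $(X,D,Y(0),Y(1))$ be a random unit, with covariates $X\in\mathcal X\subset\mathbb R^p$, treatment $D\in\{0,1\}$ and real potential outcomes; put $Y=Y(D)$ and $Z=(X,D,Y)$. Let $Z_1,Z_2,\dots$ be the observations of i.i.d. copies of this unit. Fix a batch size $B\ge 1$, and let the $j$-th batch be $\mathcal B_j=\{(j-1)B+1,\dots,jB\}$, $j\ge1$. Let $e(x)=\mathbb P(D=1\mid X=x)$ be the (known) propensity score. A policy is a measurable map $\pi:\mathcal X\to[0,1]$; its value is $V(\pi)=\mathbb E[Y(1)\pi(X)+Y(0)(1-\pi(X))]$, and $\Delta(\pi;\pi')=V(\pi)-V(\pi')$. Let $\pi_0$ be a fixed policy and let $\mathcal A$ be a learning algorithm, that is, a (jointly measurable) map from finite data sets to policies. Put $\hat\pi_0=\pi_0$ and let $\hat\pi_t=\mathcal A(Z_1,\dots,Z_{tB})$ be the policy learned from the first $t$ batches. Below, $\mathbb E_X$ integrates over a new $X$ only, with the data fixed. **Estimators.** Let $\psi(Z)=\frac{YD}{e(X)}-\frac{Y(1-D)}{1-e(X)}$ and $$\widehat\Delta(\hat\pi_T;\pi_0)=\sum_{t=1}^{T-1}\frac1{T-t}\sum_{j=t+1}^T\widehat\Gamma_{tj},\qquad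 \widehat\Gamma_{tj}=\frac1B\sum_{i\in\mathcal B_j}\psi(Z_i)\,(\hat\pi_t(X_i)-\hat\pi_{t-1}(X_i)),$$ $$\hat g_{Tj}(Z)=\psi(Z)\sum_{t=1}^{j-1}\frac{\hat\pi_t(X)-\hat\pi_{t-1}(X)}{T-t},\qquad \bar g_{Tj}=\frac{1}{B(T-j+1)}\sum_{k=j}^T\sum_{i\in\mathcal B_k}\hat g_{Tj}(Z_i),$$ $$\hat v_T^2=\frac TB\sum_{j=2}^T\frac{1}{B(T-j+1)-1}\sum_{k=j}^T\sum_{i\in\mathcal B_k}\big(\hat g_{Tj}(Z_i)-\bar g_{Tj}\big)^2,\qquad \hat v_T\ge0,$$ where the summand $j=T$ is read as $0$ if $B=1$. **Assumptions.** 1. (Strong ignorability) $(Y(0),Y(1))$ and $D$ are conditionally independent given $X$, and there is $c>0$ with $c\le e(X)\le 1-c$ almost surely. 2. (Stabilization) There are constants $\delta,R_1,K_0>0$ such that, for all $t\ge R_1$, $t^{1+\delta}\,\mathbb E_X|\hat\pi_t(X)-\hat\pi_{t-1}(X)|\le K_0$ almost surely. 3. (Limit policy differs from the baseline) There is $M_1>0$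 such that, almost surely, $\mathbb E_X|\pi_0(X)-\hat\pi_\infty(X)|>M_1$, where the limit policy $\hat\pi_\infty$ is the policy, unique up to null sets, with $\mathbb E_X|\hat\pi_\infty(X)-\hat\pi_t(X)|\to0$ (it exists almost surely by 2). 4. (Bounded conditional moments) For $d=0,1$, $|\mathbb E[Y(d)\mid X]|$ and $\mathrm{Var}(Y(d)\mid X)$ are almost surely bounded by constants, and $\mathrm{Var}(Y(d)\mid X)$ is almost surely bounded below by a positive constant. 5. (Moments) $\mathbb E[Y(d)^4]<\infty$ for $d=0,1$. **Conclusion.** As $T\to\infty$ with $B$ fixed, $$\sqrt T\cdot\frac{\widehat\Delta(\hat\pi_T;\pi_0)-\Delta(\hat\pi_T;\pi_0)}{\hat v_T}\ \xrightarrow{d}\ N(0,1).$$ Consequently, for every $\alpha\in(0,1)$, with $q$ the $(1-\alpha/2)$-quantile of $N(0,1)$, $$\mathbb P\Big(\widehat\Delta(\hat\pi_T;\pi_0)-\tfrac{q\,\hat v_T}{\sqrt T}\le\Delta(\hat\pi_T;\pi_0)\le\widehat\Delta(\hat\pi_T;\pi_0)+\tfrac{q\,\hat v_T}{\sqrt T}\Big)\longrightarrow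 1-\alpha.$$ (Where $\hat v_T=0$, the ratio is read as $0$.) -/

import Mathlib

open MeasureTheory ProbabilityTheory Filter Topology

noncomputable section

namespace Cram

/-! ### The population -/

/-- A unit `(X, D, Y(0), Y(1))`: covariates, binary treatment, and the two potential outcomes. -/
abbrev PotUnit (𝒳 : Type*) : Type _ := 𝒳 × Bool × ℝ × ℝ

/-- An observation `Z = (X, D, Y)`. -/
abbrev Obs (𝒳 : Type*) : Type _ := 𝒳 × Bool × ℝ

/-- The covariates `X` of a unit. -/
def covariate {𝒳 : Type*} (w : PotUnit 𝒳) : 𝒳 := w.1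

/-- The treatment `D` of a unit (`true` stands for `D = 1`). -/
def treatment {𝒳 : Type*} (w : PotUnit 𝒳) : Bool := w.2.1

/-- The potential outcome `Y(d)` of a unit. -/
def potOutcome {𝒳 : Type*} (d : Bool) (w : PotUnit 𝒳) : ℝ := if d then w.2.2.2 else w.2.2.1

/-- What is observed of a unit: `(X, D, Y(D))`. -/
def observe {𝒳 : Type*} (w : PotUnit 𝒳) : Obs 𝒳 :=
  (covariate w, treatment w, potOutcome (treatment w) w)

/-- The σ-algebra generated by the covariates. -/
abbrev covSigma (𝒳 : Type*) [MeasurableSpace 𝒳] : MeasurableSpace (PotUnit 𝒳) :=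
  MeasurableSpace.comap covariate inferInstance

theorem covSigma_le (𝒳 : Type*) [MeasurableSpace 𝒳] :
    covSigma 𝒳 ≤ (inferInstance : MeasurableSpace (PotUnit 𝒳)) :=
  measurable_fst.comap_le

/-- `e` is (a version of) the propensity score `e(x) = ℙ(D = 1 ∣ X = x)`. -/
structure IsPropensityScore {𝒳 : Type*} [MeasurableSpace 𝒳]
    (P : Measure (PotUnit 𝒳)) (e : 𝒳 → ℝ) : Prop where
  measurable : Measurable e
  ae_eq : (fun w => e (covariate w)) =ᵐ[P] P⟦{w | treatment w = true} | covSigma 𝒳⟧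

/-- Strong ignorability: unconfoundedness and overlap. -/
structure StrongIgnorability {𝒳 : Type*} [MeasurableSpace 𝒳] [StandardBorelSpace 𝒳]
    (P : Measure (PotUnit 𝒳)) [IsProbabilityMeasure P] (e : 𝒳 → ℝ) : Prop where
  unconfounded : CondIndepFun (covSigma 𝒳) (covSigma_le 𝒳)
    (fun w => (potOutcome false w, potOutcome true w)) treatment P
  overlap : ∃ c : ℝ, 0 < c ∧ ∀ᵐ w ∂P, c ≤ e (covariate w) ∧ e (covariate w) ≤ 1 - c

/-- Uniformly bounded conditional means, and conditional variances bounded above and away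
from zero, of the potential outcomes given the covariates. -/
structure BoundedCondMoments {𝒳 : Type*} [MeasurableSpace 𝒳]
    (P : Measure (PotUnit 𝒳)) : Prop where
  mean : ∀ d : Bool, ∃ M : ℝ, ∀ᵐ w ∂P, |(P[potOutcome d | covSigma 𝒳]) w| ≤ M
  variance : ∀ d : Bool, ∃ s S : ℝ, 0 < s ∧
    ∀ᵐ w ∂P, s ≤ (Var[potOutcome d; P | covSigma 𝒳]) w ∧
      (Var[potOutcome d; P | covSigma 𝒳]) w ≤ S

/-- The potential outcomes have finite fourth moments. -/
def FourthMoment {𝒳 : Type*} [MeasurableSpace 𝒳] (P : Measure (PotUnit 𝒳)) : Prop :=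
  ∀ d : Bool, MemLp (potOutcome d) 4 P

/-! ### Policies -/

/-- A (possibly stochastic) policy: a measurable map from covariates to treatment
probabilities. -/
def IsPolicy {𝒳 : Type*} [MeasurableSpace 𝒳] (π : 𝒳 → ℝ) : Prop :=
  Measurable π ∧ ∀ x, π x ∈ Set.Icc (0 : ℝ) 1

/-- The value `V(π) = 𝔼[Y(1) π(X) + Y(0) (1 - π(X))]`. -/
def policyValue {𝒳 : Type*} [MeasurableSpace 𝒳] (P : Measure (PotUnit 𝒳)) (π : 𝒳 → ℝ) : ℝ :=
  ∫ w, (potOutcome true w * π (covariate w) + potOutcome false w * (1 - π (covariate w))) ∂P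

/-- The value difference `Δ(π; π') = V(π) - V(π')`. -/
def valueDiff {𝒳 : Type*} [MeasurableSpace 𝒳] (P : Measure (PotUnit 𝒳)) (π π' : 𝒳 → ℝ) : ℝ :=
  policyValue P π - policyValue P π'

/-- The distance `𝔼_X |π(X) - π'(X)|`. -/
def policyDist {𝒳 : Type*} [MeasurableSpace 𝒳] (P : Measure (PotUnit 𝒳)) (π π' : 𝒳 → ℝ) : ℝ :=
  ∫ w, |π (covariate w) - π' (covariate w)| ∂P

/-- A policy learning algorithm: a map from data sets (of any size) to policies. The second
clause is joint measurability in the data and the covariates. -/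
structure IsLearningAlgorithm {𝒳 : Type*} [MeasurableSpace 𝒳]
    (A : (n : ℕ) → (Fin n → Obs 𝒳) → 𝒳 → ℝ) : Prop where
  mem_Icc : ∀ n D x, A n D x ∈ Set.Icc (0 : ℝ) 1
  measurable : ∀ n, Measurable fun q : (Fin n → Obs 𝒳) × 𝒳 => A n q.1 q.2

/-! ### Cramming

The observations `z 0, z 1, …` are cut into consecutive batches of size `B`; the batches are
numbered from `1`. -/

/-- The indices of the observations in batch `j ≥ 1`. -/
def batch (B j : ℕ) : Finset ℕ := Finset.Ico ((j - 1) * B) (j * B)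

/-- The learned policy `π̂_t`: the algorithm applied to the first `t` batches; `π̂_0 = π₀`. -/
def learned {𝒳 : Type*} (A : (n : ℕ) → (Fin n → Obs 𝒳) → 𝒳 → ℝ) (π₀ : 𝒳 → ℝ) (B : ℕ)
    (z : ℕ → Obs 𝒳) (t : ℕ) : 𝒳 → ℝ :=
  if t = 0 then π₀ else A (t * B) fun i => z i

/-- The stabilization condition: for some `δ, R₁, K₀ > 0` and all `t ≥ R₁`, almost surely
`t^(1+δ) Q_t ≤ K₀`, where `Q_t = 𝔼_X |π̂_t(X) - π̂_{t-1}(X)|`. -/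
def Stabilization {𝒳 Ω : Type*} [MeasurableSpace 𝒳] [MeasurableSpace Ω] (μ : Measure Ω)
    (P : Measure (PotUnit 𝒳)) (πhat : Ω → ℕ → 𝒳 → ℝ) : Prop :=
  ∃ (δ : ℝ) (R₁ : ℕ) (K₀ : ℝ), 0 < δ ∧ 0 < R₁ ∧ 0 < K₀ ∧ ∀ t : ℕ, R₁ ≤ t →
    ∀ᵐ ω ∂μ, (t : ℝ) ^ (1 + δ) * policyDist P (πhat ω t) (πhat ω (t - 1)) ≤ K₀

/-- `πinf` is a limit policy of the sequence `π`: a policy with `𝔼_X |πinf(X) - π_t(X)| → 0`.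
Limit policies agree for almost every `X`. -/
def IsLimitPolicy {𝒳 : Type*} [MeasurableSpace 𝒳] (P : Measure (PotUnit 𝒳))
    (π : ℕ → 𝒳 → ℝ) (πinf : 𝒳 → ℝ) : Prop :=
  IsPolicy πinf ∧ Tendsto (fun t => policyDist P πinf (π t)) atTop (𝓝 0)

/-- For some `M₁ > 0`, almost surely the limit policy of the learned policies is at distance
more than `M₁` from the baseline policy. (Under `Stabilization` a limit policy exists almost
surely, and it is unique up to null sets of covariates.) -/
def LimitDiffers {𝒳 Ω : Type*} [MeasurableSpace 𝒳] [MeasurableSpace Ω] (μ : Measure Ω)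
    (P : Measure (PotUnit 𝒳)) (π₀ : 𝒳 → ℝ) (πhat : Ω → ℕ → 𝒳 → ℝ) : Prop :=
  ∃ M₁ : ℝ, 0 < M₁ ∧ ∀ᵐ ω ∂μ, ∀ πinf : 𝒳 → ℝ, IsLimitPolicy P (πhat ω) πinf →
    M₁ < policyDist P π₀ πinf

/-! ### The crammed estimators -/

/-- The inverse probability weighted score `Y D / e(X) - Y (1 - D) / (1 - e(X))`. -/
def ipwScore {𝒳 : Type*} (e : 𝒳 → ℝ) (o : Obs 𝒳) : ℝ :=
  let D : ℝ := if o.2.1 then 1 else 0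
  o.2.2 * D / e o.1 - o.2.2 * (1 - D) / (1 - e o.1)

/-- `Γ̂_{tj}`, the estimate of `Δ(π̂_t; π̂_{t-1})` from batch `j`. -/
def gammaHat {𝒳 : Type*} (e : 𝒳 → ℝ) (B : ℕ) (z : ℕ → Obs 𝒳) (π : ℕ → 𝒳 → ℝ)
    (t j : ℕ) : ℝ :=
  1 / (B : ℝ) * ∑ i ∈ batch B j, ipwScore e (z i) * (π t (z i).1 - π (t - 1) (z i).1)

/-- `Δ̂(π̂_t; π̂_{t-1})`, the average of `Γ̂_{tj}` over the remaining batches. -/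
def stepEstimator {𝒳 : Type*} (e : 𝒳 → ℝ) (B : ℕ) (z : ℕ → Obs 𝒳) (π : ℕ → 𝒳 → ℝ)
    (T t : ℕ) : ℝ :=
  1 / ((T : ℝ) - t) * ∑ j ∈ Finset.Icc (t + 1) T, gammaHat e B z π t j

/-- The crammed policy evaluation estimator `Δ̂(π̂_T; π₀)`. -/
def crammedEstimator {𝒳 : Type*} (e : 𝒳 → ℝ) (B : ℕ) (z : ℕ → Obs 𝒳) (π : ℕ → 𝒳 → ℝ)
    (T : ℕ) : ℝ :=
  ∑ t ∈ Finset.Icc 1 (T - 1), stepEstimator e B z π T t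

/-- `ĝ_{Tj}(Z)`. -/
def gHat {𝒳 : Type*} (e : 𝒳 → ℝ) (π : ℕ → 𝒳 → ℝ) (T j : ℕ) (o : Obs 𝒳) : ℝ :=
  ipwScore e o * ∑ t ∈ Finset.Icc 1 (j - 1), (π t o.1 - π (t - 1) o.1) / ((T : ℝ) - t)

/-- `ḡ_{Tj}`, the average of `ĝ_{Tj}` over batches `j, …, T`. -/
def gBar {𝒳 : Type*} (e : 𝒳 → ℝ) (B : ℕ) (z : ℕ → Obs 𝒳) (π : ℕ → 𝒳 → ℝ) (T j : ℕ) : ℝ :=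
  1 / ((B : ℝ) * ((T : ℝ) - j + 1)) *
    ∑ k ∈ Finset.Icc j T, ∑ i ∈ batch B k, gHat e π T j (z i)

/-- The sample variance of `ĝ_{Tj}` over batches `j, …, T` (zero if `B = 1` and `j = T`). -/
def sampleVar {𝒳 : Type*} (e : 𝒳 → ℝ) (B : ℕ) (z : ℕ → Obs 𝒳) (π : ℕ → 𝒳 → ℝ)
    (T j : ℕ) : ℝ :=
  if B = 1 ∧ j = T then 0 else
    1 / ((B : ℝ) * ((T : ℝ) - j + 1) - 1) *
      ∑ k ∈ Finset.Icc j T, ∑ i ∈ batch B k, (gHat e π T j (z i) - gBar e B z π T j) ^ 2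

/-- The crammed variance estimator `v̂²_T`. -/
def varEstimator {𝒳 : Type*} (e : 𝒳 → ℝ) (B : ℕ) (z : ℕ → Obs 𝒳) (π : ℕ → 𝒳 → ℝ)
    (T : ℕ) : ℝ :=
  (T : ℝ) / B * ∑ j ∈ Finset.Icc 2 T, sampleVar e B z π T j

/-- `v̂_T`. -/
def sdEstimator {𝒳 : Type*} (e : 𝒳 → ℝ) (B : ℕ) (z : ℕ → Obs 𝒳) (π : ℕ → 𝒳 → ℝ)
    (T : ℕ) : ℝ :=
  √(varEstimator e B z π T)

end Cram

end

/-! Estimator and target are both linear in the policy increments, so the estimation error can be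
rearranged by observations. Observation `i` is scored only with policies learned before its batch:
with `m = i / B`, its weight is `∑_{t ≤ m} (π_t - π_{t-1}) / (T - t)`. If every `1 / (T - t)` were
`1 / T`, this would telescope to `(π_m - π_0) / T`. Calling the difference the excess,
`crammedEstimator_sub_eq` writes the error as a main martingale, an excess martingale, and minus the
value of the last update, which no batch is left to estimate. The excess weights are small both in
supremum norm (`abs_excess_le`) and, by stabilization, in `L¹`; the product of the two bounds makes
them negligible (`smallInProb_excess`, `tendsto_weight_discrepancy`).

The limit policy depends on the data, so the conditional variance `V_T` of the score weighted by
`π_T - π_0` has no deterministic limit. Stable convergence is avoided as follows. Each summand is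
divided by its own conditional standard deviation. The standardized scores have conditional variance
exactly one, so their normalized sum `S_T` obeys a central limit theorem proved by a recursion for
characteristic functions (`tendstoInDistribution_martingale`). The conditional variance is Lipschitz
in the `L¹` policy distance and bounded below, so the standard deviations have summable increments,
and summation by parts pulls the last one out: `√T · error = √(V_T / B) · S_T + o_P(1)`
(`smallInProb_error_sub`).

In the variance estimator, each sample variance concerns a weight fixed before its sample. It is
therefore close in `L¹` to the conditional variance, and averaging over starting batches gives that
`v̂_T² - V_T / B` tends to zero in probability (`smallInProb_varEstimator_sub`). As `V_T` stays
bounded below, the studentized error is `S_T + o_P(1)`.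

The population enters only through `RegularScore`: second moments bounded linearly in `𝔼|f(X)|`, and
variances bounded below by a multiple of `(𝔼|f(X)|)²`. The assumptions on the algorithm enter only
through `PolicyProcess` and a lower bound for the distance to the baseline. The probabilistic
argument runs on the product space of observation sequences. -/

namespace Cram

/-! ### Martingale tools on the space of i.i.d. sequences -/

section Predictable

variable {𝒵 : Type*} [MeasurableSpace 𝒵] (Q : Measure 𝒵) [IsProbabilityMeasure Q]

/-- The law of an i.i.d. sequence with marginal law `Q`. -/
noncomputable abbrev seqLaw : Measure (ℕ → 𝒵) := Measure.infinitePi fun _ : ℕ => Q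

variable {Q}

theorem _root_.DependsOn.postcomp {ι α β γ : Type*} {f : (ι → α) → β} {s : Set ι}
    (hf : DependsOn f s) (g : β → γ) : DependsOn (fun x => g (f x)) s :=
  fun _ _ h => congrArg g (hf h)

/-- A function of the first `n` observations and the next one has the same law as the function
applied to the first `n` observations and an independent new one. -/
theorem identDistrib_of_dependsOn {β : Type*} [MeasurableSpace β]
    {H : (ℕ → 𝒵) → 𝒵 → β} (hH : Measurable fun p : (ℕ → 𝒵) × 𝒵 => H p.1 p.2) {m n : ℕ}
    (hd : DependsOn H (Set.Iio m)) (hmn : m ≤ n) :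
    IdentDistrib (fun s => H s (s n)) (fun p : (ℕ → 𝒵) × 𝒵 => H p.1 p.2)
      (seqLaw Q) ((seqLaw Q).prod Q) := by
  obtain ⟨z₀⟩ : Nonempty 𝒵 := nonempty_of_isProbabilityMeasure Q
  -- Overwriting the coordinates from `n` on by a constant changes no value of `H`, since `m ≤ n`,
  -- and leaves a function of the first `n` coordinates only, which is independent of the `n`-th.
  let tr : (ℕ → 𝒵) → ℕ → 𝒵 := fun s k => if k < n then s k else z₀
  have htr : Measurable tr := by
    refine measurable_pi_lambda _ fun k => ?_
    by_cases hk : k < n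
    · simpa [tr, hk] using measurable_pi_apply k
    · simp [tr, hk]
  have hHtr : ∀ s, H (tr s) = H s := fun s => hd fun k hk => by
    have : k < n := lt_of_lt_of_le hk hmn
    simp [tr, this]
  have hind : iIndepFun (fun (i : ℕ) (s : ℕ → 𝒵) => s i) (seqLaw Q) :=
    iIndepFun_infinitePi (P := fun _ : ℕ => Q) (X := fun _ z => z) fun _ => measurable_id
  have h1 : IndepFun tr (fun s => s n) (seqLaw Q) := by
    have := hind.indepFun_finset (Finset.range n) {n} (by simp) (fun i => measurable_pi_apply i)
    have hψ : Measurable fun (p : ({n} : Finset ℕ) → 𝒵) => p ⟨n, by simp⟩ :=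
      measurable_pi_apply _
    have h2 := this.comp
      (φ := fun (p : Finset.range n → 𝒵) (k : ℕ) =>
        if hk : k < n then p ⟨k, Finset.mem_range.2 hk⟩ else z₀)
      (ψ := fun (p : ({n} : Finset ℕ) → 𝒵) => p ⟨n, by simp⟩)
      (by
        refine measurable_pi_lambda _ fun k => ?_
        by_cases hk : k < n
        · simpa [hk] using measurable_pi_apply _
        · simp [hk])
      hψ
    convert! h2 using 1
  have hev : (seqLaw Q).map (fun s => s n) = Q := Measure.infinitePi_map_eval (fun _ => Q) n
  have h3 := (indepFun_iff_map_prod_eq_prod_map_map htr.aemeasurable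
    (measurable_pi_apply n).aemeasurable).1 h1
  rw [hev] at h3
  have h4 : ((seqLaw Q).prod Q).map (Prod.map tr id) = ((seqLaw Q).map tr).prod Q := by
    rw [← Measure.map_prod_map _ _ htr measurable_id, Measure.map_id]
  refine ⟨(hH.comp (measurable_id.prodMk (measurable_pi_apply n))).aemeasurable,
    hH.aemeasurable, ?_⟩
  have e1 : (fun s => H s (s n)) =
      (fun p : (ℕ → 𝒵) × 𝒵 => H p.1 p.2) ∘ fun s => (tr s, s n) := by
    funext s; simp [hHtr]
  have e2 : (fun p : (ℕ → 𝒵) × 𝒵 => H p.1 p.2) =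
      (fun p : (ℕ → 𝒵) × 𝒵 => H p.1 p.2) ∘ Prod.map tr id := by
    funext p; simp [hHtr]
  rw [e1, ← Measure.map_map hH (htr.prodMk (measurable_pi_apply n)), h3]
  conv_rhs => rw [e2, ← Measure.map_map hH (htr.prodMap measurable_id), h4]

/-- A nonnegative function of the past and the next observation with uniformly bounded conditional
mean is integrable. -/
theorem integrable_of_condMean_le {H : (ℕ → 𝒵) → 𝒵 → ℝ}
    (hH : Measurable fun p : (ℕ → 𝒵) × 𝒵 => H p.1 p.2) {m n : ℕ}
    (hd : DependsOn H (Set.Iio m)) (hmn : m ≤ n) {c : ℝ}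
    (hi : ∀ᵐ s ∂seqLaw Q, Integrable (H s) Q)
    (hc : ∀ᵐ s ∂seqLaw Q, ∫ z, |H s z| ∂Q ≤ c) :
    Integrable (fun p : (ℕ → 𝒵) × 𝒵 => H p.1 p.2) ((seqLaw Q).prod Q) ∧
    Integrable (fun s => H s (s n)) (seqLaw Q) ∧
      ∫ s, H s (s n) ∂seqLaw Q = ∫ s, ∫ z, H s z ∂Q ∂seqLaw Q ∧
      ∫ s, |H s (s n)| ∂seqLaw Q ≤ c := by
  have hid := identDistrib_of_dependsOn (Q := Q) hH hd hmn
  have hint : Integrable (fun p : (ℕ → 𝒵) × 𝒵 => H p.1 p.2) ((seqLaw Q).prod Q) := by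
    rw [integrable_prod_iff hH.aestronglyMeasurable]
    refine ⟨hi, Integrable.of_bound (C := c) ?_ ?_⟩
    · exact hH.norm.stronglyMeasurable.integral_prod_right.aestronglyMeasurable
    · filter_upwards [hc] with s hs
      rw [Real.norm_of_nonneg (integral_nonneg fun _ => norm_nonneg _)]
      exact hs
  have hint' := hid.integrable_iff.2 hint
  refine ⟨hint, hint', ?_, ?_⟩
  · rw [hid.integral_eq, integral_prod _ hint]
  · have hid' := identDistrib_of_dependsOn (Q := Q) (H := fun s z => |H s z|) (n := n)
      (by simpa using hH.norm) (hd.postcomp fun f z => |f z|) hmn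
    rw [hid'.integral_eq, integral_prod _ hint.abs]
    calc _ ≤ ∫ _, c ∂seqLaw Q := by
          refine integral_mono_ae hint.abs.integral_prod_left (integrable_const c) ?_
          filter_upwards [hc] with s hs using hs
      _ = c := by simp

/-- Second moment bound for a sum of martingale differences. -/
theorem sq_sum_martingale_le (I : Finset ℕ) {H : ℕ → (ℕ → 𝒵) → 𝒵 → ℝ} {c : ℕ → ℝ}
    (hH : ∀ i ∈ I, Measurable fun p : (ℕ → 𝒵) × 𝒵 => H i p.1 p.2)
    (hd : ∀ i ∈ I, DependsOn (H i) (Set.Iio i))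
    (hmean : ∀ i ∈ I, ∀ᵐ s ∂seqLaw Q, ∫ z, H i s z ∂Q = 0)
    (hi : ∀ i ∈ I, ∀ᵐ s ∂seqLaw Q, Integrable (fun z => H i s z ^ 2) Q)
    (hc : ∀ i ∈ I, ∀ᵐ s ∂seqLaw Q, ∫ z, H i s z ^ 2 ∂Q ≤ c i) :
    MemLp (fun s => ∑ i ∈ I, H i s (s i)) 2 (seqLaw Q) ∧
      ∫ s, (∑ i ∈ I, H i s (s i)) ^ 2 ∂seqLaw Q ≤ ∑ i ∈ I, c i := by
  have hev : ∀ i ∈ I, Measurable fun s : ℕ → 𝒵 => H i s (s i) := fun i hiI =>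
    (hH i hiI).comp (measurable_id.prodMk (measurable_pi_apply i))
  have hsq : ∀ i ∈ I, MemLp (fun s : ℕ → 𝒵 => H i s (s i)) 2 (seqLaw Q) ∧
      ∫ s, H i s (s i) ^ 2 ∂seqLaw Q ≤ c i := by
    intro i hiI
    obtain ⟨-, h1, -, h2⟩ := integrable_of_condMean_le (Q := Q)
      (H := fun s z => H i s z ^ 2) (n := i)
      ((hH i hiI).pow_const 2) ((hd i hiI).postcomp fun f z => f z ^ 2) le_rfl (hi i hiI)
      (c := c i) (by simpa using hc i hiI)
    exact ⟨(memLp_two_iff_integrable_sq (hev i hiI).aestronglyMeasurable).2 h1, by simpa using h2⟩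
  have hL2 : MemLp (fun s => ∑ i ∈ I, H i s (s i)) 2 (seqLaw Q) :=
    memLp_finsetSum I fun i hiI => (hsq i hiI).1
  have horth : ∀ i ∈ I, ∀ j ∈ I, i < j →
      ∫ s, H i s (s i) * H j s (s j) ∂seqLaw Q = 0 := by
    -- For `i < j` the factor with index `i` is already determined by the first `j` coordinates, so
    -- the inner integral over the `j`-th coordinate kills the product.
    intro i hiI j hjI hij
    let K : (ℕ → 𝒵) → 𝒵 → ℝ := fun s z => H i s (s i) * H j s z
    have hK : Measurable fun p : (ℕ → 𝒵) × 𝒵 => K p.1 p.2 :=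
      ((hev i hiI).comp measurable_fst).mul (hH j hjI)
    have hKd : DependsOn K (Set.Iio j) := by
      intro s s' hs
      have h1 : H i s = H i s' := hd i hiI fun k hk => hs k (lt_trans hk hij)
      have h2 : H j s = H j s' := hd j hjI hs
      simp only [K, h1, h2, hs i hij]
    have hid := identDistrib_of_dependsOn (Q := Q) hK hKd le_rfl
    have hint : Integrable (fun s => K s (s j)) (seqLaw Q) :=
      (hsq i hiI).1.integrable_mul (hsq j hjI).1
    change ∫ s, K s (s j) ∂seqLaw Q = 0
    rw [hid.integral_eq, integral_prod _ (hid.integrable_iff.1 hint)]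
    refine integral_eq_zero_of_ae ?_
    filter_upwards [hmean j hjI] with s hs
    simp [K, integral_const_mul, hs]
  refine ⟨hL2, ?_⟩
  have hexp : ∀ s, (∑ i ∈ I, H i s (s i)) ^ 2 =
      ∑ i ∈ I, ∑ j ∈ I, H i s (s i) * H j s (s j) := fun s => by
    rw [sq, Finset.sum_mul_sum]
  simp_rw [hexp]
  have hint : ∀ i ∈ I, ∀ j ∈ I,
      Integrable (fun s => H i s (s i) * H j s (s j)) (seqLaw Q) := fun i hiI j hjI =>
    (hsq i hiI).1.integrable_mul (hsq j hjI).1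
  rw [integral_finsetSum _ fun i hiI => integrable_finsetSum _ (hint i hiI)]
  refine Finset.sum_le_sum fun i hiI => ?_
  rw [integral_finsetSum _ (hint i hiI), Finset.sum_eq_single_of_mem i hiI]
  · simpa [sq] using (hsq i hiI).2
  · intro j hjI hji
    rcases lt_or_gt_of_ne hji with h | h
    · simpa [mul_comm] using horth j hjI i hiI h
    · exact horth i hiI j hjI h

/-- For `|y| ≤ 1` this is the remainder of the exponential series; for `|y| ≥ 1` every term is at
most a multiple of `|y| ^ 3`. The constant is not sharp. -/
theorem norm_exp_mul_I_taylor_le (y : ℝ) :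
    ‖Complex.exp (y * Complex.I) - (1 + y * Complex.I - y ^ 2 / 2)‖ ≤ 4 * |y| ^ 3 := by
  rcases le_total |y| 1 with hy | hy
  · have := Complex.exp_bound (x := y * Complex.I) (by simpa using hy) (n := 3) (by norm_num)
    have h2 : ∑ m ∈ Finset.range 3, ((y : ℂ) * Complex.I) ^ m / m.factorial =
        1 + y * Complex.I - y ^ 2 / 2 := by
      simp [Finset.sum_range_succ, mul_pow]
      ring
    rw [h2] at this
    refine this.trans ?_
    have h3 : 0 ≤ |y| ^ 3 := by positivity
    simp [Nat.factorial]
    linarith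
  · have h1 : ‖Complex.exp (y * Complex.I)‖ = 1 := Complex.norm_exp_ofReal_mul_I y
    have h2 : ‖(1 + y * Complex.I - y ^ 2 / 2 : ℂ)‖ ≤ 1 + |y| + |y| ^ 2 / 2 := by
      refine (norm_sub_le _ _).trans (add_le_add ((norm_add_le _ _).trans ?_) ?_) <;> simp
    refine (norm_sub_le _ _).trans ?_
    rw [h1]
    nlinarith [mul_le_mul hy hy zero_le_one (abs_nonneg y), pow_le_pow_right₀ hy (show 2 ≤ 3 by norm_num),
      pow_le_pow_right₀ hy (show 1 ≤ 3 by norm_num), one_le_pow₀ hy (n := 3)]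

/-- Martingale central limit theorem for martingale differences with conditional variance one and
bounded conditional third moments. -/
theorem tendstoInDistribution_martingale {H : ℕ → (ℕ → 𝒵) → 𝒵 → ℝ} {M : ℝ}
    (hH : ∀ i, Measurable fun p : (ℕ → 𝒵) × 𝒵 => H i p.1 p.2)
    (hd : ∀ i, DependsOn (H i) (Set.Iio i))
    (hmean : ∀ i, ∀ᵐ s ∂seqLaw Q, ∫ z, H i s z ∂Q = 0)
    (hvar : ∀ i, ∀ᵐ s ∂seqLaw Q, ∫ z, H i s z ^ 2 ∂Q = 1)
    (hi3 : ∀ i, ∀ᵐ s ∂seqLaw Q, MemLp (H i s) 3 Q)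
    (h3 : ∀ i, ∀ᵐ s ∂seqLaw Q, ∫ z, |H i s z| ^ 3 ∂Q ≤ M) :
    TendstoInDistribution (fun (n : ℕ) s => (√(n : ℝ))⁻¹ * ∑ i ∈ Finset.range n, H i s (s i))
      atTop (id : ℝ → ℝ) (fun _ => seqLaw Q) (gaussianReal 0 1) := by
  have hev : ∀ i, Measurable fun s : ℕ → 𝒵 => H i s (s i) := fun i =>
    (hH i).comp (measurable_id.prodMk (measurable_pi_apply i))
  have hM : 0 ≤ M := by
    obtain ⟨s, hs⟩ := (h3 0).exists
    exact (integral_nonneg fun z => by positivity).trans hs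
  let U : ℕ → (ℕ → 𝒵) → ℝ := fun k s => ∑ i ∈ Finset.range k, H i s (s i)
  have hU : ∀ k, Measurable (U k) := fun k => Finset.measurable_fun_sum _ fun i _ => hev i
  have hUd : ∀ k, DependsOn (U k) (Set.Iio k) := by
    intro k s s' hs
    refine Finset.sum_congr rfl fun i hik => ?_
    have hik := Finset.mem_range.1 hik
    have : H i s = H i s' := hd i fun j hj => hs j (lt_trans hj hik)
    rw [this, hs i hik]
  let φ : ℝ → ℕ → ℂ := fun θ k => ∫ s, Complex.exp ((θ * U k s : ℝ) * Complex.I) ∂seqLaw Q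
  -- Conditioning on the first `k` coordinates factors out `exp(iθ U_k)`. The conditional
  -- characteristic function of the next term is `1 - θ² / 2` up to the third-order remainder,
  -- because its first two conditional moments are exactly 0 and 1. That the conditional variance is
  -- not random is what closes the recursion.
  have hstep : ∀ θ k, ‖φ θ (k + 1) - (1 - θ ^ 2 / 2 : ℝ) * φ θ k‖ ≤ 4 * |θ| ^ 3 * M := by
    intro θ k
    let K : (ℕ → 𝒵) → 𝒵 → ℂ := fun s z => Complex.exp ((θ * (U k s + H k s z) : ℝ) * Complex.I)
    have hK : Measurable fun p : (ℕ → 𝒵) × 𝒵 => K p.1 p.2 := by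
      have h1 := (hU k).comp (measurable_fst : Measurable fun p : (ℕ → 𝒵) × 𝒵 => p.1)
      have h2 := hH k
      simp only [Function.comp_def] at h1
      fun_prop
    have hKd : DependsOn K (Set.Iio k) := by
      intro s s' hs
      have h1 : U k s = U k s' := hUd k hs
      have h2 : H k s = H k s' := hd k hs
      simp only [K, h1, h2]
    have hKi : Integrable (fun p : (ℕ → 𝒵) × 𝒵 => K p.1 p.2) ((seqLaw Q).prod Q) :=
      Integrable.of_bound hK.aestronglyMeasurable 1 (ae_of_all _ fun p => by
        simp only [K]; rw [Complex.norm_exp_ofReal_mul_I])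
    have hid := identDistrib_of_dependsOn (Q := Q) hK hKd le_rfl
    have e1 : φ θ (k + 1) = ∫ s, Complex.exp ((θ * U k s : ℝ) * Complex.I) *
        ∫ z, Complex.exp ((θ * H k s z : ℝ) * Complex.I) ∂Q ∂seqLaw Q := by
      have : φ θ (k + 1) = ∫ s, K s (s k) ∂seqLaw Q := by
        simp only [φ, K, U, Finset.sum_range_succ]
      rw [this, hid.integral_eq, integral_prod _ hKi]
      refine integral_congr_ae (ae_of_all _ fun s => ?_)
      simp only [K, ← integral_const_mul]
      refine integral_congr_ae (ae_of_all _ fun z => ?_)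
      simp only [← Complex.exp_add]
      congr 1
      push_cast
      ring
    have hE1 : Measurable fun s => Complex.exp ((θ * U k s : ℝ) * Complex.I) := by
      have := hU k
      fun_prop
    have hE2 : StronglyMeasurable fun s => ∫ z, Complex.exp ((θ * H k s z : ℝ) * Complex.I) ∂Q := by
      have : Measurable fun p : (ℕ → 𝒵) × 𝒵 =>
          Complex.exp ((θ * H k p.1 p.2 : ℝ) * Complex.I) := by
        have := hH k
        fun_prop
      exact this.stronglyMeasurable.integral_prod_right
    have hn1 : ∀ s, ‖Complex.exp ((θ * U k s : ℝ) * Complex.I)‖ = 1 := fun s =>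
      Complex.norm_exp_ofReal_mul_I _
    have hI1 : Integrable (fun s => Complex.exp ((θ * U k s : ℝ) * Complex.I)) (seqLaw Q) :=
      Integrable.of_bound hE1.aestronglyMeasurable 1 (ae_of_all _ fun s => (hn1 s).le)
    have hI2 : Integrable (fun s => Complex.exp ((θ * U k s : ℝ) * Complex.I) *
        ∫ z, Complex.exp ((θ * H k s z : ℝ) * Complex.I) ∂Q) (seqLaw Q) := by
      refine Integrable.of_bound (hE1.aestronglyMeasurable.mul hE2.aestronglyMeasurable) 1
        (ae_of_all _ fun s => ?_)
      rw [norm_mul, hn1, one_mul]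
      calc _ ≤ ∫ z, ‖Complex.exp ((θ * H k s z : ℝ) * Complex.I)‖ ∂Q := norm_integral_le_integral_norm _
        _ = 1 := by simp_rw [Complex.norm_exp_ofReal_mul_I]; simp
    rw [e1, ← integral_const_mul, ← integral_sub hI2 (hI1.const_mul _)]
    refine (norm_integral_le_of_norm_le_const (C := 4 * |θ| ^ 3 * M) ?_).trans (by simp)
    filter_upwards [hmean k, hvar k, hi3 k, h3 k] with s m1 m2 m3 m4
    rw [mul_comm ((1 - θ ^ 2 / 2 : ℝ) : ℂ), ← mul_sub, norm_mul, hn1, one_mul]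
    have i1 : Integrable (H k s) Q := m3.integrable (by norm_num)
    have i2 : Integrable (fun z => H k s z ^ 2) Q := by
      have : MemLp (H k s) 2 Q := m3.mono_exponent (by norm_num)
      exact this.integrable_sq
    have i3 : Integrable (fun z => |H k s z| ^ 3) Q := by
      simpa using m3.integrable_norm_pow (p := 3) (by norm_num)
    have hHs : Measurable (H k s) := (hH k).comp measurable_prodMk_left
    have i0 : Integrable (fun z => Complex.exp ((θ * H k s z : ℝ) * Complex.I)) Q :=
      Integrable.of_bound (by fun_prop) 1
        (ae_of_all _ fun z => by rw [Complex.norm_exp_ofReal_mul_I])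
    have i4 : Integrable (fun z => (1 + (θ * H k s z : ℝ) * Complex.I -
        ((θ * H k s z : ℝ) : ℂ) ^ 2 / 2 : ℂ)) Q := by
      refine ((integrable_const _).add (((i1.const_mul θ).ofReal).mul_const _)).sub ?_
      have := ((i2.const_mul (θ ^ 2)).ofReal (𝕜 := ℂ)).div_const 2
      refine this.congr (ae_of_all _ fun z => ?_)
      simp
      ring
    have e4 : ∫ z, (1 + (θ * H k s z : ℝ) * Complex.I -
        ((θ * H k s z : ℝ) : ℂ) ^ 2 / 2 : ℂ) ∂Q = (1 - θ ^ 2 / 2 : ℝ) := by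
      rw [integral_sub ((integrable_const _).add (((i1.const_mul θ).ofReal).mul_const _)),
        integral_add (integrable_const _) (((i1.const_mul θ).ofReal).mul_const _),
        integral_mul_const, integral_complex_ofReal, integral_const_mul, m1]
      · have : ∀ z, ((θ * H k s z : ℝ) : ℂ) ^ 2 / 2 = ((θ ^ 2 / 2 * H k s z ^ 2 : ℝ) : ℂ) := by
          intro z
          push_cast
          ring
        simp_rw [this]
        rw [integral_complex_ofReal, integral_const_mul, m2]
        simp
      · have := ((i2.const_mul (θ ^ 2)).ofReal (𝕜 := ℂ)).div_const 2
        refine this.congr (ae_of_all _ fun z => ?_)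
        simp
        ring
    rw [← e4, ← integral_sub i0 i4]
    refine (norm_integral_le_of_norm_le ((i3.const_mul (4 * |θ| ^ 3))) (ae_of_all _ fun z => ?_)).trans ?_
    · refine (norm_exp_mul_I_taylor_le (θ * H k s z)).trans_eq ?_
      rw [abs_mul]
      ring
    · rw [integral_const_mul]
      gcongr
  have hφ0 : ∀ θ, φ θ 0 = 1 := fun θ => by simp [φ, U]
  -- A factor of modulus at most one does not amplify earlier errors, so the one-step errors simply
  -- add up.
  have hiter : ∀ θ : ℝ, |1 - θ ^ 2 / 2| ≤ 1 → ∀ k : ℕ,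
      ‖φ θ k - ((1 - θ ^ 2 / 2 : ℝ) : ℂ) ^ k‖ ≤ k * (4 * |θ| ^ 3 * M) := by
    intro θ hθ k
    induction k with
    | zero => simp [hφ0]
    | succ k ih =>
      have e : φ θ (k + 1) - ((1 - θ ^ 2 / 2 : ℝ) : ℂ) ^ (k + 1) =
          (φ θ (k + 1) - (1 - θ ^ 2 / 2 : ℝ) * φ θ k) +
          (1 - θ ^ 2 / 2 : ℝ) * (φ θ k - ((1 - θ ^ 2 / 2 : ℝ) : ℂ) ^ k) := by ring
      rw [e]
      refine (norm_add_le _ _).trans ?_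
      have h5 : ‖((1 - θ ^ 2 / 2 : ℝ) : ℂ)‖ ≤ 1 := by
        rw [Complex.norm_real]; exact hθ
      rw [norm_mul]
      have := mul_le_mul h5 ih (norm_nonneg _) zero_le_one
      have h6 := hstep θ k
      push_cast at this h6 ⊢
      linarith
  refine ⟨fun n => (((hU n).const_mul _)).aemeasurable, by fun_prop, ?_⟩
  refine ProbabilityMeasure.tendsto_iff_tendsto_charFun.2 fun t => ?_
  have hmap : ∀ n : ℕ, charFun ((seqLaw Q).map
      fun s => (√(n : ℝ))⁻¹ * ∑ i ∈ Finset.range n, H i s (s i)) t = φ ((√(n : ℝ))⁻¹ * t) n := by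
    intro n
    rw [charFun_apply_real, integral_map ((hU n).const_mul _).aemeasurable (by fun_prop)]
    refine integral_congr_ae (ae_of_all _ fun s => ?_)
    simp only [U]
    push_cast
    ring_nf
  simp only [ProbabilityMeasure.coe_mk, hmap, Measure.map_id, charFun_gaussianReal]
  have hlim : Tendsto (fun n : ℕ => ((1 - ((√(n : ℝ))⁻¹ * t) ^ 2 / 2 : ℝ) : ℂ) ^ n) atTop
      (𝓝 (Complex.exp (t * (0 : ℝ) * Complex.I - (1 : NNReal) * t ^ 2 / 2))) := by
    have h1 : Tendsto (fun n : ℕ => (1 + (-(t ^ 2 / 2)) / n : ℝ) ^ n) atTop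
        (𝓝 (Real.exp (-(t ^ 2 / 2)))) := Real.tendsto_one_add_div_pow_exp _
    have h2 := (Complex.continuous_ofReal.tendsto _).comp h1
    have h3 : ((Real.exp (-(t ^ 2 / 2)) : ℝ) : ℂ) =
        Complex.exp (t * (0 : ℝ) * Complex.I - (1 : NNReal) * t ^ 2 / 2) := by
      push_cast
      congr 1
      simp
    rw [h3] at h2
    refine h2.congr fun n => ?_
    simp only [Function.comp_apply]
    rw [← Complex.ofReal_pow]
    congr 2
    rw [mul_pow, inv_pow, Real.sq_sqrt (Nat.cast_nonneg n)]
    ring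
  have hdiff : Tendsto (fun n : ℕ => φ ((√(n : ℝ))⁻¹ * t) n -
      ((1 - ((√(n : ℝ))⁻¹ * t) ^ 2 / 2 : ℝ) : ℂ) ^ n) atTop (𝓝 0) := by
    have hb : Tendsto (fun n : ℕ => 4 * |t| ^ 3 * M * (√(n : ℝ))⁻¹) atTop (𝓝 0) := by
      have : Tendsto (fun n : ℕ => (√(n : ℝ))⁻¹) atTop (𝓝 0) :=
        tendsto_inv_atTop_zero.comp (Real.tendsto_sqrt_atTop.comp tendsto_natCast_atTop_atTop)
      simpa using this.const_mul (4 * |t| ^ 3 * M)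
    refine squeeze_zero_norm' ?_ hb
    -- At `θ = t / √n`, the condition `t ^ 2 ≤ n` keeps `1 - θ² / 2` in `[-1, 1]`; the accumulated
    -- error is `n · 4|t|³M / n^(3/2)`.
    filter_upwards [eventually_ge_atTop (max 1 ⌈t ^ 2⌉₊)] with n hn
    have hn1 : (1 : ℝ) ≤ n := by exact_mod_cast (le_max_left _ _).trans hn
    have hn2 : t ^ 2 ≤ n := (Nat.le_ceil _).trans (by exact_mod_cast (le_max_right _ _).trans hn)
    have hs : ((√(n : ℝ))⁻¹ * t) ^ 2 ≤ 1 := by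
      rw [mul_pow, inv_pow, Real.sq_sqrt (Nat.cast_nonneg n), inv_mul_le_iff₀ (by linarith)]
      linarith
    refine (hiter _ ?_ n).trans_eq ?_
    · rw [abs_le]
      constructor <;> nlinarith [sq_nonneg ((√(n : ℝ))⁻¹ * t)]
    · have hpos : 0 < √(n : ℝ) := Real.sqrt_pos.2 (by linarith)
      have hsq : √(n : ℝ) ^ 2 = n := Real.sq_sqrt (Nat.cast_nonneg n)
      rw [abs_mul, abs_of_pos (inv_pos.2 hpos), mul_pow]
      nth_rewrite 1 [← hsq]
      field_simp
  simpa using hdiff.add hlim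

end Predictable


/-! ### The population: moments of the inverse probability weighted score -/

theorem integral_mul_condExp {Ω : Type*} {m mΩ : MeasurableSpace Ω} {μ : Measure Ω}
    [IsFiniteMeasure μ] (hm : m ≤ mΩ) {g f : Ω → ℝ} (hg : StronglyMeasurable[m] g)
    (hf : Integrable f μ) {c : ℝ} (hc : ∀ᵐ ω ∂μ, |g ω| ≤ c) :
    ∫ ω, g ω * f ω ∂μ = ∫ ω, g ω * (μ[f | m]) ω ∂μ := by
  rw [← integral_condExp hm (f := fun ω => g ω * f ω)]
  exact integral_congr_ae (condExp_stronglyMeasurable_mul_of_bound hm hg hf c hc)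

/-- A score `ψ` with bounded conditional second moment and conditional variance bounded away from
zero, expressed through integrals against functions of the covariates. -/
structure RegularScore {𝒳 : Type*} [MeasurableSpace 𝒳] (Q : Measure (Obs 𝒳)) (ψ : Obs 𝒳 → ℝ)
    (C s : ℝ) : Prop where
  measurable : Measurable ψ
  memLp : MemLp ψ 4 Q
  pos : 0 < s
  upper : ∀ f : 𝒳 → ℝ, Measurable f → (∀ x, |f x| ≤ 1) →
    ∫ o, ψ o ^ 2 * |f o.1| ∂Q ≤ C * ∫ o, |f o.1| ∂Q
  lower : ∀ f : 𝒳 → ℝ, Measurable f → (∀ x, |f x| ≤ 1) → ∀ a : ℝ,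
    s * (∫ o, |f o.1| ∂Q) ^ 2 ≤ ∫ o, (ψ o * f o.1 - a) ^ 2 ∂Q

theorem ipwScore_observe {𝒳 : Type*} {e : 𝒳 → ℝ} (w : PotUnit 𝒳) : ipwScore e (observe w) =
    if treatment w = true then potOutcome true w / e (covariate w)
      else -(potOutcome false w / (1 - e (covariate w))) := by
  cases h : treatment w <;> simp [ipwScore, observe, h]

section Population

variable {𝒳 : Type*} [MeasurableSpace 𝒳] {P : Measure (PotUnit 𝒳)} {e : 𝒳 → ℝ}

theorem measurable_covariate : Measurable (covariate : PotUnit 𝒳 → 𝒳) := measurable_fst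

theorem measurable_treatment : Measurable (treatment : PotUnit 𝒳 → Bool) :=
  measurable_fst.comp measurable_snd

theorem measurable_potOutcome (d : Bool) : Measurable (potOutcome d : PotUnit 𝒳 → ℝ) := by
  cases d
  · exact measurable_fst.comp (measurable_snd.comp measurable_snd)
  · exact measurable_snd.comp (measurable_snd.comp measurable_snd)

theorem measurableSet_treatment (d : Bool) : MeasurableSet {w : PotUnit 𝒳 | treatment w = d} :=
  measurable_treatment (measurableSet_singleton d)

theorem measurable_observe : Measurable (observe : PotUnit 𝒳 → Obs 𝒳) := by
  refine measurable_covariate.prodMk (measurable_treatment.prodMk ?_)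
  have : (fun w : PotUnit 𝒳 => potOutcome (treatment w) w) =
      fun w => if treatment w = true then potOutcome true w else potOutcome false w := by
    funext w
    cases treatment w <;> simp
  rw [this]
  exact Measurable.ite (measurableSet_treatment true) (measurable_potOutcome _)
    (measurable_potOutcome _)

theorem measurable_ipwScore (he : Measurable e) : Measurable (ipwScore e) := by
  have h : Measurable fun o : Obs 𝒳 => (if o.2.1 = true then (1 : ℝ) else 0) :=
    Measurable.ite ((measurable_fst.comp measurable_snd) (measurableSet_singleton true))
      measurable_const measurable_const
  unfold ipwScore
  have h2 : Measurable fun o : Obs 𝒳 => e o.1 := he.comp measurable_fst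
  fun_prop

theorem ae_condExp_sq_le [IsProbabilityMeasure P] (hb : BoundedCondMoments P) (h4 : FourthMoment P) (d : Bool) :
    ∃ C : ℝ, ∀ᵐ w ∂P, (P[potOutcome d ^ 2 | covSigma 𝒳]) w ≤ C := by
  obtain ⟨M, hM⟩ := hb.mean d
  obtain ⟨s, S, -, hS⟩ := hb.variance d
  refine ⟨S + M ^ 2, ?_⟩
  have h2 : MemLp (potOutcome d) 2 P := (h4 d).mono_exponent (by norm_num)
  filter_upwards [hM, hS, condVar_ae_eq_condExp_sq_sub_sq_condExp (covSigma_le 𝒳) h2] with w h1 h2 h3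
  simp only [Pi.sub_apply, Pi.pow_apply] at h3
  have := sq_le_sq' (abs_le.1 h1).1 (abs_le.1 h1).2
  linarith [h2.2]

/-- Conditionally on the covariates the second moment is bounded by the variance bound plus the
squared mean bound. The result is linear in `𝔼|f(X)|`, the form needed to exploit stabilization,
which is an `L¹` condition. -/
theorem integral_sq_potOutcome_mul_le [IsProbabilityMeasure P] (hb : BoundedCondMoments P) (h4 : FourthMoment P)
    (d : Bool) : ∃ C : ℝ, 0 ≤ C ∧ ∀ f : 𝒳 → ℝ, Measurable f → (∀ x, |f x| ≤ 1) →
      Integrable (fun w => |f (covariate w)| * potOutcome d w ^ 2) P ∧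
      ∫ w, |f (covariate w)| * potOutcome d w ^ 2 ∂P ≤ C * ∫ w, |f (covariate w)| ∂P := by
  obtain ⟨C, hC⟩ := ae_condExp_sq_le hb h4 d
  refine ⟨max C 0, le_max_right _ _, fun f hf hf1 => ?_⟩
  have h2 : MemLp (potOutcome d) 2 P := (h4 d).mono_exponent (by norm_num)
  have hYi : Integrable (potOutcome d ^ 2) P := h2.integrable_sq
  have hfm : Measurable fun w : PotUnit 𝒳 => |f (covariate w)| := by
    simpa using (hf.comp measurable_covariate).norm
  have hfs : StronglyMeasurable[covSigma 𝒳] fun w : PotUnit 𝒳 => |f (covariate w)| := by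
    exact (hf.norm.comp (comap_measurable covariate)).stronglyMeasurable
  have hbd : ∀ᵐ w ∂P, |(|f (covariate w)|)| ≤ 1 := ae_of_all _ fun w => by simpa using hf1 _
  refine ⟨hYi.bdd_mul hfm.aestronglyMeasurable hbd, ?_⟩
  have := integral_mul_condExp (covSigma_le 𝒳) hfs hYi hbd
  simp only [Pi.pow_apply] at this
  rw [this, ← integral_const_mul]
  have hfi : Integrable (fun w : PotUnit 𝒳 => |f (covariate w)|) P :=
    Integrable.of_bound hfm.aestronglyMeasurable 1 hbd
  refine integral_mono_ae (integrable_condExp.bdd_mul hfm.aestronglyMeasurable hbd)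
    (hfi.const_mul _) (hC.mono fun w hw => ?_)
  simp only
  rw [mul_comm (max C 0)]
  exact mul_le_mul_of_nonneg_left (hw.trans (le_max_left _ _)) (abs_nonneg _)

variable [StandardBorelSpace 𝒳] [IsProbabilityMeasure P]

theorem ae_propensity_mem (he : StrongIgnorability P e) :
    ∃ c : ℝ, 0 < c ∧ ∀ᵐ w ∂P, c ≤ e (covariate w) ∧ c ≤ 1 - e (covariate w) := by
  obtain ⟨c, hc, h⟩ := he.overlap
  exact ⟨c, hc, h.mono fun w hw => ⟨hw.1, by linarith [hw.2]⟩⟩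

/-- The treated units have the law of the population reweighted by the propensity score. -/
theorem map_restrict_treatment (he : IsPropensityScore P e) (hs : StrongIgnorability P e) :
    (P.restrict {w | treatment w = true}).map (fun w => (w.1, w.2.2)) =
      (P.withDensity fun w => ENNReal.ofReal (e (covariate w))).map (fun w => (w.1, w.2.2)) := by
  have hg : Measurable fun w : PotUnit 𝒳 => (w.1, w.2.2) := by fun_prop
  have hD := measurableSet_treatment (𝒳 := 𝒳) true
  obtain ⟨c, hc, hov⟩ := ae_propensity_mem hs
  have hem : Measurable fun w : PotUnit 𝒳 => e (covariate w) :=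
    he.measurable.comp measurable_covariate
  have hei : Integrable (fun w : PotUnit 𝒳 => e (covariate w)) P := by
    refine Integrable.of_bound hem.aestronglyMeasurable 1 (hov.mono fun w hw => ?_)
    rw [Real.norm_eq_abs, abs_le]
    constructor <;> linarith [hw.1, hw.2]
  -- Rectangles determine both measures. On a rectangle, unconfoundedness factors the conditional
  -- probability of the outcome event and the treatment, and the propensity score, a function of the
  -- covariates, moves inside the conditional expectation.
  refine Measure.ext_prod fun {s t} hs' ht => ?_
  rw [Measure.map_apply hg (hs'.prod ht), Measure.map_apply hg (hs'.prod ht),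
    Measure.restrict_apply (hg (hs'.prod ht)), withDensity_apply _ (hg (hs'.prod ht))]
  have hY : Measurable fun w : PotUnit 𝒳 => (potOutcome false w, potOutcome true w) :=
    (measurable_potOutcome _).prodMk (measurable_potOutcome _)
  set S : Set (PotUnit 𝒳) := covariate ⁻¹' s with hS
  set E : Set (PotUnit 𝒳) := (fun w => (potOutcome false w, potOutcome true w)) ⁻¹' t with hE
  have hSm : MeasurableSet[covSigma 𝒳] S := ⟨s, hs', rfl⟩
  have hSm' : MeasurableSet S := measurable_covariate hs'
  have hEm : MeasurableSet E := hY ht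
  have e1 : (fun w : PotUnit 𝒳 => (w.1, w.2.2)) ⁻¹' s ×ˢ t = S ∩ E := by
    ext w; simp [hS, hE, covariate, potOutcome]
  rw [e1]
  have hci := (condIndepFun_iff_condExp_inter_preimage_eq_mul hY measurable_treatment).1
    hs.unconfounded t {true} ht (measurableSet_singleton _)
  have hpre : (treatment ⁻¹' {true} : Set (PotUnit 𝒳)) = {w | treatment w = true} := rfl
  rw [hpre, ← hE] at hci
  have hind : Integrable (E.indicator fun _ => (1 : ℝ)) P := (integrable_const 1).indicator hEm
  have hesm : StronglyMeasurable[covSigma 𝒳] fun w : PotUnit 𝒳 => e (covariate w) :=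
    (he.measurable.comp (comap_measurable covariate)).stronglyMeasurable
  have hpull := condExp_stronglyMeasurable_mul_of_bound (covSigma_le 𝒳) hesm hind 1
    (hov.mono fun w hw => by rw [Real.norm_eq_abs, abs_le]; constructor <;> linarith [hw.1, hw.2])
  have e2 : P.real (S ∩ E ∩ {w | treatment w = true}) =
      ∫ w in S ∩ E, e (covariate w) ∂P := by
    calc P.real (S ∩ E ∩ {w | treatment w = true})
        = ∫ w in S, (E ∩ {w | treatment w = true}).indicator (fun _ => (1 : ℝ)) w ∂P := by
          rw [Set.inter_assoc, setIntegral_indicator (hEm.inter hD)]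
          simp
      _ = ∫ w in S, (P⟦E ∩ {w | treatment w = true} | covSigma 𝒳⟧) w ∂P :=
          (setIntegral_condExp (covSigma_le 𝒳)
            ((integrable_const 1).indicator (hEm.inter hD)) hSm).symm
      _ = ∫ w in S, (P[(fun w => e (covariate w)) * E.indicator (fun _ => (1 : ℝ)) | covSigma 𝒳]) w ∂P := by
          refine setIntegral_congr_ae hSm' ?_
          filter_upwards [hci, hpull, he.ae_eq] with w h1 h2 h3 _
          rw [h1, h2, ← h3, Pi.mul_apply, mul_comm]
      _ = ∫ w in S, ((fun w => e (covariate w)) * E.indicator (fun _ => (1 : ℝ))) w ∂P := by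
          refine setIntegral_condExp (covSigma_le 𝒳) ?_ hSm
          exact hind.bdd_mul (c := 1) hem.aestronglyMeasurable (hov.mono fun w hw => by
            rw [Real.norm_eq_abs, abs_le]; constructor <;> linarith [hw.1, hw.2])
      _ = ∫ w in S, E.indicator (fun w => e (covariate w)) w ∂P := by
          congr 1
          ext w
          by_cases hw : w ∈ E <;> simp [hw]
      _ = _ := by rw [setIntegral_indicator hEm]
  rw [← ofReal_integral_eq_lintegral_ofReal hei.integrableOn
    (ae_restrict_of_ae (hov.mono fun w hw => by simp only [Pi.zero_apply]; linarith [hw.1])), ← e2,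
    ofReal_measureReal]

theorem integral_treated (he : IsPropensityScore P e) (hs : StrongIgnorability P e)
    {F : 𝒳 × ℝ × ℝ → ℝ} (hF : Measurable F) :
    ∫ w, (if treatment w = true then F (w.1, w.2.2) else 0) ∂P =
      ∫ w, e (covariate w) * F (w.1, w.2.2) ∂P := by
  have hg : Measurable fun w : PotUnit 𝒳 => (w.1, w.2.2) := by fun_prop
  have hem : Measurable fun w : PotUnit 𝒳 => e (covariate w) :=
    he.measurable.comp measurable_covariate
  obtain ⟨c, hc, hov⟩ := ae_propensity_mem hs
  have h := congrArg (fun ν => ∫ p, F p ∂ν) (map_restrict_treatment he hs)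
  rw [integral_map hg.aemeasurable hF.aestronglyMeasurable,
    integral_map hg.aemeasurable hF.aestronglyMeasurable,
    ← integral_indicator (measurableSet_treatment true),
    integral_withDensity_eq_integral_toReal_smul hem.ennreal_ofReal
      (ae_of_all _ fun _ => ENNReal.ofReal_lt_top)] at h
  calc _ = _ := integral_congr_ae (ae_of_all _ fun w => by simp [Set.indicator])
    _ = _ := h
    _ = _ := integral_congr_ae (hov.mono fun w hw => by
      simp only [smul_eq_mul]
      rw [ENNReal.toReal_ofReal (by linarith [hw.1])])

/-- The inverse probability weighted score identifies value differences. -/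
theorem integral_ipwScore_mul (he : IsPropensityScore P e) (hs : StrongIgnorability P e)
    (h4 : FourthMoment P) {f : 𝒳 → ℝ} (hf : Measurable f) (hf1 : ∀ x, |f x| ≤ 1) :
    ∫ o, ipwScore e o * f o.1 ∂P.map observe =
      ∫ w, (potOutcome true w - potOutcome false w) * f (covariate w) ∂P := by
  obtain ⟨c, hc, hov⟩ := ae_propensity_mem hs
  have hψ := measurable_ipwScore (𝒳 := 𝒳) he.measurable
  have hfm : Measurable fun o : Obs 𝒳 => f o.1 := hf.comp measurable_fst
  rw [integral_map measurable_observe.aemeasurable (by fun_prop)]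
  have hYi : ∀ d, Integrable (potOutcome d) P := fun d => (h4 d).integrable (by norm_num)
  have hem : Measurable fun w : PotUnit 𝒳 => e (covariate w) :=
    he.measurable.comp measurable_covariate
  let F1 : 𝒳 × ℝ × ℝ → ℝ := fun p => p.2.2 * f p.1 / e p.1
  let F0 : 𝒳 × ℝ × ℝ → ℝ := fun p => p.2.1 * f p.1 / (1 - e p.1)
  have hF1 : Measurable F1 := by
    have := he.measurable
    fun_prop
  have hF0 : Measurable F0 := by
    have := he.measurable
    fun_prop
  have hfb : ∀ (d : Bool) (g : 𝒳 → ℝ), Measurable g → (∀ᵐ w ∂P, c ≤ g (covariate w)) →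
      Integrable (fun w : PotUnit 𝒳 => potOutcome d w * f (covariate w) / g (covariate w)) P := by
    intro d g hg hgc
    have hm : Measurable fun w : PotUnit 𝒳 => f (covariate w) / g (covariate w) :=
      (hf.comp measurable_covariate).div (hg.comp measurable_covariate)
    refine ((hYi d).bdd_mul (c := 1 / c) hm.aestronglyMeasurable ?_).congr
      (ae_of_all _ fun w => by simp only; ring)
    filter_upwards [hgc] with w hw
    rw [Real.norm_eq_abs, abs_div, abs_of_pos (hc.trans_le hw)]
    exact div_le_div₀ zero_le_one (hf1 _) hc hw
  have i1 : Integrable (fun w : PotUnit 𝒳 => F1 (w.1, w.2.2)) P :=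
    hfb true e he.measurable (hov.mono fun w hw => hw.1)
  have i0 : Integrable (fun w : PotUnit 𝒳 => F0 (w.1, w.2.2)) P :=
    hfb false (fun x => 1 - e x) (measurable_const.sub he.measurable) (hov.mono fun w hw => hw.2)
  have j1 : Integrable (fun w : PotUnit 𝒳 =>
      if treatment w = true then F1 (w.1, w.2.2) else 0) P := by
    exact (i1.indicator (measurableSet_treatment true)).congr
      (ae_of_all _ fun w => by simp [Set.indicator])
  have j0 : Integrable (fun w : PotUnit 𝒳 =>
      if treatment w = true then F0 (w.1, w.2.2) else 0) P := by
    exact (i0.indicator (measurableSet_treatment true)).congr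
      (ae_of_all _ fun w => by simp [Set.indicator])
  -- The control part is written as all units minus the treated ones, so that the reweighting
  -- identity for the treated is the only one required.
  have hsplit : ∀ w : PotUnit 𝒳, ipwScore e (observe w) * f (observe w).1 =
      (if treatment w = true then F1 (w.1, w.2.2) else 0) - (F0 (w.1, w.2.2) -
        (if treatment w = true then F0 (w.1, w.2.2) else 0)) := by
    intro w
    rw [ipwScore_observe]
    cases h : treatment w <;> simp [F1, F0, potOutcome, observe, covariate] <;> ring
  have hle : ∀ᵐ w ∂P, ‖e (covariate w)‖ ≤ 1 := hov.mono fun w hw => by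
    rw [Real.norm_eq_abs, abs_le]; constructor <;> linarith [hw.1, hw.2]
  simp_rw [hsplit]
  have i0j0 : Integrable (fun w : PotUnit 𝒳 => F0 (w.1, w.2.2) -
      (if treatment w = true then F0 (w.1, w.2.2) else 0)) P := i0.sub j0
  have i0e : Integrable (fun w : PotUnit 𝒳 => F0 (w.1, w.2.2) -
      e (covariate w) * F0 (w.1, w.2.2)) P := i0.sub (i0.bdd_mul hem.aestronglyMeasurable hle)
  rw [integral_sub j1 i0j0, integral_sub i0 j0, integral_treated he hs hF1,
    integral_treated he hs hF0, ← integral_sub i0 (i0.bdd_mul hem.aestronglyMeasurable hle),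
    ← integral_sub (i1.bdd_mul hem.aestronglyMeasurable hle) i0e]
  refine integral_congr_ae (hov.mono fun w hw => ?_)
  have h1 : e w.1 ≠ 0 := (hc.trans_le hw.1).ne'
  have h2 : 1 - e w.1 ≠ 0 := (hc.trans_le hw.2).ne'
  simp only [F1, F0, covariate, potOutcome]
  field_simp
  simp

theorem ae_abs_ipwScore_le (he : StrongIgnorability P e) :
    ∃ c : ℝ, 0 < c ∧ ∀ᵐ w ∂P, |ipwScore e (observe w)| ≤
      c⁻¹ * ‖|potOutcome true w| + |potOutcome false w|‖ := by
  obtain ⟨c, hc, hov⟩ := ae_propensity_mem he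
  refine ⟨c, hc, hov.mono fun w hw => ?_⟩
  rw [ipwScore_observe, Real.norm_of_nonneg (by positivity)]
  have h1 := abs_nonneg (potOutcome true w)
  have h0 := abs_nonneg (potOutcome false w)
  have key : ∀ a b x : ℝ, 0 ≤ b → c ≤ x → |a / x| ≤ c⁻¹ * (|a| + b) := by
    intro a b x hb hx
    rw [abs_div, abs_of_pos (hc.trans_le hx), div_eq_inv_mul]
    gcongr
    linarith
  split_ifs
  · exact key _ _ _ h0 hw.1
  · rw [abs_neg, add_comm]
    exact key _ _ _ h1 hw.2

/-- The treated units alone carry enough variance. On them the weighted score is `Y(1) f(X) / e(X)`.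
Splitting `Y(1)` into its conditional mean and a residual, the cross term integrates to zero, and
reweighting by `e` leaves the squared residual with the coefficient `f² / e ≥ f²`. The centre `a` is
arbitrary because it enters only the cross term and a square that is discarded. -/
theorem integral_sq_ipwScore_sub_ge (he : IsPropensityScore P e) (hs : StrongIgnorability P e)
    (hb : BoundedCondMoments P) (h4 : FourthMoment P) :
    ∃ s : ℝ, 0 < s ∧ ∀ f : 𝒳 → ℝ, Measurable f → (∀ x, |f x| ≤ 1) → ∀ a : ℝ,
      s * ∫ w, f (covariate w) ^ 2 ∂P ≤
        ∫ w, (ipwScore e (observe w) * f (covariate w) - a) ^ 2 ∂P := by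
  obtain ⟨M, hM⟩ := hb.mean true
  obtain ⟨s, S, hs0, hS⟩ := hb.variance true
  obtain ⟨c, hc, hov⟩ := ae_propensity_mem hs
  obtain ⟨c', hc', hψb⟩ := ae_abs_ipwScore_le hs
  refine ⟨s, hs0, fun f hf hf1 a => ?_⟩
  have hem : Measurable fun w : PotUnit 𝒳 => e (covariate w) :=
    he.measurable.comp measurable_covariate
  have hfm : Measurable fun w : PotUnit 𝒳 => f (covariate w) := hf.comp measurable_covariate
  have h2 : MemLp (potOutcome true) 2 P := (h4 true).mono_exponent (by norm_num)
  have h2' : MemLp (potOutcome false) 2 P := (h4 false).mono_exponent (by norm_num)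
  have hψ := measurable_ipwScore (𝒳 := 𝒳) he.measurable
  have hψ2 : MemLp (fun w => ipwScore e (observe w) * f (covariate w)) 2 P := by
    refine MemLp.of_le_mul (h2.norm.add h2'.norm)
      ((hψ.comp measurable_observe).mul hfm).aestronglyMeasurable (c := c'⁻¹)
      (hψb.mono fun w hw => ?_)
    rw [norm_mul]
    refine (mul_le_of_le_one_right (norm_nonneg _) (hf1 _)).trans hw
  set m1 : PotUnit 𝒳 → ℝ := P[potOutcome true | covSigma 𝒳] with hm1
  have hm1s : StronglyMeasurable[covSigma 𝒳] m1 := stronglyMeasurable_condExp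
  have hm1m : Measurable m1 := (hm1s.mono (covSigma_le 𝒳)).measurable
  have hm1L : MemLp m1 2 P := MemLp.of_bound hm1m.aestronglyMeasurable M hM
  have hres : MemLp (fun w => potOutcome true w - m1 w) 2 P := h2.sub hm1L
  -- the weights, as functions of the covariates
  let g : PotUnit 𝒳 → ℝ := fun w => f (covariate w) / e (covariate w)
  have hes : StronglyMeasurable[covSigma 𝒳] fun w : PotUnit 𝒳 => e (covariate w) :=
    (he.measurable.comp (comap_measurable covariate)).stronglyMeasurable
  have hfs : StronglyMeasurable[covSigma 𝒳] fun w : PotUnit 𝒳 => f (covariate w) :=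
    (hf.comp (comap_measurable covariate)).stronglyMeasurable
  have hgs : StronglyMeasurable[covSigma 𝒳] g :=
    ((hf.div he.measurable).comp (comap_measurable covariate)).stronglyMeasurable
  have hgb : ∀ᵐ w ∂P, |g w| ≤ c⁻¹ := hov.mono fun w hw => by
    simp only [g]
    rw [abs_div, abs_of_pos (hc.trans_le hw.1), inv_eq_one_div]
    exact div_le_div₀ zero_le_one (hf1 _) hc hw.1
  -- `k1` and `k2` are the coefficients of the residual `Y(1) - m1` and of its square in the
  -- expansion of `e (Y(1) g - a)²`. Both are almost surely bounded and measurable with respect to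
  -- the covariates, so they pass through conditional expectations.
  let k1 : PotUnit 𝒳 → ℝ := fun w => 2 * e (covariate w) * g w * (m1 w * g w - a)
  let k2 : PotUnit 𝒳 → ℝ := fun w => e (covariate w) * g w ^ 2
  have hk1s : StronglyMeasurable[covSigma 𝒳] k1 :=
    ((hes.const_mul 2).mul hgs).mul ((hm1s.mul hgs).sub stronglyMeasurable_const)
  have hk2s : StronglyMeasurable[covSigma 𝒳] k2 := hes.mul (hgs.pow 2)
  have hMc : 0 ≤ M := by
    obtain ⟨w, hw⟩ := hM.exists
    exact (abs_nonneg _).trans hw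
  have hk1b : ∀ᵐ w ∂P, |k1 w| ≤ 2 * 1 * c⁻¹ * (M * c⁻¹ + |a|) := by
    filter_upwards [hgb, hM, hov] with w h1 h2 h3
    have he1 : |e (covariate w)| ≤ 1 := by rw [abs_le]; constructor <;> linarith [h3.1, h3.2]
    simp only [k1]
    rw [abs_mul, abs_mul, abs_mul, abs_two]
    gcongr
    refine (abs_sub _ _).trans ?_
    rw [abs_mul]
    gcongr
  have hk2b : ∀ᵐ w ∂P, |k2 w| ≤ 1 * c⁻¹ ^ 2 := by
    filter_upwards [hgb, hov] with w h1 h3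
    have he1 : |e (covariate w)| ≤ 1 := by rw [abs_le]; constructor <;> linarith [h3.1, h3.2]
    simp only [k2]
    rw [abs_mul, abs_pow]
    gcongr
  have hk1m := (hk1s.mono (covSigma_le 𝒳)).aestronglyMeasurable (μ := P)
  have hk2m := (hk2s.mono (covSigma_le 𝒳)).aestronglyMeasurable (μ := P)
  have hsq : Integrable (fun w => (potOutcome true w - m1 w) ^ 2) P := hres.integrable_sq
  have hresi : Integrable (fun w => potOutcome true w - m1 w) P := hres.integrable (by norm_num)
  have z1 : ∫ w, k1 w * (potOutcome true w - m1 w) ∂P = 0 := by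
    rw [integral_mul_condExp (covSigma_le 𝒳) hk1s hresi hk1b]
    refine integral_eq_zero_of_ae ?_
    have hsub : P[fun w => potOutcome true w - m1 w | covSigma 𝒳] =ᵐ[P] 0 := by
      have h5 := condExp_sub (m := covSigma 𝒳) (h2.integrable (by norm_num))
        (hm1L.integrable (by norm_num)) (μ := P)
      have h6 : P[m1 | covSigma 𝒳] = m1 :=
        condExp_of_stronglyMeasurable (covSigma_le 𝒳) hm1s (hm1L.integrable (by norm_num))
      rw [h6, ← hm1, sub_self] at h5
      exact h5
    filter_upwards [hsub] with w hw
    simp [hw]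
  have z2 : s * ∫ w, f (covariate w) ^ 2 ∂P ≤ ∫ w, k2 w * (potOutcome true w - m1 w) ^ 2 ∂P := by
    rw [integral_mul_condExp (covSigma_le 𝒳) hk2s hsq hk2b, ← integral_const_mul]
    have hf2 : Integrable (fun w : PotUnit 𝒳 => f (covariate w) ^ 2) P :=
      Integrable.of_bound (hfm.pow_const 2).aestronglyMeasurable 1 (ae_of_all _ fun w => by
        rw [norm_pow]; exact pow_le_one₀ (norm_nonneg _) (hf1 _))
    refine integral_mono_ae (hf2.const_mul s) (integrable_condExp.bdd_mul hk2m hk2b) ?_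
    filter_upwards [hS, hov] with w h1 h3
    have hv : s ≤ (P[fun w => (potOutcome true w - m1 w) ^ 2 | covSigma 𝒳]) w := h1.1
    have he0 : 0 < e (covariate w) := hc.trans_le h3.1
    have hk : f (covariate w) ^ 2 ≤ k2 w := by
      simp only [k2, g]
      rw [div_pow, ← mul_div_assoc, le_div_iff₀ (by positivity)]
      have h7 := sq_nonneg (f (covariate w))
      have h8 : e (covariate w) ^ 2 ≤ e (covariate w) := by nlinarith [h3.2]
      nlinarith
    calc s * f (covariate w) ^ 2 = f (covariate w) ^ 2 * s := mul_comm _ _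
      _ ≤ _ := mul_le_mul hk hv hs0.le ((sq_nonneg _).trans hk)
  let F : 𝒳 × ℝ × ℝ → ℝ := fun p => (p.2.2 * (f p.1 / e p.1) - a) ^ 2
  have hF : Measurable F := by
    have := he.measurable
    fun_prop
  have hFi : Integrable (fun w => (potOutcome true w * g w - a) ^ 2) P := by
    have : MemLp (fun w => potOutcome true w * g w) 2 P := by
      refine MemLp.of_le_mul h2 ((measurable_potOutcome true).mul
        (hgs.mono (covSigma_le 𝒳)).measurable).aestronglyMeasurable (c := c⁻¹)
        (hgb.mono fun w hw => ?_)
      rw [norm_mul, mul_comm]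
      exact mul_le_mul_of_nonneg_right hw (norm_nonneg _)
    exact (this.sub (memLp_const a)).integrable_sq
  calc s * ∫ w, f (covariate w) ^ 2 ∂P
      ≤ ∫ w, k2 w * (potOutcome true w - m1 w) ^ 2 ∂P +
        ∫ w, k1 w * (potOutcome true w - m1 w) ∂P := by rw [z1, add_zero]; exact z2
    _ = ∫ w, (k2 w * (potOutcome true w - m1 w) ^ 2 + k1 w * (potOutcome true w - m1 w)) ∂P :=
        (integral_add (hsq.bdd_mul hk2m hk2b) (hresi.bdd_mul hk1m hk1b)).symm
    _ ≤ ∫ w, e (covariate w) * (potOutcome true w * g w - a) ^ 2 ∂P := by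
        refine integral_mono_ae ((hsq.bdd_mul hk2m hk2b).add (hresi.bdd_mul hk1m hk1b))
          (hFi.bdd_mul (c := 1) hem.aestronglyMeasurable (hov.mono fun w hw => by
            rw [Real.norm_eq_abs, abs_le]; constructor <;> linarith [hw.1, hw.2])) ?_
        filter_upwards [hov] with w hw
        have : e (covariate w) * (potOutcome true w * g w - a) ^ 2 -
            (k2 w * (potOutcome true w - m1 w) ^ 2 + k1 w * (potOutcome true w - m1 w)) =
            e (covariate w) * (m1 w * g w - a) ^ 2 := by
          simp only [k1, k2]; ring
        have h9 : 0 ≤ e (covariate w) * (m1 w * g w - a) ^ 2 :=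
          mul_nonneg (hc.le.trans hw.1) (sq_nonneg _)
        linarith
    _ = ∫ w, (if treatment w = true then F (w.1, w.2.2) else 0) ∂P :=
        (integral_treated he hs hF).symm
    _ ≤ _ := by
        have hFD : Integrable (fun w => if treatment w = true then F (w.1, w.2.2) else 0) P := by
          refine (hFi.indicator (measurableSet_treatment true)).congr (ae_of_all _ fun w => ?_)
          simp [Set.indicator, F, g, potOutcome, covariate]
        refine integral_mono hFD
          (hψ2.sub (memLp_const a)).integrable_sq fun w => ?_
        simp only
        split_ifs with h
        · rw [ipwScore_observe, if_pos h]
          simp only [F, covariate, potOutcome]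
          apply le_of_eq
          simp
          ring
        · positivity

/-- Overlap bounds the score by a multiple of `|Y(1)| + |Y(0)|`, which transfers the fourth moment
and the upper bound. For the lower bound, `𝔼 f²` is weakened to `(𝔼|f|)²`, so that separation in the
`L¹` policy distance suffices. -/
theorem exists_regularScore (he : IsPropensityScore P e) (hs : StrongIgnorability P e)
    (hb : BoundedCondMoments P) (h4 : FourthMoment P) :
    ∃ C s : ℝ, RegularScore (P.map observe) (ipwScore e) C s := by
  obtain ⟨s, hs0, hlow⟩ := integral_sq_ipwScore_sub_ge he hs hb h4
  obtain ⟨C1, hC1, hup1⟩ := integral_sq_potOutcome_mul_le hb h4 true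
  obtain ⟨C0, hC0, hup0⟩ := integral_sq_potOutcome_mul_le hb h4 false
  obtain ⟨c, hc, hψb⟩ := ae_abs_ipwScore_le hs
  have hψ := measurable_ipwScore (𝒳 := 𝒳) he.measurable
  have hψo := hψ.comp measurable_observe
  have h4' : MemLp (fun w => ipwScore e (observe w)) 4 P :=
    MemLp.of_le_mul ((h4 true).norm.add (h4 false).norm) hψo.aestronglyMeasurable hψb
  have hmap : ∀ {g : Obs 𝒳 → ℝ}, Measurable g →
      ∫ o, g o ∂P.map observe = ∫ w, g (observe w) ∂P := fun hg =>
    integral_map measurable_observe.aemeasurable hg.aestronglyMeasurable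
  refine ⟨c⁻¹ ^ 2 * (2 * (C1 + C0)), s, hψ, ?_, hs0, fun f hf hf1 => ?_, fun f hf hf1 a => ?_⟩
  · exact (memLp_map_measure_iff hψ.aestronglyMeasurable measurable_observe.aemeasurable).2 h4'
  · have hfm : Measurable fun o : Obs 𝒳 => |f o.1| := by
      simpa using (hf.comp measurable_fst).norm
    have hm1 : Measurable fun o : Obs 𝒳 => ipwScore e o ^ 2 * |f o.1| := by fun_prop
    rw [hmap hm1, hmap hfm]
    obtain ⟨i1, b1⟩ := hup1 f hf hf1
    obtain ⟨i0, b0⟩ := hup0 f hf hf1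
    change ∫ w, ipwScore e (observe w) ^ 2 * |f (covariate w)| ∂P ≤
      _ * ∫ w, |f (covariate w)| ∂P
    calc ∫ w, ipwScore e (observe w) ^ 2 * |f (covariate w)| ∂P
        ≤ ∫ w, c⁻¹ ^ 2 * (2 * (|f (covariate w)| * potOutcome true w ^ 2 +
            |f (covariate w)| * potOutcome false w ^ 2)) ∂P := by
          refine integral_mono_of_nonneg (ae_of_all _ fun w => by positivity)
            (((i1.add i0).const_mul 2).const_mul _) (hψb.mono fun w hw => ?_)
          have h1 := pow_le_pow_left₀ (abs_nonneg _) hw 2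
          rw [sq_abs, mul_pow, Real.norm_eq_abs, sq_abs] at h1
          have h2 : (|potOutcome true w| + |potOutcome false w|) ^ 2 ≤
              2 * (potOutcome true w ^ 2 + potOutcome false w ^ 2) := by
            have := sq_nonneg (|potOutcome true w| - |potOutcome false w|)
            nlinarith [sq_abs (potOutcome true w), sq_abs (potOutcome false w)]
          calc _ ≤ c⁻¹ ^ 2 * (2 * (potOutcome true w ^ 2 + potOutcome false w ^ 2)) *
                |f (covariate w)| := by
                refine mul_le_mul_of_nonneg_right (h1.trans ?_) (abs_nonneg _)
                exact mul_le_mul_of_nonneg_left h2 (by positivity)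
            _ = _ := by ring
      _ ≤ c⁻¹ ^ 2 * (2 * (C1 * ∫ w, |f (covariate w)| ∂P + C0 * ∫ w, |f (covariate w)| ∂P)) := by
          rw [integral_const_mul, integral_const_mul, integral_add i1 i0]
          gcongr
      _ = _ := by ring
  · have hfm : Measurable fun o : Obs 𝒳 => |f o.1| := by
      simpa using (hf.comp measurable_fst).norm
    have hfm' : Measurable fun o : Obs 𝒳 => f o.1 := hf.comp measurable_fst
    have hm2 : Measurable fun o : Obs 𝒳 => (ipwScore e o * f o.1 - a) ^ 2 := by fun_prop
    rw [hmap hm2, hmap hfm]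
    refine le_trans ?_ (hlow f hf hf1 a)
    refine mul_le_mul_of_nonneg_left ?_ hs0.le
    have hL : MemLp (fun w : PotUnit 𝒳 => |f (covariate w)|) 2 P :=
      MemLp.of_bound (hfm.comp measurable_observe).aestronglyMeasurable 1
        (ae_of_all _ fun w => by simpa using hf1 _)
    have := variance_nonneg (fun w : PotUnit 𝒳 => |f (covariate w)|) P
    rw [variance_eq_sub hL] at this
    simp only [Pi.pow_apply, sq_abs] at this
    change (∫ w, |f (covariate w)| ∂P) ^ 2 ≤ _
    linarith

end Population


/-! ### Mean and variance of the weighted score as functions of the weight -/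

section Score

variable {𝒳 : Type*} [MeasurableSpace 𝒳]

/-- The norm `𝔼_X |f(X)|`. -/
noncomputable def covNorm (Q : Measure (Obs 𝒳)) (f : 𝒳 → ℝ) : ℝ := ∫ o, |f o.1| ∂Q

/-- The mean of `ψ(Z) f(X)`. -/
noncomputable def scoreMean (Q : Measure (Obs 𝒳)) (ψ : Obs 𝒳 → ℝ) (f : 𝒳 → ℝ) : ℝ :=
  ∫ o, ψ o * f o.1 ∂Q

/-- The centered score `ψ(Z) f(X) - 𝔼 ψ(Z) f(X)`. -/
noncomputable def centered (Q : Measure (Obs 𝒳)) (ψ : Obs 𝒳 → ℝ) (f : 𝒳 → ℝ) (o : Obs 𝒳) : ℝ :=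
  ψ o * f o.1 - scoreMean Q ψ f

/-- The variance of `ψ(Z) f(X)`. -/
noncomputable def scoreVar (Q : Measure (Obs 𝒳)) (ψ : Obs 𝒳 → ℝ) (f : 𝒳 → ℝ) : ℝ :=
  ∫ o, centered Q ψ f o ^ 2 ∂Q

variable {Q : Measure (Obs 𝒳)} [IsProbabilityMeasure Q] {ψ : Obs 𝒳 → ℝ} {C σ : ℝ}
  {f g : 𝒳 → ℝ} {b : ℝ}

omit [IsProbabilityMeasure Q] in
theorem covNorm_nonneg : 0 ≤ covNorm Q f := integral_nonneg fun _ => abs_nonneg _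

omit [IsProbabilityMeasure Q] in
theorem covNorm_sub_comm (f g : 𝒳 → ℝ) :
    covNorm Q (fun x => f x - g x) = covNorm Q (fun x => g x - f x) := by
  simp_rw [covNorm, abs_sub_comm]

theorem integrable_comp_fst (hf : Measurable f) (hb : ∀ x, |f x| ≤ b) :
    Integrable (fun o : Obs 𝒳 => f o.1) Q :=
  Integrable.of_bound (hf.comp measurable_fst).aestronglyMeasurable b (ae_of_all _ fun _ => hb _)

theorem covNorm_le (hf : Measurable f) (hb : ∀ x, |f x| ≤ b) : covNorm Q f ≤ b := by
  calc covNorm Q f ≤ ∫ _, b ∂Q :=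
        integral_mono (integrable_comp_fst hf hb).abs (integrable_const b) fun _ => hb _
    _ = b := by simp

theorem covNorm_add_le {b' : ℝ} (hf : Measurable f) (hb : ∀ x, |f x| ≤ b)
    (hg : Measurable g) (hb' : ∀ x, |g x| ≤ b') :
    covNorm Q (fun x => f x + g x) ≤ covNorm Q f + covNorm Q g := by
  have h1 := (integrable_comp_fst (Q := Q) hf hb)
  have h2 := (integrable_comp_fst (Q := Q) hg hb')
  unfold covNorm
  rw [← integral_add h1.abs h2.abs]
  exact integral_mono (h1.add h2).abs (h1.abs.add h2.abs) fun o => abs_add_le _ _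

theorem covNorm_sum_le {ι : Type*} (I : Finset ι) {F : ι → 𝒳 → ℝ} (a : ι → ℝ)
    (ha : ∀ i ∈ I, 0 ≤ a i) (hF : ∀ i ∈ I, Measurable (F i)) (hb : ∀ i ∈ I, ∀ x, |F i x| ≤ b) :
    covNorm Q (fun x => ∑ i ∈ I, F i x * a i) ≤ ∑ i ∈ I, covNorm Q (F i) * a i := by
  have h1 : ∀ i ∈ I, Integrable (fun o : Obs 𝒳 => F i o.1) Q := fun i hi =>
    integrable_comp_fst (hF i hi) (hb i hi)
  unfold covNorm
  simp_rw [← integral_mul_const]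
  rw [← integral_finsetSum _ fun i hi => (h1 i hi).abs.mul_const _]
  refine integral_mono (integrable_finsetSum _ fun i hi => (h1 i hi).mul_const _).abs
    (integrable_finsetSum _ fun i hi => (h1 i hi).abs.mul_const _) fun o => ?_
  refine (Finset.abs_sum_le_sum_abs _ _).trans_eq (Finset.sum_congr rfl fun i hi => ?_)
  rw [abs_mul, abs_of_nonneg (ha i hi)]

omit [IsProbabilityMeasure Q] in
theorem scoreVar_nonneg : 0 ≤ scoreVar Q ψ f := integral_nonneg fun _ => sq_nonneg _

namespace RegularScore

variable (h : RegularScore Q ψ C σ)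

include h

omit [IsProbabilityMeasure Q] in
theorem memLp_mul (hf : Measurable f) (hb : ∀ x, |f x| ≤ b) :
    MemLp (fun o => ψ o * f o.1) 4 Q := by
  have := h.measurable
  refine MemLp.of_le_mul h.memLp (by fun_prop) (c := b) (ae_of_all _ fun o => ?_)
  rw [norm_mul, mul_comm]
  exact mul_le_mul_of_nonneg_right (hb _) (norm_nonneg _)

theorem memLp_two : MemLp ψ 2 Q := h.memLp.mono_exponent (by norm_num)

theorem integrable_mul (hf : Measurable f) (hb : ∀ x, |f x| ≤ b) :
    Integrable (fun o => ψ o * f o.1) Q :=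
  (h.memLp_mul hf hb).integrable (by norm_num)

theorem integrable_sq_mul (hf : Measurable f) (hb : ∀ x, |f x| ≤ b) :
    Integrable (fun o => ψ o ^ 2 * |f o.1|) Q := by
  refine (h.memLp_two.integrable_sq.bdd_mul (c := b) (f := fun o : Obs 𝒳 => |f o.1|)
    (hf.comp measurable_fst).norm.aestronglyMeasurable
    (ae_of_all _ fun o => by simpa using hb _)).congr
    (ae_of_all _ fun o => mul_comm _ _)

theorem memLp_centered (hf : Measurable f) (hb : ∀ x, |f x| ≤ b) :
    MemLp (centered Q ψ f) 4 Q :=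
  (h.memLp_mul hf hb).sub (memLp_const _)

theorem integral_centered (hf : Measurable f) (hb : ∀ x, |f x| ≤ b) :
    ∫ o, centered Q ψ f o ∂Q = 0 := by
  unfold centered
  rw [integral_sub (h.integrable_mul hf hb) (integrable_const _)]
  simp [scoreMean]

theorem scoreMean_sub {b' : ℝ} (hf : Measurable f) (hb : ∀ x, |f x| ≤ b)
    (hg : Measurable g) (hb' : ∀ x, |g x| ≤ b') :
    scoreMean Q ψ (fun x => f x - g x) = scoreMean Q ψ f - scoreMean Q ψ g := by
  unfold scoreMean
  rw [← integral_sub (h.integrable_mul hf hb) (h.integrable_mul hg hb')]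
  simp_rw [mul_sub]

theorem scoreMean_sum {ι : Type*} (I : Finset ι) {F : ι → 𝒳 → ℝ} (a : ι → ℝ)
    (hF : ∀ i ∈ I, Measurable (F i)) (hb : ∀ i ∈ I, ∀ x, |F i x| ≤ b) :
    scoreMean Q ψ (fun x => ∑ i ∈ I, F i x * a i) = ∑ i ∈ I, scoreMean Q ψ (F i) * a i := by
  unfold scoreMean
  simp_rw [← integral_mul_const, Finset.mul_sum]
  rw [integral_finsetSum]
  · simp_rw [mul_assoc]
  · intro i hi
    simp_rw [← mul_assoc]
    exact (h.integrable_mul (hF i hi) (hb i hi)).mul_const _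

omit [IsProbabilityMeasure Q] in
theorem integral_sq_mul_le (hf : Measurable f) (hb : ∀ x, |f x| ≤ b) :
    ∫ o, ψ o ^ 2 * |f o.1| ∂Q ≤ C * covNorm Q f := by
  have hb0 : 0 < |b| + 1 := by positivity
  have := h.upper (fun x => f x / (|b| + 1)) (hf.div_const _) fun x => by
    rw [abs_div, abs_of_pos hb0, div_le_one hb0]
    linarith [hb x, le_abs_self b]
  simp only [abs_div, abs_of_pos hb0, ← mul_div_assoc, integral_div] at this
  rwa [div_le_div_iff_of_pos_right hb0] at this

theorem const_nonneg : 0 ≤ C := by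
  have := h.integral_sq_mul_le (f := fun _ => 1) measurable_const (b := 1) (by simp)
  have h2 : 0 ≤ ∫ o, ψ o ^ 2 * |(1 : ℝ)| ∂Q := integral_nonneg fun o => by positivity
  simpa [covNorm] using h2.trans this

/-- By `|ψ| ≤ 1 + ψ²`, the second-moment bound that is linear in `|f|` also controls the first
moment. -/
theorem abs_scoreMean_le (hf : Measurable f) (hb : ∀ x, |f x| ≤ b) :
    |scoreMean Q ψ f| ≤ (1 + C) * covNorm Q f := by
  have i1 := (integrable_comp_fst (Q := Q) hf hb).abs
  have i2 := h.integrable_sq_mul hf hb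
  calc |scoreMean Q ψ f| ≤ ∫ o, |ψ o * f o.1| ∂Q := abs_integral_le_integral_abs
    _ ≤ ∫ o, (|f o.1| + ψ o ^ 2 * |f o.1|) ∂Q := by
        refine integral_mono (h.integrable_mul hf hb).abs (i1.add i2) fun o => ?_
        simp only
        rw [abs_mul, ← one_add_mul]
        refine mul_le_mul_of_nonneg_right ?_ (abs_nonneg _)
        nlinarith [sq_nonneg (|ψ o| - 1), sq_abs (ψ o)]
    _ = covNorm Q f + ∫ o, ψ o ^ 2 * |f o.1| ∂Q := integral_add i1 i2
    _ ≤ _ := by linarith [h.integral_sq_mul_le hf hb]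

theorem scoreVar_eq (hf : Measurable f) (hb : ∀ x, |f x| ≤ b) :
    scoreVar Q ψ f = ∫ o, (ψ o * f o.1) ^ 2 ∂Q - scoreMean Q ψ f ^ 2 := by
  have h2 : MemLp (fun o => ψ o * f o.1) 2 Q := (h.memLp_mul hf hb).mono_exponent (by norm_num)
  have := variance_eq_sub h2
  rw [variance_eq_integral h2.aestronglyMeasurable.aemeasurable] at this
  exact this

/-- Only one of the two factors of `f²` is replaced by its supremum; the other stays in `L¹` norm.
For the excess weights both factors are small, and their product is what makes the excess
negligible. -/
theorem scoreVar_le (hf : Measurable f) (hb : ∀ x, |f x| ≤ b) :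
    scoreVar Q ψ f ≤ b * (C * covNorm Q f) := by
  obtain ⟨o, -⟩ : ∃ o : Obs 𝒳, True :=
    ⟨(nonempty_of_isProbabilityMeasure Q).some, trivial⟩
  have hb0 : 0 ≤ b := (abs_nonneg _).trans (hb o.1)
  have h2 : MemLp (fun o => ψ o * f o.1) 2 Q := (h.memLp_mul hf hb).mono_exponent (by norm_num)
  rw [h.scoreVar_eq hf hb]
  calc _ ≤ ∫ o, (ψ o * f o.1) ^ 2 ∂Q := by linarith [sq_nonneg (scoreMean Q ψ f)]
    _ ≤ ∫ o, b * (ψ o ^ 2 * |f o.1|) ∂Q := by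
        refine integral_mono h2.integrable_sq ((h.integrable_sq_mul hf hb).const_mul b) fun o => ?_
        simp only
        rw [mul_pow, ← sq_abs (f o.1), sq |f o.1|]
        have := mul_le_mul_of_nonneg_right (hb o.1) (abs_nonneg (f o.1))
        nlinarith [sq_nonneg (ψ o)]
    _ ≤ _ := by
        rw [integral_const_mul]
        exact mul_le_mul_of_nonneg_left (h.integral_sq_mul_le hf hb) hb0

theorem scoreVar_le_const (hf : Measurable f) (hb : ∀ x, |f x| ≤ 1) : scoreVar Q ψ f ≤ C := by
  have h1 := h.scoreVar_le hf hb
  have h2 := covNorm_le (Q := Q) hf hb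
  nlinarith [h.const_nonneg]

omit [IsProbabilityMeasure Q] in
theorem scoreVar_ge (hf : Measurable f) (hb : ∀ x, |f x| ≤ 1) :
    σ * covNorm Q f ^ 2 ≤ scoreVar Q ψ f := h.lower f hf hb _

/-- Factoring `f² - g² = (f - g)(f + g)` leaves the `L¹` distance times a bounded factor, and
likewise for the squared means. This turns summable policy increments into summable increments of
the conditional variance. -/
theorem abs_scoreVar_sub_le (hf : Measurable f) (hb : ∀ x, |f x| ≤ 1)
    (hg : Measurable g) (hb' : ∀ x, |g x| ≤ 1) :
    |scoreVar Q ψ f - scoreVar Q ψ g| ≤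
      (2 * C + 2 * (1 + C) ^ 2) * covNorm Q (fun x => f x - g x) := by
  have hfg : Measurable fun x => f x - g x := hf.sub hg
  have hfgb : ∀ x, |f x - g x| ≤ 2 := fun x => (abs_sub _ _).trans (by linarith [hb x, hb' x])
  have h2 : MemLp (fun o => ψ o * f o.1) 2 Q := (h.memLp_mul hf hb).mono_exponent (by norm_num)
  have h2' : MemLp (fun o => ψ o * g o.1) 2 Q := (h.memLp_mul hg hb').mono_exponent (by norm_num)
  set N := covNorm Q (fun x => f x - g x) with hN
  have hN0 : 0 ≤ N := covNorm_nonneg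
  have e1 : |∫ o, (ψ o * f o.1) ^ 2 ∂Q - ∫ o, (ψ o * g o.1) ^ 2 ∂Q| ≤ 2 * C * N := by
    rw [← integral_sub h2.integrable_sq h2'.integrable_sq]
    calc _ ≤ ∫ o, |(ψ o * f o.1) ^ 2 - (ψ o * g o.1) ^ 2| ∂Q := abs_integral_le_integral_abs
      _ ≤ ∫ o, 2 * (ψ o ^ 2 * |f o.1 - g o.1|) ∂Q := by
          refine integral_mono (h2.integrable_sq.sub h2'.integrable_sq).abs
            ((h.integrable_sq_mul hfg hfgb).const_mul 2) fun o => ?_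
          simp only
          have : (ψ o * f o.1) ^ 2 - (ψ o * g o.1) ^ 2 =
            (ψ o ^ 2 * (f o.1 - g o.1)) * (f o.1 + g o.1) := by ring
          rw [this, abs_mul, abs_mul, abs_of_nonneg (sq_nonneg (ψ o)), mul_comm (2 : ℝ)]
          refine mul_le_mul_of_nonneg_left ?_ (by positivity)
          exact (abs_add_le _ _).trans (by linarith [hb o.1, hb' o.1])
      _ ≤ _ := by
          rw [integral_const_mul]
          linarith [h.integral_sq_mul_le hfg hfgb]
  have e2 : |scoreMean Q ψ f ^ 2 - scoreMean Q ψ g ^ 2| ≤ 2 * (1 + C) ^ 2 * N := by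
    have a1 := h.abs_scoreMean_le hfg hfgb
    rw [h.scoreMean_sub hf hb hg hb'] at a1
    have a2 := h.abs_scoreMean_le hf hb
    have a3 := h.abs_scoreMean_le hg hb'
    have a4 := covNorm_le (Q := Q) hf hb
    have a5 := covNorm_le (Q := Q) hg hb'
    have hC := h.const_nonneg
    have a6 : |scoreMean Q ψ f + scoreMean Q ψ g| ≤ 2 * (1 + C) := by
      refine (abs_add_le _ _).trans ?_
      nlinarith
    rw [sq_sub_sq, abs_mul]
    calc _ ≤ (2 * (1 + C)) * ((1 + C) * N) := by gcongr
      _ = _ := by ring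
  rw [h.scoreVar_eq hf hb, h.scoreVar_eq hg hb', sub_sub_sub_comm]
  refine (abs_sub _ _).trans ?_
  linarith

/-- The envelope `|ψ| + (1 + C)` dominates all centered scores at once, so the constant depends
neither on the weight nor on the data through which the weight was chosen. -/
theorem exists_moment_bounds : ∃ M : ℝ, 0 ≤ M ∧ ∀ f : 𝒳 → ℝ, Measurable f → (∀ x, |f x| ≤ 1) →
    ∫ o, |centered Q ψ f o| ∂Q ≤ M ∧ ∫ o, |centered Q ψ f o| ^ 3 ∂Q ≤ M ∧
      ∫ o, centered Q ψ f o ^ 4 ∂Q ≤ M := by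
  let D : Obs 𝒳 → ℝ := fun o => |ψ o| + (1 + C)
  have hC := h.const_nonneg
  have hD : MemLp D 4 Q := h.memLp.abs.add (memLp_const _)
  have hD0 : ∀ o, 0 ≤ D o := fun o => by positivity
  have i1 : Integrable D Q := hD.integrable (by norm_num)
  have i3 : Integrable (fun o => D o ^ 3) Q := by
    have h3 : MemLp D 3 Q := hD.mono_exponent (by norm_num)
    refine (h3.integrable_norm_pow (p := 3) (by norm_num)).congr (ae_of_all _ fun o => ?_)
    simp only [Real.norm_of_nonneg (hD0 o)]
  have i4 : Integrable (fun o => D o ^ 4) Q := by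
    refine (hD.integrable_norm_pow (p := 4) (by norm_num)).congr (ae_of_all _ fun o => ?_)
    simp only [Real.norm_of_nonneg (hD0 o)]
  refine ⟨max (∫ o, D o ∂Q) (max (∫ o, D o ^ 3 ∂Q) (∫ o, D o ^ 4 ∂Q)),
    le_max_of_le_left (integral_nonneg hD0), fun f hf hb => ?_⟩
  have hle : ∀ o, |centered Q ψ f o| ≤ D o := fun o => by
    refine (abs_sub _ _).trans (add_le_add ?_ ?_)
    · rw [abs_mul]
      exact mul_le_of_le_one_right (abs_nonneg _) (hb _)
    · refine (h.abs_scoreMean_le hf hb).trans ?_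
      have := covNorm_le (Q := Q) hf hb
      nlinarith
  refine ⟨le_max_of_le_left ?_, le_max_of_le_right (le_max_of_le_left ?_),
    le_max_of_le_right (le_max_of_le_right ?_)⟩
  · exact integral_mono_of_nonneg (ae_of_all _ fun o => abs_nonneg _) i1 (ae_of_all _ hle)
  · exact integral_mono_of_nonneg (ae_of_all _ fun o => by positivity) i3
      (ae_of_all _ fun o => pow_le_pow_left₀ (abs_nonneg _) (hle o) 3)
  · refine integral_mono_of_nonneg (ae_of_all _ fun o => by positivity) i4
      (ae_of_all _ fun o => ?_)
    have := pow_le_pow_left₀ (abs_nonneg _) (hle o) 4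
    rwa [show |centered Q ψ f o| ^ 4 = centered Q ψ f o ^ 4 from Even.pow_abs (by decide) _] at this

end RegularScore

/-! ### Predictable scores -/

variable {F : (ℕ → Obs 𝒳) → 𝒳 → ℝ}

theorem measurable_scoreMean (hψ : Measurable ψ)
    (hF : Measurable fun p : (ℕ → Obs 𝒳) × 𝒳 => F p.1 p.2) :
    Measurable fun s => scoreMean Q ψ (F s) := by
  have : Measurable fun p : (ℕ → Obs 𝒳) × Obs 𝒳 => ψ p.2 * F p.1 p.2.1 := by
    have := hF.comp (measurable_fst.prodMk (measurable_fst.comp measurable_snd) :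
      Measurable fun p : (ℕ → Obs 𝒳) × Obs 𝒳 => (p.1, p.2.1))
    exact (hψ.comp measurable_snd).mul this
  exact this.stronglyMeasurable.integral_prod_right.measurable

theorem measurable_centered (hψ : Measurable ψ)
    (hF : Measurable fun p : (ℕ → Obs 𝒳) × 𝒳 => F p.1 p.2) :
    Measurable fun p : (ℕ → Obs 𝒳) × Obs 𝒳 => centered Q ψ (F p.1) p.2 := by
  have h1 := hF.comp (measurable_fst.prodMk (measurable_fst.comp measurable_snd) :
      Measurable fun p : (ℕ → Obs 𝒳) × Obs 𝒳 => (p.1, p.2.1))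
  exact ((hψ.comp measurable_snd).mul h1).sub
    ((measurable_scoreMean hψ hF).comp measurable_fst)

theorem measurable_scoreVar (hψ : Measurable ψ)
    (hF : Measurable fun p : (ℕ → Obs 𝒳) × 𝒳 => F p.1 p.2) :
    Measurable fun s => scoreVar Q ψ (F s) :=
  ((measurable_centered (Q := Q) hψ hF).pow_const 2).stronglyMeasurable.integral_prod_right.measurable

theorem measurable_covNorm (hF : Measurable fun p : (ℕ → Obs 𝒳) × 𝒳 => F p.1 p.2) :
    Measurable fun s => covNorm Q (F s) := by
  have h1 : Measurable fun p : (ℕ → Obs 𝒳) × Obs 𝒳 => |F p.1 p.2.1| := by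
    simpa using (hF.comp (measurable_fst.prodMk (measurable_fst.comp measurable_snd) :
      Measurable fun p : (ℕ → Obs 𝒳) × Obs 𝒳 => (p.1, p.2.1))).norm
  exact h1.stronglyMeasurable.integral_prod_right.measurable

end Score


/-! ### Convergence to zero in probability -/

theorem sq_integral_abs_le {Ω : Type*} [MeasurableSpace Ω] {μ : Measure Ω}
    [IsProbabilityMeasure μ] {f : Ω → ℝ} (hf : MemLp f 2 μ) :
    (∫ ω, |f ω| ∂μ) ^ 2 ≤ ∫ ω, f ω ^ 2 ∂μ := by
  have hf' : MemLp (fun ω => |f ω|) 2 μ := hf.abs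
  have h1 := variance_nonneg (fun ω => |f ω|) μ
  rw [variance_eq_sub hf'] at h1
  simp only [Pi.pow_apply, sq_abs] at h1
  linarith

section SmallInProb

variable {Ω : Type*} [MeasurableSpace Ω] {μ : Measure Ω} [IsProbabilityMeasure μ]
  {f g h : ℕ → Ω → ℝ} {b : ℕ → ℝ}

/-- Convergence to zero in probability. -/
def SmallInProb (μ : Measure Ω) (f : ℕ → Ω → ℝ) : Prop :=
  ∀ ε : ℝ, 0 < ε → Tendsto (fun n => μ.real {ω | ε ≤ |f n ω|}) atTop (𝓝 0)

theorem SmallInProb.add (hf : SmallInProb μ f) (hg : SmallInProb μ g) :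
    SmallInProb μ fun n ω => f n ω + g n ω := by
  intro ε hε
  refine squeeze_zero (fun n => measureReal_nonneg) (fun n => ?_)
    (by simpa using (hf (ε / 2) (by positivity)).add (hg (ε / 2) (by positivity)))
  refine (measureReal_mono ?_).trans (measureReal_union_le _ _)
  intro ω hω
  by_contra hcon
  simp only [Set.mem_union, Set.mem_ofPred_eq, not_or, not_le] at hcon hω
  linarith [abs_add_le (f n ω) (g n ω)]

/-- If `f` is dominated by `g` wherever `h` is below a threshold, and both are small in
probability, then so is `f`. -/
theorem SmallInProb.mono_of_small {κ : ℝ} (hκ : 0 < κ) (hg : SmallInProb μ g)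
    (hh : SmallInProb μ h)
    (hle : ∀ᶠ n in atTop, ∀ᵐ ω ∂μ, |h n ω| < κ → |f n ω| ≤ |g n ω|) : SmallInProb μ f := by
  intro ε hε
  refine squeeze_zero' (Eventually.of_forall fun n => measureReal_nonneg) ?_
    (by simpa using (hg ε hε).add (hh κ hκ))
  filter_upwards [hle] with n hn
  have h1 : μ {ω | ε ≤ |f n ω|} ≤ μ ({ω | ε ≤ |g n ω|} ∪ {ω | κ ≤ |h n ω|}) := by
    refine measure_mono_ae ?_
    filter_upwards [hn] with ω hω hε'
    by_cases hk : |h n ω| < κ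
    · exact Or.inl (le_trans hε' (hω hk))
    · exact Or.inr (not_lt.1 hk)
  exact (ENNReal.toReal_mono (measure_ne_top _ _) h1).trans (measureReal_union_le _ _)

omit [IsProbabilityMeasure μ] in
theorem smallInProb_zero : SmallInProb μ fun _ _ => (0 : ℝ) := by
  intro ε hε
  simp [hε.not_ge]

theorem SmallInProb.mono (hg : SmallInProb μ g)
    (hle : ∀ᶠ n in atTop, ∀ᵐ ω ∂μ, |f n ω| ≤ |g n ω|) : SmallInProb μ f :=
  hg.mono_of_small one_pos smallInProb_zero (hle.mono fun _ hn => hn.mono fun _ hω _ => hω)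

theorem smallInProb_of_bound (hb : Tendsto b atTop (𝓝 0))
    (hle : ∀ᶠ n in atTop, ∀ᵐ ω ∂μ, |f n ω| ≤ b n) : SmallInProb μ f := by
  have : SmallInProb μ fun n (_ : Ω) => b n := by
    intro ε hε
    refine tendsto_const_nhds.congr' ?_
    filter_upwards [(tendsto_order.1 hb.abs).2 ε (by simpa using hε)] with n hn
    simp [hn.not_ge]
  exact this.mono (hle.mono fun n hn => hn.mono fun ω hω => hω.trans (le_abs_self _))

omit [IsProbabilityMeasure μ] in
theorem smallInProb_of_integral (hb : Tendsto b atTop (𝓝 0))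
    (hi : ∀ᶠ n in atTop, Integrable (f n) μ)
    (hle : ∀ᶠ n in atTop, ∫ ω, |f n ω| ∂μ ≤ b n) : SmallInProb μ f := by
  intro ε hε
  refine squeeze_zero' (Eventually.of_forall fun n => measureReal_nonneg) ?_
    (by simpa using hb.div_const ε)
  filter_upwards [hi, hle] with n h1 h2
  rw [le_div_iff₀ hε, mul_comm]
  exact (mul_meas_ge_le_integral_of_nonneg (ae_of_all _ fun _ => abs_nonneg _) h1.abs ε).trans h2

omit [IsProbabilityMeasure μ] in
theorem smallInProb_of_integral_sq (hb : Tendsto b atTop (𝓝 0))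
    (hi : ∀ᶠ n in atTop, MemLp (f n) 2 μ)
    (hle : ∀ᶠ n in atTop, ∫ ω, f n ω ^ 2 ∂μ ≤ b n) : SmallInProb μ f := by
  have : SmallInProb μ fun n ω => f n ω ^ 2 := smallInProb_of_integral hb
    (hi.mono fun n hn => hn.integrable_sq) (by simpa using hle)
  intro ε hε
  refine (this (ε ^ 2) (by positivity)).congr fun n => ?_
  congr 1
  ext ω
  simp only [Set.mem_ofPred_eq, abs_pow]
  exact pow_le_pow_iff_left₀ hε.le (abs_nonneg _) (by norm_num)

theorem SmallInProb.const_mul (c : ℝ) (hf : SmallInProb μ f) :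
    SmallInProb μ fun n ω => c * f n ω := by
  intro ε hε
  have hc : 0 < |c| + 1 := by positivity
  refine squeeze_zero (fun n => measureReal_nonneg) (fun n => measureReal_mono ?_)
    (hf (ε / (|c| + 1)) (by positivity))
  intro ω hω
  simp only [Set.mem_ofPred_eq, abs_mul] at hω ⊢
  rw [div_le_iff₀ hc]
  nlinarith [abs_nonneg (f n ω)]

/-- By Chebyshev's inequality `|g n|` exceeds a large level `M` with probability at most `K / M ^
2`, uniformly in `n`; below that level `f` absorbs it. -/
theorem SmallInProb.mul_of_integral_sq_le {K : ℝ} (hf : SmallInProb μ f)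
    (hg : ∀ n, MemLp (g n) 2 μ) (hK : ∀ n, ∫ ω, g n ω ^ 2 ∂μ ≤ K) :
    SmallInProb μ fun n ω => f n ω * g n ω := by
  intro ε hε
  have hK0 : 0 ≤ K := (integral_nonneg fun ω => sq_nonneg (g 0 ω)).trans (hK 0)
  rw [Metric.tendsto_nhds]
  intro η hη
  obtain ⟨M, hM0, hM⟩ : ∃ M : ℝ, 0 < M ∧ K / M ^ 2 < η / 2 := by
    refine ⟨√(2 * (K + 1) / η), by positivity, ?_⟩
    rw [Real.sq_sqrt (by positivity), div_lt_iff₀ (by positivity)]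
    field_simp
    linarith
  have h1 := hf (ε / M) (by positivity)
  filter_upwards [(tendsto_order.1 h1).2 (η / 2) (by positivity)] with n hn
  rw [Real.dist_eq, sub_zero, abs_of_nonneg measureReal_nonneg]
  have h2 : μ.real {ω | M ^ 2 ≤ g n ω ^ 2} ≤ K / M ^ 2 := by
    rw [le_div_iff₀ (by positivity), mul_comm]
    exact (mul_meas_ge_le_integral_of_nonneg (ae_of_all _ fun _ => sq_nonneg _)
      (hg n).integrable_sq _).trans (hK n)
  have h3 : μ.real {ω | ε ≤ |f n ω * g n ω|} ≤
      μ.real {ω | ε / M ≤ |f n ω|} + μ.real {ω | M ^ 2 ≤ g n ω ^ 2} := by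
    refine (measureReal_mono ?_).trans (measureReal_union_le _ _)
    intro ω hω
    by_contra hcon
    simp only [Set.mem_union, Set.mem_ofPred_eq, not_or, not_le] at hcon hω
    have h4 : |g n ω| < M := by
      rw [← abs_of_pos hM0]; exact sq_lt_sq.1 hcon.2
    rw [abs_mul] at hω
    have h5 := (lt_div_iff₀ hM0).1 hcon.1
    nlinarith [abs_nonneg (f n ω), abs_nonneg (g n ω)]
  linarith

end SmallInProb

/-! ### Deterministic sums -/

/-- Summation by parts against increasing weights: only the range of `p` matters, not its total
variation, which is not controlled pointwise in the covariates. -/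
theorem abs_sum_increment_mul_le {a p : ℕ → ℝ} (h0 : 0 ≤ a 0) (hp : ∀ t, p t ∈ Set.Icc (0 : ℝ) 1)
    (n : ℕ) (ha : ∀ t < n, a t ≤ a (t + 1)) :
    |∑ t ∈ Finset.Icc 1 n, (p t - p (t - 1)) * a t| ≤ a n := by
  -- The quantity that survives the induction is the sum minus `a n * p n`, which stays between `-a
  -- n` and `0`.
  have key : -a n ≤ ∑ t ∈ Finset.Icc 1 n, (p t - p (t - 1)) * a t - a n * p n ∧
      ∑ t ∈ Finset.Icc 1 n, (p t - p (t - 1)) * a t - a n * p n ≤ 0 ∧ 0 ≤ a n := by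
    induction n with
    | zero =>
      have h1 := (hp 0).1
      have h2 := (hp 0).2
      refine ⟨?_, ?_, h0⟩ <;> simp <;> nlinarith
    | succ n ih =>
      obtain ⟨i1, i2, i3⟩ := ih fun t ht => ha t (ht.trans n.lt_succ_self)
      rw [Finset.sum_Icc_succ_top (by omega)]
      have h3 := ha n n.lt_succ_self
      have h1 := (hp n).1
      have h2 := (hp n).2
      simp only [Nat.add_sub_cancel]
      refine ⟨?_, ?_, i3.trans h3⟩ <;> nlinarith
  have h1 := (hp n).1
  have h2 := (hp n).2
  rw [abs_le]
  constructor <;> nlinarith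

theorem sum_increments (p : ℕ → ℝ) (n : ℕ) :
    ∑ t ∈ Finset.Icc 1 n, (p t - p (t - 1)) = p n - p 0 := by
  induction n with
  | zero => simp
  | succ n ih => rw [Finset.sum_Icc_succ_top (by omega), ih]; simp

theorem sum_batches {M : Type*} [AddCommMonoid M] (B : ℕ) {a T : ℕ} (h : a ≤ T) (f : ℕ → M) :
    ∑ j ∈ Finset.Icc (a + 1) T, ∑ i ∈ batch B j, f i = ∑ i ∈ Finset.Ico (a * B) (T * B), f i := by
  induction T, h using Nat.le_induction with
  | base => simp
  | succ n hn ih =>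
    rw [Finset.sum_Icc_succ_top (by omega), ih, batch, Nat.add_sub_cancel]
    exact Finset.sum_Ico_consecutive f (Nat.mul_le_mul_right B hn)
      (Nat.mul_le_mul_right B n.le_succ)

/-- Increment `t` is evaluated exactly on the observations with `t * B ≤ i`, that is `t ≤ i / B`.
The constraint `t ≤ T - 1` is then automatic from `i < T * B`. -/
theorem sum_swap_batches {M : Type*} [AddCommMonoid M] {B : ℕ} (hB : 0 < B) (T : ℕ)
    (f : ℕ → ℕ → M) :
    ∑ t ∈ Finset.Icc 1 (T - 1), ∑ i ∈ Finset.Ico (t * B) (T * B), f t i =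
      ∑ i ∈ Finset.range (T * B), ∑ t ∈ Finset.Icc 1 (i / B), f t i := by
  refine Finset.sum_comm' fun t i => ?_
  simp only [Finset.mem_Icc, Finset.mem_Ico, Finset.mem_range, Nat.le_div_iff_mul_le hB]
  constructor
  · rintro ⟨⟨h1, -⟩, h3, h4⟩
    exact ⟨⟨h1, h3⟩, h4⟩
  · rintro ⟨⟨h1, h3⟩, h4⟩
    have : t < T := lt_of_mul_lt_mul_right (h3.trans_lt h4) (Nat.zero_le B)
    exact ⟨⟨h1, by omega⟩, h3, h4⟩

theorem sum_range_mul_batch (B T : ℕ) (f : ℕ → ℝ) (g : ℕ → ℝ) :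
    ∑ i ∈ Finset.range (T * B), f i * g (i / B) =
      ∑ m ∈ Finset.range T, (∑ i ∈ Finset.range ((m + 1) * B), f i -
        ∑ i ∈ Finset.range (m * B), f i) * g m := by
  induction T with
  | zero => simp
  | succ n ih =>
    have h1 : n * B ≤ (n + 1) * B := Nat.mul_le_mul_right B n.le_succ
    rw [Finset.sum_range_succ, ← ih, ← Finset.sum_range_add_sum_Ico _ h1,
      ← Finset.sum_range_add_sum_Ico f h1, add_sub_cancel_left, Finset.sum_mul]
    congr 1
    refine Finset.sum_congr rfl fun i hi => ?_
    rw [Finset.mem_Ico] at hi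
    rw [Nat.div_eq_of_lt_le hi.1 hi.2]

theorem sum_range_div_batch (B T : ℕ) (g : ℕ → ℝ) :
    ∑ i ∈ Finset.range (T * B), g (i / B) = B * ∑ m ∈ Finset.range T, g m := by
  have := sum_range_mul_batch B T (fun _ => 1) g
  simp only [one_mul, Finset.sum_const, Finset.card_range, nsmul_eq_mul, mul_one] at this
  rw [this, Finset.mul_sum]
  refine Finset.sum_congr rfl fun m _ => ?_
  push_cast
  ring

/-- Abel summation; only partial sums over complete batches occur, because the weight is constant on
each batch. -/
theorem sum_range_mul_batch_by_parts (B T : ℕ) (f : ℕ → ℝ) (g : ℕ → ℝ) :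
    ∑ i ∈ Finset.range (T * B), f i * g (i / B) =
      g T * ∑ i ∈ Finset.range (T * B), f i -
        ∑ m ∈ Finset.range T, (∑ i ∈ Finset.range ((m + 1) * B), f i) * (g (m + 1) - g m) := by
  rw [sum_range_mul_batch]
  induction T with
  | zero => simp
  | succ n ih =>
    rw [Finset.sum_range_succ, ih, Finset.sum_range_succ]
    ring

/-- Dominated convergence for series: each fixed term vanishes as `T` grows, and `m < T` keeps the
square root at most one. -/
theorem tendsto_sum_sqrt_mul {ε : ℕ → ℝ} (hε : Summable ε) (h0 : ∀ m, 0 ≤ ε m) :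
    Tendsto (fun T : ℕ => ∑ m ∈ Finset.range T, √(((m : ℝ) + 1) / T) * ε m) atTop (𝓝 0) := by
  have h := tendsto_tsum_of_dominated_convergence (𝓕 := atTop) (bound := ε) (g := fun _ => (0 : ℝ))
    (f := fun (T : ℕ) (m : ℕ) => if m < T then √(((m : ℝ) + 1) / T) * ε m else 0) hε ?_ ?_
  · rw [tsum_zero] at h
    refine h.congr fun T => ?_
    rw [tsum_eq_sum (s := Finset.range T) fun m hm => by
      simp only [Finset.mem_range] at hm; simp [hm]]
    exact Finset.sum_congr rfl fun m hm => if_pos (Finset.mem_range.1 hm)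
  · intro m
    have h1 : Tendsto (fun T : ℕ => √(((m : ℝ) + 1) / T) * ε m) atTop (𝓝 0) := by
      have := (Real.continuous_sqrt.tendsto 0).comp
        (tendsto_const_div_atTop_nhds_zero_nat ((m : ℝ) + 1))
      simpa using this.mul_const (ε m)
    refine h1.congr' ?_
    filter_upwards [eventually_gt_atTop m] with T hT
    rw [if_pos hT]
  · refine Eventually.of_forall fun T m => ?_
    split_ifs with hm
    · rw [norm_mul, Real.norm_of_nonneg (Real.sqrt_nonneg _), Real.norm_of_nonneg (h0 m)]
      refine mul_le_of_le_one_left (h0 m) (Real.sqrt_le_one.2 ?_)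
      have : (0 : ℝ) < T := by exact_mod_cast (Nat.zero_le m).trans_lt hm
      rw [div_le_one this]
      exact_mod_cast hm
    · simpa using h0 m

theorem sum_inv_sub_eq (T : ℕ) :
    ∑ m ∈ Finset.range T, 1 / ((T : ℝ) - m) = ∑ m ∈ Finset.range T, 1 / ((m : ℝ) + 1) := by
  rw [← Finset.sum_range_reflect]
  refine Finset.sum_congr rfl fun m hm => ?_
  have hm := Finset.mem_range.1 hm
  rw [show T - 1 - m = T - (m + 1) by omega, Nat.cast_sub hm]
  push_cast
  ring_nf

theorem sum_inv_le (T : ℕ) : ∑ m ∈ Finset.range T, 1 / ((m : ℝ) + 1) ≤ 1 + Real.log T := by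
  have := harmonic_le_one_add_log T
  simpa [harmonic] using this

/-- The cumulated effect of the weights `1 / (T - t)` replacing `1 / T`. -/
theorem tendsto_weight_discrepancy {δ K : ℝ} (hδ : 0 < δ) (hδ1 : δ ≤ 1) (hK : 0 ≤ K) :
    Tendsto (fun T : ℕ => T * (∑ t ∈ Finset.Icc 1 (T - 1),
        K * (t : ℝ) ^ (-(1 + δ)) * (1 / ((T : ℝ) - t) - 1 / T)) *
      ∑ m ∈ Finset.range T, 1 / ((T : ℝ) - m)) atTop (𝓝 0) := by
  have hlim : Tendsto (fun T : ℕ => 2 * K * ((1 + Real.log T) / (T : ℝ) ^ (δ / 2)) ^ 2) atTop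
      (𝓝 0) := by
    have h1 : Tendsto (fun x : ℝ => 1 / x ^ (δ / 2)) atTop (𝓝 0) := by
      simpa [Function.comp_def] using
        tendsto_inv_atTop_zero.comp (tendsto_rpow_atTop (y := δ / 2) (by positivity))
    have h2 : Tendsto (fun x : ℝ => Real.log x / x ^ (δ / 2)) atTop (𝓝 0) :=
      (isLittleO_log_rpow_atTop (by positivity)).tendsto_div_nhds_zero
    have h3 := ((h1.add h2).comp tendsto_natCast_atTop_atTop).pow 2 |>.const_mul (2 * K)
    simp only [add_zero, ne_eq, OfNat.ofNat_ne_zero, not_false_eq_true, zero_pow, mul_zero] at h3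
    refine h3.congr fun T => ?_
    simp only [Function.comp_apply, add_div]
  refine squeeze_zero' ?_ ?_ hlim
  · filter_upwards [eventually_gt_atTop 0] with T hT
    refine mul_nonneg (mul_nonneg (by positivity) (Finset.sum_nonneg fun t ht => ?_))
      (Finset.sum_nonneg fun m hm => ?_)
    · have ht := Finset.mem_Icc.1 ht
      have h1 : (0 : ℝ) < (T : ℝ) - t := sub_pos.2 (by exact_mod_cast (by omega : t < T))
      refine mul_nonneg (by positivity) (sub_nonneg.2 (one_div_le_one_div_of_le h1 ?_))
      linarith [(Nat.cast_nonneg t : (0 : ℝ) ≤ t)]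
    · have hm : (m : ℝ) < T := by exact_mod_cast Finset.mem_range.1 hm
      exact one_div_nonneg.2 (by linarith)
  · filter_upwards [eventually_gt_atTop 0] with T hT
    have hT0 : (0 : ℝ) < T := by exact_mod_cast hT
    set H := ∑ m ∈ Finset.range T, 1 / ((m : ℝ) + 1) with hH
    have hH0 : 0 ≤ H := Finset.sum_nonneg fun m _ => by positivity
    rw [sum_inv_sub_eq, ← hH]
    -- The difference of weights is `t / (T (T - t))`, which gains a factor `t`; then `t ^ (1 - δ) ≤
    -- T ^ (1 - δ)`, where `δ ≤ 1` is needed. The remaining `1 / (t (T - t))` splits into partial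
    -- fractions, each summing to at most a harmonic number.
    have hterm : ∀ t ∈ Finset.Icc 1 (T - 1), K * (t : ℝ) ^ (-(1 + δ)) * (1 / ((T : ℝ) - t) - 1 / T) ≤
        K * (T : ℝ) ^ (-δ) / T * (1 / (t : ℝ) + 1 / ((T : ℝ) - t)) := by
      intro t ht
      have ht := Finset.mem_Icc.1 ht
      have ht0 : (0 : ℝ) < t := by exact_mod_cast ht.1
      have h1 : (0 : ℝ) < (T : ℝ) - t := sub_pos.2 (by exact_mod_cast (by omega : t < T))
      have e1 : (t : ℝ) ^ (-(1 + δ)) * (1 / ((T : ℝ) - t) - 1 / T) =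
          (t : ℝ) ^ (1 - δ) * (1 / (t * T * (T - t))) := by
        have : (t : ℝ) ^ (-(1 + δ)) = (t : ℝ) ^ (1 - δ) / t ^ 2 := by
          rw [← Real.rpow_natCast, ← Real.rpow_sub ht0]
          congr 1
          push_cast
          ring
        rw [this]
        field_simp
        ring
      have e2 : (T : ℝ) ^ (-δ) / T * (1 / (t : ℝ) + 1 / ((T : ℝ) - t)) =
          (T : ℝ) ^ (1 - δ) * (1 / (t * T * (T - t))) := by
        have : (T : ℝ) ^ (-δ) = (T : ℝ) ^ (1 - δ) / T := by
          rw [← Real.rpow_sub_one hT0.ne']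
          congr 1
          ring
        rw [this]
        field_simp
        ring
      rw [mul_assoc, e1, mul_div_assoc, mul_assoc K, e2]
      refine mul_le_mul_of_nonneg_left (mul_le_mul_of_nonneg_right ?_ (by positivity)) hK
      exact Real.rpow_le_rpow ht0.le (by linarith) (by linarith)
    have hs1 : ∑ t ∈ Finset.Icc 1 (T - 1), 1 / (t : ℝ) ≤ H := by
      have h := Finset.sum_Ico_add' (fun t : ℕ => 1 / (t : ℝ)) 0 T 1
      push_cast at h
      rw [hH, Finset.range_eq_Ico, h]
      refine Finset.sum_le_sum_of_subset_of_nonneg ?_ fun t _ _ => by positivity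
      intro t ht
      simp only [Finset.mem_Icc, Finset.mem_Ico] at ht ⊢
      omega
    have hs2 : ∑ t ∈ Finset.Icc 1 (T - 1), 1 / ((T : ℝ) - t) ≤ H := by
      rw [hH, ← sum_inv_sub_eq]
      refine Finset.sum_le_sum_of_subset_of_nonneg ?_ fun t ht _ => ?_
      · intro t ht
        simp only [Finset.mem_Icc, Finset.mem_range] at ht ⊢
        omega
      · have hm : (t : ℝ) < T := by exact_mod_cast Finset.mem_range.1 ht
        exact one_div_nonneg.2 (by linarith)
    have hρ : ∑ t ∈ Finset.Icc 1 (T - 1), K * (t : ℝ) ^ (-(1 + δ)) * (1 / ((T : ℝ) - t) - 1 / T) ≤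
        K * (T : ℝ) ^ (-δ) / T * (2 * H) := by
      refine (Finset.sum_le_sum hterm).trans ?_
      rw [← Finset.mul_sum, Finset.sum_add_distrib]
      exact mul_le_mul_of_nonneg_left (by linarith) (by positivity)
    have hHlog : H ≤ 1 + Real.log T := sum_inv_le T
    calc _ ≤ T * (K * (T : ℝ) ^ (-δ) / T * (2 * H)) * H := by gcongr
      _ = 2 * K * (T : ℝ) ^ (-δ) * H ^ 2 := by field_simp
      _ ≤ 2 * K * (T : ℝ) ^ (-δ) * (1 + Real.log T) ^ 2 := by gcongr
      _ = _ := by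
        have : (T : ℝ) ^ (-δ) = (((T : ℝ) ^ (δ / 2)) ^ 2)⁻¹ := by
          rw [← Real.rpow_natCast, ← Real.rpow_mul hT0.le, ← Real.rpow_neg hT0.le]
          congr 1
          push_cast
          ring
        rw [this, div_pow]
        ring


/-! ### Sample variances -/

/-- The sample variance of `x i`, `i ∈ I` (zero for a single observation). -/
noncomputable def smpVar (I : Finset ℕ) (x : ℕ → ℝ) : ℝ :=
  1 / ((I.card : ℝ) - 1) * ∑ i ∈ I, (x i - 1 / (I.card : ℝ) * ∑ l ∈ I, x l) ^ 2

section SampleVariance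

variable {I : Finset ℕ} (x y : ℕ → ℝ)

theorem inv_card_sub_one_nonneg (hI : I.Nonempty) : 0 ≤ 1 / ((I.card : ℝ) - 1) := by
  have : (1 : ℝ) ≤ I.card := by exact_mod_cast hI.card_pos
  exact one_div_nonneg.2 (by linarith)

theorem smpVar_nonneg (hI : I.Nonempty) : 0 ≤ smpVar I x :=
  mul_nonneg (inv_card_sub_one_nonneg hI) (Finset.sum_nonneg fun _ _ => sq_nonneg _)

/-- Young's inequality for the cross term. The parameter `ε` is kept free so that it can tend to
zero with `T`. -/
theorem abs_smpVar_add_sub_le (hI : I.Nonempty) {ε : ℝ} (hε : 0 < ε) :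
    |smpVar I (fun i => x i + y i) - smpVar I x| ≤
      ε * smpVar I x + (1 + 1 / ε) * smpVar I y := by
  set a : ℕ → ℝ := fun i => x i - 1 / (I.card : ℝ) * ∑ l ∈ I, x l
  set b : ℕ → ℝ := fun i => y i - 1 / (I.card : ℝ) * ∑ l ∈ I, y l
  have e1 : smpVar I (fun i => x i + y i) - smpVar I x =
      1 / ((I.card : ℝ) - 1) * ∑ i ∈ I, (2 * a i * b i + b i ^ 2) := by
    rw [smpVar, smpVar, ← mul_sub, ← Finset.sum_sub_distrib, Finset.sum_add_distrib]
    congr 1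
    refine Finset.sum_congr rfl fun i _ => ?_
    simp only [a, b]
    ring
  have e2 : ε * smpVar I x + (1 + 1 / ε) * smpVar I y =
      1 / ((I.card : ℝ) - 1) * ∑ i ∈ I, (ε * a i ^ 2 + (1 + 1 / ε) * b i ^ 2) := by
    rw [smpVar, smpVar, Finset.sum_add_distrib, ← Finset.mul_sum, ← Finset.mul_sum]
    ring
  have hc := inv_card_sub_one_nonneg hI
  rw [e1, e2, abs_mul, abs_of_nonneg hc]
  refine mul_le_mul_of_nonneg_left ((Finset.abs_sum_le_sum_abs _ _).trans
    (Finset.sum_le_sum fun i _ => ?_)) hc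
  have h1 : 2 * (a i * b i) ≤ ε * a i ^ 2 + 1 / ε * b i ^ 2 := by
    have := mul_nonneg (one_div_nonneg.2 hε.le) (sq_nonneg (ε * a i - b i))
    have e : 1 / ε * (ε * a i - b i) ^ 2 = ε * a i ^ 2 + 1 / ε * b i ^ 2 - 2 * (a i * b i) := by
      field_simp
      ring
    linarith
  have h2 : -(2 * (a i * b i)) ≤ ε * a i ^ 2 + 1 / ε * b i ^ 2 := by
    have := mul_nonneg (one_div_nonneg.2 hε.le) (sq_nonneg (ε * a i + b i))
    have e : 1 / ε * (ε * a i + b i) ^ 2 = ε * a i ^ 2 + 1 / ε * b i ^ 2 + 2 * (a i * b i) := by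
      field_simp
      ring
    linarith
  have h3 := sq_nonneg (b i)
  have h4 := sq_nonneg (a i)
  have h5 : 0 < 1 / ε := by positivity
  rw [abs_le]
  constructor <;> nlinarith

/-- The usual bias identity about an arbitrary centre; the conditional mean of the score will serve
as `m`. -/
theorem smpVar_eq (hI : I.Nonempty) (m : ℝ) :
    smpVar I x = 1 / ((I.card : ℝ) - 1) * (∑ i ∈ I, (x i - m) ^ 2 -
      I.card * (1 / (I.card : ℝ) * ∑ i ∈ I, (x i - m)) ^ 2) := by
  have hn : (I.card : ℝ) ≠ 0 := by exact_mod_cast hI.card_pos.ne'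
  rw [smpVar]
  congr 1
  set n : ℝ := (I.card : ℝ)
  set S := ∑ l ∈ I, x l
  have e1 : ∑ i ∈ I, (x i - 1 / n * S) ^ 2 = ∑ i ∈ I, x i ^ 2 - 2 * (1 / n * S) * S +
      n * (1 / n * S) ^ 2 := by
    simp_rw [sub_sq]
    rw [Finset.sum_add_distrib, Finset.sum_sub_distrib, Finset.sum_const, nsmul_eq_mul,
      ← Finset.sum_mul, ← Finset.mul_sum]
    ring
  have e2 : ∑ i ∈ I, (x i - m) ^ 2 = ∑ i ∈ I, x i ^ 2 - 2 * m * S + n * m ^ 2 := by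
    simp_rw [sub_sq]
    rw [Finset.sum_add_distrib, Finset.sum_sub_distrib, Finset.sum_const, nsmul_eq_mul,
      ← Finset.sum_mul, ← Finset.mul_sum]
    ring
  have e3 : ∑ i ∈ I, (x i - m) = S - n * m := by
    rw [Finset.sum_sub_distrib, Finset.sum_const, nsmul_eq_mul]
  rw [e1, e2, e3]
  field_simp
  ring

/-- A single observation is no exception, since the left side is then `1 / 0 = 0`. -/
theorem inv_card_sub_one_le (hI : I.Nonempty) : 1 / ((I.card : ℝ) - 1) ≤ 2 / I.card := by
  have h0 : 1 ≤ I.card := hI.card_pos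
  rcases h0.eq_or_lt with h | h
  · rw [← h]; norm_num
  · have h2 : (2 : ℝ) ≤ I.card := by exact_mod_cast h
    rw [div_le_div_iff₀ (by linarith) (by linarith)]
    linarith

theorem smpVar_le (hI : I.Nonempty) (m : ℝ) :
    smpVar I x ≤ 2 / I.card * ∑ i ∈ I, (x i - m) ^ 2 := by
  rw [smpVar_eq x hI m]
  refine mul_le_mul (inv_card_sub_one_le hI) ?_ ?_ (by positivity)
  · have : 0 ≤ (I.card : ℝ) * (1 / (I.card : ℝ) * ∑ i ∈ I, (x i - m)) ^ 2 := by positivity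
    linarith
  · rw [sub_nonneg, mul_pow]
    have h := sq_sum_le_card_mul_sum_sq (s := I) (f := fun i => x i - m)
    have hn : (0 : ℝ) < I.card := by exact_mod_cast hI.card_pos
    calc _ = 1 / (I.card : ℝ) * (∑ i ∈ I, (x i - m)) ^ 2 := by field_simp
      _ ≤ 1 / (I.card : ℝ) * (I.card * ∑ i ∈ I, (x i - m) ^ 2) := by gcongr
      _ = _ := by field_simp

theorem abs_smpVar_sub_le (hI : I.Nonempty) (m : ℝ) {V : ℝ} (hV : 0 ≤ V) :
    |smpVar I x - V| ≤ 2 * |1 / (I.card : ℝ) * ∑ i ∈ I, ((x i - m) ^ 2 - V)| +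
      2 * (1 / (I.card : ℝ) * ∑ i ∈ I, (x i - m)) ^ 2 + 2 / I.card * V := by
  have h0 : 1 ≤ I.card := hI.card_pos
  have hn : (0 : ℝ) < I.card := by exact_mod_cast h0
  set A := 1 / (I.card : ℝ) * ∑ i ∈ I, ((x i - m) ^ 2 - V) with hA
  set D := 1 / (I.card : ℝ) * ∑ i ∈ I, (x i - m) with hD
  have hsum : ∑ i ∈ I, (x i - m) ^ 2 = I.card * (A + V) := by
    rw [hA, Finset.sum_sub_distrib, Finset.sum_const, nsmul_eq_mul]
    field_simp
    ring
  rcases h0.eq_or_lt with h | h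
  -- With a single observation the sample variance is zero and the last term of the bound absorbs
  -- the whole error `V`.
  · have hz : smpVar I x = 0 := by rw [smpVar, ← h]; simp
    rw [hz, zero_sub, abs_neg, abs_of_nonneg hV, ← h]
    have := abs_nonneg A
    push_cast
    nlinarith [sq_nonneg D]
  · have h2 : (2 : ℝ) ≤ I.card := by exact_mod_cast h
    have h1 : (0 : ℝ) < (I.card : ℝ) - 1 := by linarith
    have e : smpVar I x - V = (I.card : ℝ) / ((I.card : ℝ) - 1) * (A - D ^ 2) +
        1 / ((I.card : ℝ) - 1) * V := by
      rw [smpVar_eq x hI m, hsum, ← hD]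
      field_simp
      ring
    have c1 : (I.card : ℝ) / ((I.card : ℝ) - 1) ≤ 2 := by
      rw [div_le_iff₀ h1]; linarith
    have c2 := inv_card_sub_one_le hI
    have c3 : 0 ≤ (I.card : ℝ) / ((I.card : ℝ) - 1) := by positivity
    rw [e]
    refine (abs_add_le _ _).trans (add_le_add ?_ ?_)
    · rw [abs_mul, abs_of_nonneg c3]
      have : |A - D ^ 2| ≤ |A| + D ^ 2 := (abs_sub _ _).trans_eq (by rw [abs_of_nonneg (sq_nonneg D)])
      calc _ ≤ 2 * (|A| + D ^ 2) := mul_le_mul c1 this (abs_nonneg _) (by norm_num)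
        _ = _ := by ring
    · rw [abs_of_nonneg (mul_nonneg (by positivity) hV)]
      exact mul_le_mul_of_nonneg_right c2 hV

end SampleVariance

/-! ### Sample variances of scores that are fixed before the sample -/

/-- `L¹` bound for a quantity dominated by a normalized sum, a squared normalized sum and a
constant. -/
theorem integral_abs_le_of_normalized_sums {Ω : Type*} [MeasurableSpace Ω] {μ : Measure Ω}
    [IsProbabilityMeasure μ] {X A D : Ω → ℝ} {n K C : ℝ} (hn : 1 ≤ n) (hC : 0 ≤ C)
    (hX : AEStronglyMeasurable X μ) (hA : MemLp A 2 μ) (hA2 : ∫ ω, A ω ^ 2 ∂μ ≤ n * K)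
    (hD : MemLp D 2 μ) (hD2 : ∫ ω, D ω ^ 2 ∂μ ≤ n * C)
    (hle : ∀ ω, |X ω| ≤ 2 * |1 / n * A ω| + 2 * (1 / n * D ω) ^ 2 + 2 / n * C) :
    Integrable X μ ∧ ∫ ω, |X ω| ∂μ ≤ (2 * √K + 4 * C) / √n := by
  have hn0 : 0 < n := by linarith
  have hle' : ∀ ω, |X ω| ≤ 2 * (1 / n * |A ω|) + 2 * ((1 / n) ^ 2 * D ω ^ 2) + 2 / n * C := by
    intro ω
    refine (hle ω).trans_eq ?_
    rw [abs_mul, abs_of_nonneg (one_div_nonneg.2 hn0.le), mul_pow]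
  have hi1 : Integrable (fun ω => 2 * (1 / n * |A ω|)) μ :=
    ((hA.integrable (by norm_num)).abs.const_mul _).const_mul _
  have hi2 : Integrable (fun ω => 2 * ((1 / n) ^ 2 * D ω ^ 2)) μ :=
    (hD.integrable_sq.const_mul _).const_mul _
  have hi12 : Integrable (fun ω => 2 * (1 / n * |A ω|) + 2 * ((1 / n) ^ 2 * D ω ^ 2)) μ :=
    hi1.add hi2
  have hi : Integrable (fun ω => 2 * (1 / n * |A ω|) + 2 * ((1 / n) ^ 2 * D ω ^ 2) +
      2 / n * C) μ := hi12.add (integrable_const _)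
  have hint := hi.mono' hX (ae_of_all _ hle')
  refine ⟨hint, (integral_mono hint.abs hi hle').trans ?_⟩
  rw [integral_add hi12 (integrable_const _), integral_add hi1 hi2]
  simp only [integral_const_mul, integral_const, probReal_univ, one_smul]
  have hA1 : ∫ ω, |A ω| ∂μ ≤ √(n * K) :=
    Real.le_sqrt_of_sq_le ((sq_integral_abs_le hA).trans hA2)
  have hsqrt : 0 < √n := Real.sqrt_pos.2 hn0
  have hsq : √n ^ 2 = n := Real.sq_sqrt hn0.le
  have hs1 : 1 / n ≤ 1 / √n := by
    refine one_div_le_one_div_of_le hsqrt ?_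
    rw [Real.sqrt_le_left hn0.le]
    nlinarith
  have t1 : 1 / n * ∫ ω, |A ω| ∂μ ≤ √K / √n := by
    calc _ ≤ 1 / n * √(n * K) := by gcongr
      _ = _ := by
        rw [Real.sqrt_mul hn0.le]
        nth_rewrite 1 [← hsq]
        field_simp
  have t2 : (1 / n) ^ 2 * ∫ ω, D ω ^ 2 ∂μ ≤ C * (1 / √n) := by
    calc _ ≤ (1 / n) ^ 2 * (n * C) := by gcongr
      _ = C * (1 / n) := by field_simp
      _ ≤ _ := by gcongr
  have t3 : 2 / n * C ≤ 2 * C * (1 / √n) := by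
    calc _ = 2 * C * (1 / n) := by ring
      _ ≤ _ := by gcongr
  calc _ ≤ 2 * (√K / √n) + 2 * (C * (1 / √n)) + 2 * C * (1 / √n) := by gcongr
    _ = _ := by ring

section Block

variable {𝒳 : Type*} [MeasurableSpace 𝒳] {Q : Measure (Obs 𝒳)} [IsProbabilityMeasure Q]
  {ψ : Obs 𝒳 → ℝ} {C σ : ℝ} {F : (ℕ → Obs 𝒳) → 𝒳 → ℝ} {b : ℝ} {M : ℕ} {I : Finset ℕ}

theorem measurable_score_eval (hψ : Measurable ψ)
    (hF : Measurable fun p : (ℕ → Obs 𝒳) × 𝒳 => F p.1 p.2) (i : ℕ) :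
    Measurable fun s : ℕ → Obs 𝒳 => ψ (s i) * F s (s i).1 := by
  have h1 : Measurable fun s : ℕ → Obs 𝒳 => (s i).1 := measurable_fst.comp (measurable_pi_apply i)
  exact (hψ.comp (measurable_pi_apply i)).mul (hF.comp (measurable_id.prodMk h1))

theorem measurable_smpVar {x : (ℕ → Obs 𝒳) → ℕ → ℝ} (hx : ∀ i ∈ I, Measurable fun s => x s i) :
    Measurable fun s => smpVar I (x s) := by
  have h1 : Measurable fun s => ∑ l ∈ I, x s l := Finset.measurable_fun_sum _ hx
  unfold smpVar
  exact (Finset.measurable_fun_sum _ fun i hi =>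
    ((hx i hi).sub (h1.const_mul _)).pow_const 2).const_mul _

variable (h : RegularScore Q ψ C σ)
  (hF : Measurable fun p : (ℕ → Obs 𝒳) × 𝒳 => F p.1 p.2)
  (hd : DependsOn F (Set.Iio M)) (hI : ∀ i ∈ I, M ≤ i) (hne : I.Nonempty)

include h hF hd hI

/-- Centering at the conditional mean rather than the sample mean costs a factor two (`smpVar_le`).
Each centered square then has mean at most `v`, because `F` is determined before any index of `I` is
observed. -/
theorem integral_smpVar_le (hne : I.Nonempty) (hb : ∀ s x, |F s x| ≤ b) {v : ℝ}
    (hv : ∀ᵐ s ∂seqLaw Q, scoreVar Q ψ (F s) ≤ v) :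
    Integrable (fun s => smpVar I fun i => ψ (s i) * F s (s i).1) (seqLaw Q) ∧
      ∫ s, smpVar I (fun i => ψ (s i) * F s (s i).1) ∂seqLaw Q ≤ 2 * v := by
  have hFs : ∀ s, Measurable (F s) := fun s => hF.comp measurable_prodMk_left
  have hsq : ∀ i ∈ I, Integrable (fun s : ℕ → Obs 𝒳 => centered Q ψ (F s) (s i) ^ 2) (seqLaw Q) ∧
      ∫ s, centered Q ψ (F s) (s i) ^ 2 ∂seqLaw Q ≤ v := by
    intro i hi
    obtain ⟨-, h1, -, h2⟩ := integrable_of_condMean_le (Q := Q)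
      (H := fun s z => centered Q ψ (F s) z ^ 2) (m := M) (n := i) (c := v)
      ((measurable_centered h.measurable hF).pow_const 2)
      (hd.postcomp fun f z => centered Q ψ f z ^ 2) (hI i hi)
      (ae_of_all _ fun s => ((h.memLp_centered (hFs s) (hb s)).mono_exponent
        (by norm_num : (2 : ENNReal) ≤ 4)).integrable_sq)
      (by simpa [scoreVar] using hv)
    exact ⟨h1, by simpa using h2⟩
  have hn : (0 : ℝ) < I.card := by exact_mod_cast hne.card_pos
  have hint : Integrable (fun s : ℕ → Obs 𝒳 => 2 / (I.card : ℝ) *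
      ∑ i ∈ I, centered Q ψ (F s) (s i) ^ 2) (seqLaw Q) :=
    (integrable_finsetSum _ fun i hi => (hsq i hi).1).const_mul _
  have hle : ∀ s : ℕ → Obs 𝒳, smpVar I (fun i => ψ (s i) * F s (s i).1) ≤
      2 / (I.card : ℝ) * ∑ i ∈ I, centered Q ψ (F s) (s i) ^ 2 := fun s =>
    smpVar_le _ hne (scoreMean Q ψ (F s))
  have hm : Measurable fun s : ℕ → Obs 𝒳 => smpVar I fun i => ψ (s i) * F s (s i).1 :=
    measurable_smpVar fun i _ => measurable_score_eval h.measurable hF i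
  have hint' := hint.mono' hm.aestronglyMeasurable (ae_of_all _ fun s => by
    rw [Real.norm_of_nonneg (smpVar_nonneg _ hne)]; exact hle s)
  refine ⟨hint', (integral_mono hint' hint hle).trans ?_⟩
  rw [integral_const_mul, integral_finsetSum _ fun i hi => (hsq i hi).1]
  calc _ ≤ 2 / (I.card : ℝ) * ∑ _i ∈ I, v := by
        gcongr with i hi
        exact (hsq i hi).2
    _ = 2 * v := by
        rw [Finset.sum_const, nsmul_eq_mul]
        field_simp

/-- As `F` is fixed before the sample, both the centered scores and the deviations of their squares
from the conditional variance are martingale differences along `I`. The fourth moment bounds the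
variance of the squares. -/
theorem centered_sum_sq_le (hb : ∀ s x, |F s x| ≤ 1) {K : ℝ}
    (hK : ∀ f : 𝒳 → ℝ, Measurable f → (∀ x, |f x| ≤ 1) → ∫ o, centered Q ψ f o ^ 4 ∂Q ≤ K) :
    (MemLp (fun s => ∑ i ∈ I, (centered Q ψ (F s) (s i) ^ 2 - scoreVar Q ψ (F s))) 2 (seqLaw Q) ∧
      ∫ s, (∑ i ∈ I, (centered Q ψ (F s) (s i) ^ 2 - scoreVar Q ψ (F s))) ^ 2 ∂seqLaw Q ≤
        I.card * K) ∧
    (MemLp (fun s => ∑ i ∈ I, centered Q ψ (F s) (s i)) 2 (seqLaw Q) ∧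
      ∫ s, (∑ i ∈ I, centered Q ψ (F s) (s i)) ^ 2 ∂seqLaw Q ≤ I.card * C) := by
  have hFs : ∀ s, Measurable (F s) := fun s => hF.comp measurable_prodMk_left
  have hcm := measurable_centered (Q := Q) h.measurable hF
  have hvm := measurable_scoreVar (Q := Q) h.measurable hF
  have hL4 : ∀ s, MemLp (centered Q ψ (F s)) 4 Q := fun s => h.memLp_centered (hFs s) (hb s)
  have hL2 : ∀ s, MemLp (centered Q ψ (F s)) 2 Q := fun s => (hL4 s).mono_exponent (by norm_num)
  have hint4 : ∀ s, Integrable (fun z => centered Q ψ (F s) z ^ 4) Q := fun s => by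
    refine ((hL4 s).integrable_norm_pow (p := 4) (by norm_num)).congr (ae_of_all _ fun o => ?_)
    simp only [Real.norm_eq_abs]
    exact Even.pow_abs (by decide) _
  have hL2sq : ∀ s, MemLp (fun z => centered Q ψ (F s) z ^ 2) 2 Q := fun s => by
    refine (memLp_two_iff_integrable_sq ((hL2 s).aestronglyMeasurable.pow 2)).2 ?_
    refine (hint4 s).congr (ae_of_all _ fun o => ?_)
    simp only [Pi.pow_apply]
    ring
  have hL2d : ∀ s, MemLp (fun z => centered Q ψ (F s) z ^ 2 - scoreVar Q ψ (F s)) 2 Q :=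
    fun s => (hL2sq s).sub (memLp_const _)
  constructor
  · obtain ⟨a1, a2⟩ := sq_sum_martingale_le (Q := Q) I (c := fun _ => K)
      (H := fun _ s z => centered Q ψ (F s) z ^ 2 - scoreVar Q ψ (F s))
      (fun i _ => (hcm.pow_const 2).sub (hvm.comp measurable_fst))
      (fun i hi => (hd.mono (Set.Iio_subset_Iio (hI i hi))).postcomp
        fun f z => centered Q ψ f z ^ 2 - scoreVar Q ψ f)
      (fun i _ => ae_of_all _ fun s => by
        rw [integral_sub (hL2 s).integrable_sq (integrable_const _)]
        simp [scoreVar])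
      (fun i _ => ae_of_all _ fun s => (hL2d s).integrable_sq)
      (fun i _ => ae_of_all _ fun s => by
        have h1 := variance_eq_sub (hL2sq s)
        rw [variance_eq_integral (hL2sq s).aestronglyMeasurable.aemeasurable] at h1
        change ∫ z, (centered Q ψ (F s) z ^ 2 - ∫ z, centered Q ψ (F s) z ^ 2 ∂Q) ^ 2 ∂Q ≤ K
        rw [h1]
        have h2 : ∫ z, ((fun z => centered Q ψ (F s) z ^ 2) ^ 2) z ∂Q =
            ∫ z, centered Q ψ (F s) z ^ 4 ∂Q := integral_congr_ae (ae_of_all _ fun z => by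
              simp only [Pi.pow_apply]; ring)
        rw [h2]
        have h3 := hK (F s) (hFs s) (hb s)
        have h4 := sq_nonneg (∫ z, centered Q ψ (F s) z ^ 2 ∂Q)
        linarith)
    rw [Finset.sum_const, nsmul_eq_mul] at a2
    exact ⟨a1, a2⟩
  · obtain ⟨b1, b2⟩ := sq_sum_martingale_le (Q := Q) I (c := fun _ => C)
      (H := fun _ s z => centered Q ψ (F s) z)
      (fun i _ => hcm)
      (fun i hi => (hd.mono (Set.Iio_subset_Iio (hI i hi))).postcomp fun f z => centered Q ψ f z)
      (fun i _ => ae_of_all _ fun s => h.integral_centered (hFs s) (hb s))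
      (fun i _ => ae_of_all _ fun s => (hL2 s).integrable_sq)
      (fun i _ => ae_of_all _ fun s => h.scoreVar_le_const (hFs s) (hb s))
    rw [Finset.sum_const, nsmul_eq_mul] at b2
    exact ⟨b1, b2⟩

/-- The two martingale sums, divided by the sample size, give the rate `n^(-1/2)`. An explicit rate
is needed because the samples to be averaged have all sizes down to a single batch. -/
theorem integral_abs_smpVar_sub_le (hne : I.Nonempty) (hb : ∀ s x, |F s x| ≤ 1) {K : ℝ}
    (hK : ∀ f : 𝒳 → ℝ, Measurable f → (∀ x, |f x| ≤ 1) → ∫ o, centered Q ψ f o ^ 4 ∂Q ≤ K) :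
    Integrable (fun s => smpVar I (fun i => ψ (s i) * F s (s i).1) - scoreVar Q ψ (F s))
        (seqLaw Q) ∧
      ∫ s, |smpVar I (fun i => ψ (s i) * F s (s i).1) - scoreVar Q ψ (F s)| ∂seqLaw Q ≤
        (2 * √K + 4 * C) / √(I.card : ℝ) := by
  have hFs : ∀ s, Measurable (F s) := fun s => hF.comp measurable_prodMk_left
  have hC := h.const_nonneg
  have hm : Measurable fun s : ℕ → Obs 𝒳 =>
      smpVar I (fun i => ψ (s i) * F s (s i).1) - scoreVar Q ψ (F s) :=
    (measurable_smpVar fun i _ => measurable_score_eval h.measurable hF i).sub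
      (measurable_scoreVar h.measurable hF)
  obtain ⟨⟨a1, a2⟩, b1, b2⟩ := centered_sum_sq_le h hF hd hI hb hK
  have hle : ∀ s : ℕ → Obs 𝒳, |smpVar I (fun i => ψ (s i) * F s (s i).1) - scoreVar Q ψ (F s)| ≤
      2 * |1 / (I.card : ℝ) * ∑ i ∈ I, (centered Q ψ (F s) (s i) ^ 2 - scoreVar Q ψ (F s))| +
      2 * (1 / (I.card : ℝ) * ∑ i ∈ I, centered Q ψ (F s) (s i)) ^ 2 +
        2 / (I.card : ℝ) * scoreVar Q ψ (F s) := fun s =>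
    abs_smpVar_sub_le _ hne (scoreMean Q ψ (F s)) scoreVar_nonneg
  have hVC : ∀ s, scoreVar Q ψ (F s) ≤ C := fun s => h.scoreVar_le_const (hFs s) (hb s)
  refine integral_abs_le_of_normalized_sums (by exact_mod_cast hne.card_pos) hC
    hm.aestronglyMeasurable a1 a2 b1 b2 fun s => (hle s).trans ?_
  have := mul_le_mul_of_nonneg_left (hVC s) (by positivity : 0 ≤ 2 / (I.card : ℝ))
  linarith

end Block


/-! ### Learned policies and the decomposition of the estimation error -/

section Learning

variable {𝒳 : Type*} [MeasurableSpace 𝒳]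

/-- A sequence of policies, the `t`-th one learned from the first `t` batches, whose increments
decrease polynomially fast. -/
structure PolicyProcess (Q : Measure (Obs 𝒳)) [IsProbabilityMeasure Q] (B : ℕ)
    (π : (ℕ → Obs 𝒳) → ℕ → 𝒳 → ℝ) (δ K : ℝ) : Prop where
  delta_pos : 0 < δ
  delta_le_one : δ ≤ 1
  const_nonneg : 0 ≤ K
  mem_Icc : ∀ s t x, π s t x ∈ Set.Icc (0 : ℝ) 1
  measurable : ∀ t, Measurable fun p : (ℕ → Obs 𝒳) × 𝒳 => π p.1 t p.2
  dependsOn : ∀ t, DependsOn (fun s => π s t) (Set.Iio (t * B))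
  stable : ∀ t, 1 ≤ t → ∀ᵐ s ∂seqLaw Q,
    covNorm Q (fun x => π s t x - π s (t - 1) x) ≤ K * (t : ℝ) ^ (-(1 + δ))

/-- The difference between the policy learned from `m` batches and the baseline policy. -/
def gap (π : ℕ → 𝒳 → ℝ) (m : ℕ) (x : 𝒳) : ℝ := π m x - π 0 x

/-- The difference between the weighted sum of the policy increments with weights `1 / (T - t)`
and the one with weights `1 / T`. -/
noncomputable def excess (π : ℕ → 𝒳 → ℝ) (T m : ℕ) (x : 𝒳) : ℝ :=
  ∑ t ∈ Finset.Icc 1 m, (π t x - π (t - 1) x) * (1 / ((T : ℝ) - t) - 1 / T)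

theorem weight_nonneg {T t : ℕ} (h : t < T) : 0 ≤ 1 / ((T : ℝ) - t) - 1 / T := by
  have h1 : (0 : ℝ) < (T : ℝ) - t := sub_pos.2 (by exact_mod_cast h)
  exact sub_nonneg.2 (one_div_le_one_div_of_le h1
    (by linarith [(Nat.cast_nonneg t : (0 : ℝ) ≤ t)]))

omit [MeasurableSpace 𝒳] in
theorem gap_eq_sum (π : ℕ → 𝒳 → ℝ) (m : ℕ) (x : 𝒳) :
    gap π m x = ∑ t ∈ Finset.Icc 1 m, (π t x - π (t - 1) x) :=
  (sum_increments (fun t => π t x) m).symm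

-- With the constant weight `1 / T` the increments telescope to the policy gap, which isolates the
-- main term.
omit [MeasurableSpace 𝒳] in
theorem sum_weighted_increments (π : ℕ → 𝒳 → ℝ) (T m : ℕ) (x : 𝒳) :
    ∑ t ∈ Finset.Icc 1 m, (π t x - π (t - 1) x) / ((T : ℝ) - t) =
      1 / (T : ℝ) * gap π m x + excess π T m x := by
  rw [gap_eq_sum, excess, Finset.mul_sum, ← Finset.sum_add_distrib]
  refine Finset.sum_congr rfl fun t _ => ?_
  ring

namespace PolicyProcess

variable {Q : Measure (Obs 𝒳)} [IsProbabilityMeasure Q] {B : ℕ}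
  {π : (ℕ → Obs 𝒳) → ℕ → 𝒳 → ℝ} {δ K : ℝ} (hπ : PolicyProcess Q B π δ K)

include hπ

theorem measurable_apply (s : ℕ → Obs 𝒳) (t : ℕ) : Measurable (π s t) :=
  (hπ.measurable t).comp measurable_prodMk_left

theorem abs_sub_le (s : ℕ → Obs 𝒳) (t u : ℕ) (x : 𝒳) : |π s t x - π s u x| ≤ 1 := by
  have h1 := hπ.mem_Icc s t x
  have h2 := hπ.mem_Icc s u x
  rw [abs_le]
  constructor <;> linarith [h1.1, h1.2, h2.1, h2.2]

theorem abs_gap_le (s : ℕ → Obs 𝒳) (m : ℕ) (x : 𝒳) : |gap (π s) m x| ≤ 1 :=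
  hπ.abs_sub_le s m 0 x

theorem measurable_gap (m : ℕ) : Measurable fun p : (ℕ → Obs 𝒳) × 𝒳 => gap (π p.1) m p.2 :=
  (hπ.measurable m).sub (hπ.measurable 0)

theorem dependsOn_le {m n : ℕ} (hmn : m ≤ n) :
    DependsOn (fun s => π s m) (Set.Iio (n * B)) :=
  (hπ.dependsOn m).mono (Set.Iio_subset_Iio (Nat.mul_le_mul_right B hmn))

theorem dependsOn_gap (m : ℕ) : DependsOn (fun s => gap (π s) m) (Set.Iio (m * B)) := by
  intro s s' h
  have h1 : π s m = π s' m := hπ.dependsOn m h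
  have h2 : π s 0 = π s' 0 := hπ.dependsOn_le (Nat.zero_le m) h
  funext x
  simp only [gap, h1, h2]

theorem measurable_excess (T m : ℕ) :
    Measurable fun p : (ℕ → Obs 𝒳) × 𝒳 => excess (π p.1) T m p.2 :=
  Finset.measurable_fun_sum _ fun t _ =>
    ((hπ.measurable t).sub (hπ.measurable (t - 1))).mul_const _

theorem dependsOn_excess (T m : ℕ) :
    DependsOn (fun s => excess (π s) T m) (Set.Iio (m * B)) := by
  intro s s' h
  funext x
  refine Finset.sum_congr rfl fun t ht => ?_
  have ht := Finset.mem_Icc.1 ht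
  have h1 : π s t = π s' t := hπ.dependsOn_le ht.2 h
  have h2 : π s (t - 1) = π s' (t - 1) := hπ.dependsOn_le ((Nat.sub_le t 1).trans ht.2) h
  rw [h1, h2]

/-- The weights increase with `t`, so `abs_sum_increment_mul_le` bounds the sum by its last weight.
Stabilization plays no role here. -/
theorem abs_excess_le {T m : ℕ} (hm : m < T) (s : ℕ → Obs 𝒳) (x : 𝒳) :
    |excess (π s) T m x| ≤ 1 / ((T : ℝ) - m) := by
  have h := abs_sum_increment_mul_le (a := fun t : ℕ => 1 / ((T : ℝ) - t) - 1 / T)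
    (p := fun t => π s t x) (by simp) (fun t => hπ.mem_Icc s t x) m fun t ht => by
      have h1 : (0 : ℝ) < (T : ℝ) - (t + 1 : ℕ) :=
        sub_pos.2 (by exact_mod_cast (by omega : t + 1 < T))
      have h2 : (T : ℝ) - (t + 1 : ℕ) ≤ (T : ℝ) - t := by push_cast; linarith
      exact sub_le_sub_right (one_div_le_one_div_of_le h1 h2) _
  refine h.trans ?_
  have : (0 : ℝ) ≤ 1 / T := by positivity
  linarith

theorem ae_stable : ∀ᵐ s ∂seqLaw Q, ∀ t, 1 ≤ t →
    covNorm Q (fun x => π s t x - π s (t - 1) x) ≤ K * (t : ℝ) ^ (-(1 + δ)) := by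
  rw [ae_all_iff]
  intro t
  by_cases ht : 1 ≤ t
  · exact (hπ.stable t ht).mono fun s hs _ => hs
  · exact ae_of_all _ fun s h => absurd h ht

theorem ae_covNorm_excess_le : ∀ᵐ s ∂seqLaw Q, ∀ T m : ℕ, m < T →
    covNorm Q (excess (π s) T m) ≤ ∑ t ∈ Finset.Icc 1 (T - 1),
        K * (t : ℝ) ^ (-(1 + δ)) * (1 / ((T : ℝ) - t) - 1 / T) := by
  filter_upwards [hπ.ae_stable] with s hs T m hm
  have hlt : ∀ t ∈ Finset.Icc 1 (T - 1), t < T := fun t ht => by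
    have := Finset.mem_Icc.1 ht; omega
  have hsub : Finset.Icc 1 m ⊆ Finset.Icc 1 (T - 1) := Finset.Icc_subset_Icc le_rfl (by omega)
  have h1 := covNorm_sum_le (Q := Q) (Finset.Icc 1 m) (b := 1)
    (F := fun t x => π s t x - π s (t - 1) x) (fun t => 1 / ((T : ℝ) - t) - 1 / T)
    (fun t ht => weight_nonneg (hlt t (hsub ht)))
    (fun t _ => (hπ.measurable_apply s t).sub (hπ.measurable_apply s (t - 1)))
    (fun t _ x => hπ.abs_sub_le s t (t - 1) x)
  refine h1.trans (le_trans (Finset.sum_le_sum fun t ht => ?_)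
    (Finset.sum_le_sum_of_subset_of_nonneg hsub fun t ht _ => ?_))
  · exact mul_le_mul_of_nonneg_right (hs t (Finset.mem_Icc.1 ht).1)
      (weight_nonneg (hlt t (hsub ht)))
  · exact mul_nonneg (mul_nonneg hπ.const_nonneg (by positivity)) (weight_nonneg (hlt t ht))

/-- Product of the supremum bound and the `L¹` bound. Summed over `m` and multiplied by `T`, it
becomes up to a constant the quantity of `tendsto_weight_discrepancy`. -/
theorem ae_scoreVar_excess_le {ψ : Obs 𝒳 → ℝ} {C σ : ℝ} (h : RegularScore Q ψ C σ) :
    ∀ᵐ s ∂seqLaw Q, ∀ T m : ℕ, m < T →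
      scoreVar Q ψ (excess (π s) T m) ≤ 1 / ((T : ℝ) - m) *
        (C * ∑ t ∈ Finset.Icc 1 (T - 1),
          K * (t : ℝ) ^ (-(1 + δ)) * (1 / ((T : ℝ) - t) - 1 / T)) := by
  filter_upwards [hπ.ae_covNorm_excess_le] with s hs T m hm
  have hT : (0 : ℝ) < (T : ℝ) - m := sub_pos.2 (by exact_mod_cast hm)
  refine (h.scoreVar_le ((hπ.measurable_excess T m).comp measurable_prodMk_left)
    (hπ.abs_excess_le hm s)).trans ?_
  exact mul_le_mul_of_nonneg_left (mul_le_mul_of_nonneg_left (hs T m hm) h.const_nonneg)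
    (by positivity)

variable {e : 𝒳 → ℝ} {C σ : ℝ} (h : RegularScore Q (ipwScore e) C σ)

include h

theorem scoreMean_gap (s : ℕ → Obs 𝒳) (m : ℕ) : scoreMean Q (ipwScore e) (gap (π s) m) =
    ∑ t ∈ Finset.Icc 1 m, scoreMean Q (ipwScore e) (fun x => π s t x - π s (t - 1) x) := by
  have := h.scoreMean_sum (Finset.Icc 1 m) (b := 1) (F := fun t x => π s t x - π s (t - 1) x)
    (fun _ => 1) (fun t _ => (hπ.measurable_apply s t).sub (hπ.measurable_apply s (t - 1)))
    (fun t _ x => hπ.abs_sub_le s t (t - 1) x)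
  simp only [mul_one] at this
  rw [← this]
  congr 1
  funext x
  exact gap_eq_sum _ _ _

theorem scoreMean_excess (s : ℕ → Obs 𝒳) (T m : ℕ) :
    scoreMean Q (ipwScore e) (excess (π s) T m) = ∑ t ∈ Finset.Icc 1 m,
      scoreMean Q (ipwScore e) (fun x => π s t x - π s (t - 1) x) *
        (1 / ((T : ℝ) - t) - 1 / T) :=
  h.scoreMean_sum (Finset.Icc 1 m) (b := 1) (F := fun t x => π s t x - π s (t - 1) x)
    _ (fun t _ => (hπ.measurable_apply s t).sub (hπ.measurable_apply s (t - 1)))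
    (fun t _ x => hπ.abs_sub_le s t (t - 1) x)

/-- The estimation error as a sum of martingale differences and a small bias. -/
theorem crammedEstimator_sub_eq (hB : 0 < B) (s : ℕ → Obs 𝒳) {T : ℕ} (hT : 0 < T) :
    crammedEstimator e B s (π s) T - scoreMean Q (ipwScore e) (gap (π s) T) =
      1 / ((B : ℝ) * T) * ∑ i ∈ Finset.range (T * B),
          centered Q (ipwScore e) (gap (π s) (i / B)) (s i) +
        1 / (B : ℝ) * ∑ i ∈ Finset.range (T * B),
          centered Q (ipwScore e) (excess (π s) T (i / B)) (s i) -
        scoreMean Q (ipwScore e) (fun x => π s T x - π s (T - 1) x) := by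
  have hB0 : (B : ℝ) ≠ 0 := by exact_mod_cast hB.ne'
  have hT0 : (T : ℝ) ≠ 0 := by exact_mod_cast hT.ne'
  set ν : ℕ → ℝ := fun t => scoreMean Q (ipwScore e) (fun x => π s t x - π s (t - 1) x) with hν
  have e1 : crammedEstimator e B s (π s) T = 1 / (B : ℝ) * ∑ i ∈ Finset.range (T * B),
      ∑ t ∈ Finset.Icc 1 (i / B),
        ipwScore e (s i) * (π s t (s i).1 - π s (t - 1) (s i).1) / ((T : ℝ) - t) := by
    rw [← sum_swap_batches hB T fun t i =>
      ipwScore e (s i) * (π s t (s i).1 - π s (t - 1) (s i).1) / ((T : ℝ) - t),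
      crammedEstimator, Finset.mul_sum]
    refine Finset.sum_congr rfl fun t ht => ?_
    have ht := Finset.mem_Icc.1 ht
    rw [stepEstimator]
    simp only [gammaHat]
    rw [← Finset.mul_sum, sum_batches B (by omega : t ≤ T), ← Finset.sum_div]
    ring
  -- Increment `t` is counted on `(T - t) * B` observations, which cancels its weight `1 / (T - t)`;
  -- hence the centering constants add up to the target without its last term.
  have e2 : ∑ t ∈ Finset.Icc 1 (T - 1), ν t = 1 / (B : ℝ) * ∑ i ∈ Finset.range (T * B),
      ∑ t ∈ Finset.Icc 1 (i / B), ν t / ((T : ℝ) - t) := by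
    rw [← sum_swap_batches hB T fun t _ => ν t / ((T : ℝ) - t), Finset.mul_sum]
    refine Finset.sum_congr rfl fun t ht => ?_
    have ht := Finset.mem_Icc.1 ht
    have htT : t < T := by omega
    have h1 : (T : ℝ) - t ≠ 0 := (sub_pos.2 (by exact_mod_cast htT)).ne'
    rw [Finset.sum_const, Nat.card_Ico, ← Nat.sub_mul, nsmul_eq_mul, Nat.cast_mul,
      Nat.cast_sub htT.le]
    field_simp
  -- The increment of step `T` belongs to the target, but no batch remains to estimate it; it is the
  -- bias term.
  have e3 : scoreMean Q (ipwScore e) (gap (π s) T) = ∑ t ∈ Finset.Icc 1 (T - 1), ν t + ν T := by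
    rw [hπ.scoreMean_gap h]
    obtain ⟨n, rfl⟩ : ∃ n, T = n + 1 := ⟨T - 1, by omega⟩
    rw [Finset.sum_Icc_succ_top (by omega)]
    rfl
  rw [e1, e3, e2, ← sub_sub, ← mul_sub, ← Finset.sum_sub_distrib]
  congr 1
  rw [show 1 / ((B : ℝ) * T) = 1 / (B : ℝ) * (1 / T) by field_simp, mul_assoc, ← mul_add]
  congr 1
  rw [Finset.mul_sum, ← Finset.sum_add_distrib]
  refine Finset.sum_congr rfl fun i _ => ?_
  rw [centered, centered, hπ.scoreMean_gap h, hπ.scoreMean_excess h]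
  have e4 : ∑ t ∈ Finset.Icc 1 (i / B),
      ipwScore e (s i) * (π s t (s i).1 - π s (t - 1) (s i).1) / ((T : ℝ) - t) =
      ipwScore e (s i) * (1 / (T : ℝ) * gap (π s) (i / B) (s i).1 +
        excess (π s) T (i / B) (s i).1) := by
    rw [← sum_weighted_increments, Finset.mul_sum]
    exact Finset.sum_congr rfl fun t _ => mul_div_assoc _ _ _
  have e5 : ∑ t ∈ Finset.Icc 1 (i / B), ν t / ((T : ℝ) - t) =
      1 / (T : ℝ) * ∑ t ∈ Finset.Icc 1 (i / B), ν t +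
        ∑ t ∈ Finset.Icc 1 (i / B), ν t * (1 / ((T : ℝ) - t) - 1 / T) := by
    rw [Finset.mul_sum, ← Finset.sum_add_distrib]
    exact Finset.sum_congr rfl fun t _ => by ring
  rw [e4, e5]
  ring

end PolicyProcess

-- For `j = m + 1` the weight involves policies up to `m` only, and the sample starts at observation
-- `m * B`. The weight is thus known before the sample is drawn, which is what the martingale bounds
-- require.
omit [MeasurableSpace 𝒳] in
theorem sampleVar_eq_smpVar (e : 𝒳 → ℝ) (B : ℕ) (s : ℕ → Obs 𝒳) (π : ℕ → 𝒳 → ℝ)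
    {T m : ℕ} (hm : m < T) :
    sampleVar e B s π T (m + 1) = smpVar (Finset.Ico (m * B) (T * B)) fun i =>
      1 / (T : ℝ) * (ipwScore e (s i) * gap π m (s i).1) +
        ipwScore e (s i) * excess π T m (s i).1 := by
  have hcard : ((Finset.Ico (m * B) (T * B)).card : ℝ) = (B : ℝ) * ((T : ℝ) - (m + 1 : ℕ) + 1) := by
    rw [Nat.card_Ico, ← Nat.sub_mul, Nat.cast_mul, Nat.cast_sub hm.le]
    push_cast
    ring
  have hg : ∀ i, gHat e π T (m + 1) (s i) = 1 / (T : ℝ) * (ipwScore e (s i) * gap π m (s i).1) +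
        ipwScore e (s i) * excess π T m (s i).1 := fun i => by
    rw [gHat, Nat.add_sub_cancel, sum_weighted_increments]
    ring
  have hmain : 1 / ((B : ℝ) * ((T : ℝ) - (m + 1 : ℕ) + 1) - 1) *
      ∑ k ∈ Finset.Icc (m + 1) T, ∑ i ∈ batch B k,
        (gHat e π T (m + 1) (s i) - gBar e B s π T (m + 1)) ^ 2 =
      smpVar (Finset.Ico (m * B) (T * B)) fun i =>
      1 / (T : ℝ) * (ipwScore e (s i) * gap π m (s i).1) +
        ipwScore e (s i) * excess π T m (s i).1 := by
    rw [smpVar, sum_batches B hm.le, hcard, gBar, sum_batches B hm.le]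
    simp only [hg]
  rw [sampleVar]
  split_ifs with hc
  -- For `B = 1` and `j = T` the divisor `B (T - j + 1) - 1` is zero, so the convention for this
  -- summand agrees with division by zero.
  · rw [← hmain, hc.1, ← hc.2]
    simp
  · exact hmain

theorem smpVar_const_mul (I : Finset ℕ) (c : ℝ) (x : ℕ → ℝ) :
    smpVar I (fun i => c * x i) = c ^ 2 * smpVar I x := by
  unfold smpVar
  rw [← Finset.mul_sum, mul_left_comm (c ^ 2), Finset.mul_sum _ _ (c ^ 2)]
  congr 1
  refine Finset.sum_congr rfl fun i _ => ?_
  ring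

omit [MeasurableSpace 𝒳] in
theorem varEstimator_eq (e : 𝒳 → ℝ) (B : ℕ) (s : ℕ → Obs 𝒳) (π : ℕ → 𝒳 → ℝ) (T : ℕ) :
    varEstimator e B s π T =
      (T : ℝ) / B * ∑ m ∈ Finset.Ico 1 T, sampleVar e B s π T (m + 1) := by
  rw [varEstimator]
  congr 1
  rw [Finset.sum_Ico_add' (fun j => sampleVar e B s π T j) 1 T 1]
  rfl

end Learning


/-! ### Normal approximation through standardized scores -/

section Normal

variable {𝒳 : Type*} [MeasurableSpace 𝒳]

/-- The policy gap, replaced by `1` during the first batches. -/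
noncomputable def regGap (π : ℕ → 𝒳 → ℝ) (R m : ℕ) (x : 𝒳) : ℝ :=
  if m < R then 1 else gap π m x

theorem abs_sqrt_sub_sqrt_le {κ a b : ℝ} (hκ : 0 < κ) (ha : κ ≤ a) (hb : κ ≤ b) :
    |√a - √b| ≤ (√κ)⁻¹ * |a - b| := by
  have h1 : 0 < √κ := Real.sqrt_pos.2 hκ
  have h2 : √κ ≤ √a := Real.sqrt_le_sqrt ha
  have h3 : 0 ≤ √b := Real.sqrt_nonneg b
  have e : a - b = (√a - √b) * (√a + √b) := by
    have e1 := Real.sq_sqrt (hκ.le.trans ha)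
    have e2 := Real.sq_sqrt (hκ.le.trans hb)
    linear_combination -e1 + e2
  rw [e, abs_mul, inv_mul_eq_div, le_div_iff₀ h1]
  refine mul_le_mul_of_nonneg_left ?_ (abs_nonneg _)
  exact (h2.trans (by linarith)).trans (le_abs_self _)

namespace PolicyProcess

variable {Q : Measure (Obs 𝒳)} [IsProbabilityMeasure Q] {B : ℕ}
  {π : (ℕ → Obs 𝒳) → ℕ → 𝒳 → ℝ} {δ K : ℝ} (hπ : PolicyProcess Q B π δ K)

include hπ

theorem abs_regGap_le (s : ℕ → Obs 𝒳) (R m : ℕ) (x : 𝒳) : |regGap (π s) R m x| ≤ 1 := by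
  unfold regGap
  split_ifs
  · simp
  · exact hπ.abs_gap_le s m x

theorem measurable_regGap (R m : ℕ) :
    Measurable fun p : (ℕ → Obs 𝒳) × 𝒳 => regGap (π p.1) R m p.2 := by
  unfold regGap
  split_ifs
  · exact measurable_const
  · exact hπ.measurable_gap m

theorem dependsOn_regGap (R m : ℕ) :
    DependsOn (fun s => regGap (π s) R m) (Set.Iio (m * B)) := by
  intro s s' h
  have h1 : gap (π s) m = gap (π s') m := hπ.dependsOn_gap m h
  funext x
  simp only [regGap, h1]

variable {ψ : Obs 𝒳 → ℝ} {C σ : ℝ} (h : RegularScore Q ψ C σ) {R : ℕ} {d : ℝ} (hd : 0 < d)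
  (hsep : ∀ t, R ≤ t → ∀ᵐ s ∂seqLaw Q, d ≤ covNorm Q (gap (π s) t))

include h hd hsep

/-- During the first `R` batches the policy may coincide with the baseline, so that a conditional
variance could vanish and standardization fail. The weight `1` used there makes the lower bound
uniform in `m`, and alters only finitely many summands. -/
theorem exists_scoreVar_regGap_ge :
    ∃ κ : ℝ, 0 < κ ∧ ∀ᵐ s ∂seqLaw Q, ∀ m, κ ≤ scoreVar Q ψ (regGap (π s) R m) := by
  refine ⟨σ * min d 1 ^ 2, mul_pos h.pos (by positivity), ?_⟩
  rw [ae_all_iff]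
  intro m
  have key : ∀ s, min d 1 ≤ covNorm Q (regGap (π s) R m) →
      σ * min d 1 ^ 2 ≤ scoreVar Q ψ (regGap (π s) R m) := fun s hs => by
    refine le_trans ?_ (h.scoreVar_ge ((hπ.measurable_regGap R m).comp measurable_prodMk_left)
      (hπ.abs_regGap_le s R m))
    have := h.pos
    gcongr
  by_cases hm : m < R
  · refine ae_of_all _ fun s => key s ?_
    simp [covNorm, regGap, hm]
  · filter_upwards [hsep m (not_lt.1 hm)] with s hs
    refine key s ((min_le_left _ _).trans ?_)
    have : regGap (π s) R m = gap (π s) m := by funext x; simp [regGap, hm]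
    rwa [this]

/-- The square root is Lipschitz away from zero and the variance is Lipschitz in the weight, so the
summable rate of the policy increments is inherited. -/
theorem exists_sqrt_scoreVar_increment_le :
    ∃ ε : ℕ → ℝ, Summable ε ∧ (∀ m, 0 ≤ ε m) ∧ ∀ᵐ s ∂seqLaw Q, ∀ m,
      |√(scoreVar Q ψ (regGap (π s) R (m + 1))) - √(scoreVar Q ψ (regGap (π s) R m))| ≤ ε m := by
  obtain ⟨κ, hκ, hlow⟩ := hπ.exists_scoreVar_regGap_ge h hd hsep
  have hC := h.const_nonneg
  set c := (√κ)⁻¹ * (2 * C + 2 * (1 + C) ^ 2) with hc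
  have hc0 : 0 ≤ c := by positivity
  -- The trivial distance bound `2` is used for `m < R`, and in particular at `m = R - 1`, where the
  -- regularized weight jumps from `1` to the policy gap.
  refine ⟨fun m => c * (K * ((m : ℝ) + 1) ^ (-(1 + δ)) + if m < R then 2 else 0), ?_, ?_, ?_⟩
  · refine Summable.mul_left _ (Summable.add (Summable.mul_left _ ?_) ?_)
    · have := (summable_nat_add_iff 1).2
        (Real.summable_nat_rpow (p := -(1 + δ)) |>.2 (by linarith [hπ.delta_pos]))
      simpa using this
    · refine summable_of_ne_finset_zero (s := Finset.range R) fun m hm => ?_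
      rw [Finset.mem_range] at hm
      simp [hm]
  · intro m
    have := hπ.const_nonneg
    refine mul_nonneg hc0 (add_nonneg (by positivity) ?_)
    split_ifs <;> norm_num
  · filter_upwards [hlow, hπ.ae_stable] with s hs hst m
    have hm1 : Measurable (regGap (π s) R m) :=
      (hπ.measurable_regGap R m).comp measurable_prodMk_left
    have hm2 : Measurable (regGap (π s) R (m + 1)) :=
      (hπ.measurable_regGap R (m + 1)).comp measurable_prodMk_left
    refine (abs_sqrt_sub_sqrt_le hκ (hs _) (hs _)).trans ?_
    rw [hc, mul_assoc]
    refine mul_le_mul_of_nonneg_left ?_ (by positivity)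
    refine (h.abs_scoreVar_sub_le hm2 (hπ.abs_regGap_le s R _) hm1
      (hπ.abs_regGap_le s R _)).trans ?_
    refine mul_le_mul_of_nonneg_left ?_ (by positivity)
    have hKm : 0 ≤ K * ((m : ℝ) + 1) ^ (-(1 + δ)) := mul_nonneg hπ.const_nonneg (by positivity)
    by_cases hm : m < R
    · rw [if_pos hm]
      refine (covNorm_le (b := 2) (hm2.sub hm1) fun x => ?_).trans (by linarith)
      exact (abs_sub _ _).trans
        (by linarith [hπ.abs_regGap_le s R m x, hπ.abs_regGap_le s R (m + 1) x])
    · rw [if_neg hm, add_zero]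
      have e : (fun x => regGap (π s) R (m + 1) x - regGap (π s) R m x) =
          fun x => π s (m + 1) x - π s (m + 1 - 1) x := by
        funext x
        have hm' : ¬ m + 1 < R := by omega
        simp [regGap, hm, hm', gap]
      have := hst (m + 1) (by omega)
      rw [← e] at this
      push_cast at this
      exact this

/-- The standardized score of observation `i`. -/
noncomputable def _root_.Cram.stdScore (Q : Measure (Obs 𝒳)) (ψ : Obs 𝒳 → ℝ) (B R : ℕ)
    (π : (ℕ → Obs 𝒳) → ℕ → 𝒳 → ℝ) (i : ℕ) (s : ℕ → Obs 𝒳) (o : Obs 𝒳) : ℝ :=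
  centered Q ψ (regGap (π s) R (i / B)) o / √(scoreVar Q ψ (regGap (π s) R (i / B)))

omit hd hsep in
theorem measurable_stdScore (R i : ℕ) :
    Measurable fun p : (ℕ → Obs 𝒳) × Obs 𝒳 => stdScore Q ψ B R π i p.1 p.2 := by
  have h1 := measurable_centered (Q := Q) (F := fun s => regGap (π s) R (i / B)) h.measurable
    (hπ.measurable_regGap R (i / B))
  have h2 := (measurable_scoreVar (Q := Q) (F := fun s => regGap (π s) R (i / B)) h.measurable
    (hπ.measurable_regGap R (i / B))).sqrt.comp
    (measurable_fst : Measurable fun p : (ℕ → Obs 𝒳) × Obs 𝒳 => p.1)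
  exact h1.div h2

omit h hd hsep in
theorem dependsOn_stdScore (R i : ℕ) : DependsOn (stdScore Q ψ B R π i) (Set.Iio i) :=
  ((hπ.dependsOn_regGap R (i / B)).mono
    (Set.Iio_subset_Iio (Nat.div_mul_le_self i B))).postcomp
    fun f o => centered Q ψ f o / √(scoreVar Q ψ f)

theorem ae_stdScore_moments : ∃ M : ℝ, ∀ i : ℕ, ∀ᵐ s ∂seqLaw Q,
    ∫ o, stdScore Q ψ B R π i s o ∂Q = 0 ∧ ∫ o, stdScore Q ψ B R π i s o ^ 2 ∂Q = 1 ∧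
      MemLp (stdScore Q ψ B R π i s) 3 Q ∧ ∫ o, |stdScore Q ψ B R π i s o| ^ 3 ∂Q ≤ M := by
  obtain ⟨κ, hκ, hlow⟩ := hπ.exists_scoreVar_regGap_ge h hd hsep
  obtain ⟨M, hM, hmom⟩ := h.exists_moment_bounds
  refine ⟨M / √κ ^ 3, fun i => ?_⟩
  filter_upwards [hlow] with s hs
  have hm : Measurable (regGap (π s) R (i / B)) :=
    (hπ.measurable_regGap R (i / B)).comp measurable_prodMk_left
  have hb := hπ.abs_regGap_le s R (i / B)
  have hV : 0 < scoreVar Q ψ (regGap (π s) R (i / B)) := hκ.trans_le (hs _)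
  have hL : MemLp (centered Q ψ (regGap (π s) R (i / B))) 3 Q :=
    (h.memLp_centered hm hb).mono_exponent (by norm_num)
  unfold stdScore
  refine ⟨?_, ?_, ?_, ?_⟩
  · rw [integral_div, h.integral_centered hm hb, zero_div]
  · simp_rw [div_pow]
    rw [integral_div, Real.sq_sqrt hV.le]
    exact div_self hV.ne'
  · simpa only [div_eq_inv_mul] using hL.const_mul _
  · simp_rw [abs_div, div_pow]
    rw [integral_div, abs_of_nonneg (Real.sqrt_nonneg _)]
    exact div_le_div₀ hM (hmom _ hm hb).2.1 (by positivity)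
      (pow_le_pow_left₀ (by positivity) (Real.sqrt_le_sqrt (hs _)) 3)

theorem sq_sum_stdScore_le (I : Finset ℕ) :
    MemLp (fun s => ∑ i ∈ I, stdScore Q ψ B R π i s (s i)) 2 (seqLaw Q) ∧
      ∫ s, (∑ i ∈ I, stdScore Q ψ B R π i s (s i)) ^ 2 ∂seqLaw Q ≤ I.card := by
  obtain ⟨M, hmom⟩ := hπ.ae_stdScore_moments h hd hsep
  obtain ⟨h1, h2⟩ := sq_sum_martingale_le (Q := Q) I (H := stdScore Q ψ B R π) (c := fun _ => 1)
    (fun i _ => hπ.measurable_stdScore h R i) (fun i _ => hπ.dependsOn_stdScore R i)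
    (fun i _ => (hmom i).mono fun s hs => hs.1)
    (fun i _ => (hmom i).mono fun s hs =>
      (hs.2.2.1.mono_exponent (by norm_num : (2 : ENNReal) ≤ 3)).integrable_sq)
    (fun i _ => (hmom i).mono fun s hs => hs.2.1.le)
  exact ⟨h1, by simpa using h2⟩

theorem tendstoInDistribution_stdScore (hB : 0 < B) :
    TendstoInDistribution (fun (T : ℕ) s => (√((T * B : ℕ) : ℝ))⁻¹ *
        ∑ i ∈ Finset.range (T * B), stdScore Q ψ B R π i s (s i))
      atTop (id : ℝ → ℝ) (fun _ => seqLaw Q) (gaussianReal 0 1) := by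
  obtain ⟨M, hmom⟩ := hπ.ae_stdScore_moments h hd hsep
  have hclt := tendstoInDistribution_martingale (Q := Q) (H := stdScore Q ψ B R π) (M := M)
    (fun i => hπ.measurable_stdScore h R i) (fun i => hπ.dependsOn_stdScore R i)
    (fun i => (hmom i).mono fun s hs => hs.1) (fun i => (hmom i).mono fun s hs => hs.2.1)
    (fun i => (hmom i).mono fun s hs => hs.2.2.1) (fun i => (hmom i).mono fun s hs => hs.2.2.2)
  have hlim : Tendsto (fun T : ℕ => T * B) atTop atTop :=
    tendsto_id.atTop_mul_const' hB
  exact ⟨fun T => hclt.forall_aemeasurable (T * B), hclt.aemeasurable_limit,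
    hclt.tendsto.comp hlim⟩

omit h hd hsep in
/-- The contribution of the unequal weights is negligible. -/
theorem smallInProb_excess (h : RegularScore Q ψ C σ) :
    SmallInProb (seqLaw Q) fun (T : ℕ) s => √(T : ℝ) * (1 / (B : ℝ) *
      ∑ i ∈ Finset.range (T * B), centered Q ψ (excess (π s) T (i / B)) (s i)) := by
  set ρ : ℕ → ℝ := fun T => ∑ t ∈ Finset.Icc 1 (T - 1),
    K * (t : ℝ) ^ (-(1 + δ)) * (1 / ((T : ℝ) - t) - 1 / T) with hρ
  have hb : Tendsto (fun T : ℕ => C / B * (T * ρ T * ∑ m ∈ Finset.range T, 1 / ((T : ℝ) - m)))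
      atTop (𝓝 0) := by
    have := (tendsto_weight_discrepancy hπ.delta_pos hπ.delta_le_one hπ.const_nonneg).const_mul
      (C / (B : ℝ))
    rw [mul_zero] at this
    exact this
  have hkey : ∀ T : ℕ, MemLp (fun s => ∑ i ∈ Finset.range (T * B),
        centered Q ψ (excess (π s) T (i / B)) (s i)) 2 (seqLaw Q) ∧
      ∫ s, (∑ i ∈ Finset.range (T * B), centered Q ψ (excess (π s) T (i / B)) (s i)) ^ 2 ∂seqLaw Q ≤
        ∑ i ∈ Finset.range (T * B), 1 / ((T : ℝ) - (i / B : ℕ)) * (C * ρ T) := by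
    intro T
    have hlt : ∀ i ∈ Finset.range (T * B), i / B < T := fun i hi =>
      Nat.div_lt_of_lt_mul (by rw [mul_comm]; exact Finset.mem_range.1 hi)
    have hm : ∀ i s, Measurable (excess (π s) T (i / B)) := fun i s =>
      (hπ.measurable_excess T (i / B)).comp measurable_prodMk_left
    exact sq_sum_martingale_le (Q := Q) _
      (H := fun i s o => centered Q ψ (excess (π s) T (i / B)) o)
      (fun i _ => measurable_centered (F := fun s => excess (π s) T (i / B)) h.measurable
        (hπ.measurable_excess T (i / B)))
      (fun i _ => ((hπ.dependsOn_excess T (i / B)).mono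
        (Set.Iio_subset_Iio (Nat.div_mul_le_self i B))).postcomp fun f o => centered Q ψ f o)
      (fun i hi => ae_of_all _ fun s => h.integral_centered (hm i s)
        (hπ.abs_excess_le (hlt i hi) s))
      (fun i hi => ae_of_all _ fun s => ((h.memLp_centered (hm i s)
        (hπ.abs_excess_le (hlt i hi) s)).mono_exponent
          (by norm_num : (2 : ENNReal) ≤ 4)).integrable_sq)
      (fun i hi => (hπ.ae_scoreVar_excess_le h).mono fun s hs => hs T _ (hlt i hi))
  refine smallInProb_of_integral_sq hb
    (Eventually.of_forall fun T => ((hkey T).1.const_mul _).const_mul _)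
    (Eventually.of_forall fun T => ?_)
  simp_rw [mul_pow]
  rw [integral_const_mul, integral_const_mul, Real.sq_sqrt (Nat.cast_nonneg T)]
  refine (mul_le_mul_of_nonneg_left (mul_le_mul_of_nonneg_left (hkey T).2 (by positivity))
    (by positivity)).trans_eq ?_
  rw [← Finset.sum_mul, sum_range_div_batch B T fun m => 1 / ((T : ℝ) - m)]
  rcases Nat.eq_zero_or_pos B with rfl | hB
  · simp
  · have : (B : ℝ) ≠ 0 := by exact_mod_cast hB.ne'
    field_simp

omit hd hsep in
/-- The contribution of the last policy update is negligible. -/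
theorem smallInProb_last_update :
    SmallInProb (seqLaw Q) fun (T : ℕ) s =>
      √(T : ℝ) * scoreMean Q ψ (fun x => π s T x - π s (T - 1) x) := by
  have hlim : Tendsto (fun T : ℕ => (1 + C) * K * (T : ℝ) ^ (-(1 / 2 + δ))) atTop (𝓝 0) := by
    have := (tendsto_rpow_neg_atTop (y := 1 / 2 + δ) (by linarith [hπ.delta_pos])).comp
      tendsto_natCast_atTop_atTop
    simpa [Function.comp_def] using this.const_mul ((1 + C) * K)
  refine smallInProb_of_bound hlim ?_
  filter_upwards [eventually_ge_atTop 1] with T hT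
  filter_upwards [hπ.ae_stable] with s hs
  have hT0 : (0 : ℝ) < T := by exact_mod_cast hT
  have hC := h.const_nonneg
  have h1 := h.abs_scoreMean_le (f := fun x => π s T x - π s (T - 1) x)
    ((hπ.measurable_apply s T).sub (hπ.measurable_apply s (T - 1)))
    (fun x => hπ.abs_sub_le s T (T - 1) x)
  rw [abs_mul, abs_of_nonneg (Real.sqrt_nonneg _)]
  calc _ ≤ √(T : ℝ) * ((1 + C) * (K * (T : ℝ) ^ (-(1 + δ)))) := by
        gcongr
        exact h1.trans (mul_le_mul_of_nonneg_left (hs T hT) (by linarith))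
    _ = (1 + C) * K * ((T : ℝ) ^ (1 / 2 : ℝ) * (T : ℝ) ^ (-(1 + δ))) := by
        rw [Real.sqrt_eq_rpow]; ring
    _ = _ := by
        rw [← Real.rpow_add hT0]
        congr 2
        ring

/-- Normalized sums of partial sums against summable increments are negligible. -/
theorem smallInProb_by_parts {ε : ℕ → ℝ} (hB : 0 < B) (hε : Summable ε) (hε0 : ∀ m, 0 ≤ ε m) :
    SmallInProb (seqLaw Q) fun (T : ℕ) s => 1 / ((B : ℝ) * √(T : ℝ)) *
      ∑ m ∈ Finset.range T,
        |∑ i ∈ Finset.range ((m + 1) * B), stdScore Q ψ B R π i s (s i)| * ε m := by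
  have hlim := (tendsto_sum_sqrt_mul hε hε0).const_mul (1 / √(B : ℝ))
  rw [mul_zero] at hlim
  have hU := fun m : ℕ => hπ.sq_sum_stdScore_le h hd hsep (Finset.range ((m + 1) * B))
  have hUi : ∀ m : ℕ, Integrable (fun s => |∑ i ∈ Finset.range ((m + 1) * B),
      stdScore Q ψ B R π i s (s i)|) (seqLaw Q) := fun m =>
    ((hU m).1.integrable (by norm_num)).abs
  have hint : ∀ T : ℕ, Integrable (fun s => 1 / ((B : ℝ) * √(T : ℝ)) *
      ∑ m ∈ Finset.range T,
        |∑ i ∈ Finset.range ((m + 1) * B), stdScore Q ψ B R π i s (s i)| * ε m) (seqLaw Q) :=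
    fun T => (integrable_finsetSum _ fun m _ => (hUi m).mul_const _).const_mul _
  refine smallInProb_of_integral hlim (Eventually.of_forall hint) ?_
  filter_upwards [eventually_gt_atTop 0] with T hT
  have hT0 : (0 : ℝ) < T := by exact_mod_cast hT
  have hB0 : (0 : ℝ) < B := by exact_mod_cast hB
  have habs : ∀ s : ℕ → Obs 𝒳, |1 / ((B : ℝ) * √(T : ℝ)) *
      ∑ m ∈ Finset.range T,
        |∑ i ∈ Finset.range ((m + 1) * B), stdScore Q ψ B R π i s (s i)| * ε m| =
      1 / ((B : ℝ) * √(T : ℝ)) *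
      ∑ m ∈ Finset.range T,
        |∑ i ∈ Finset.range ((m + 1) * B), stdScore Q ψ B R π i s (s i)| * ε m := fun s =>
    abs_of_nonneg (mul_nonneg (by positivity)
      (Finset.sum_nonneg fun m _ => mul_nonneg (abs_nonneg _) (hε0 m)))
  simp_rw [habs]
  rw [integral_const_mul, integral_finsetSum _ fun m _ => (hUi m).mul_const _]
  simp_rw [integral_mul_const]
  -- Orthogonality bounds the `L¹` size of a sum over `m + 1` batches by `√((m + 1) B)`; against the
  -- factor `1 / √T` this leaves the weights `√((m + 1) / T)` of `tendsto_sum_sqrt_mul`.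
  have hUn : ∀ m : ℕ, ∫ s, |∑ i ∈ Finset.range ((m + 1) * B), stdScore Q ψ B R π i s (s i)|
      ∂seqLaw Q ≤ √(((m : ℝ) + 1) * B) := fun m => by
    refine Real.le_sqrt_of_sq_le ((sq_integral_abs_le (hU m).1).trans ((hU m).2.trans_eq ?_))
    rw [Finset.card_range]
    push_cast
    ring
  calc _ ≤ 1 / ((B : ℝ) * √(T : ℝ)) * ∑ m ∈ Finset.range T, √(((m : ℝ) + 1) * B) * ε m := by
        gcongr with m hm
        · exact hε0 m
        · exact hUn m
    _ = _ := by
        rw [Finset.mul_sum, Finset.mul_sum]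
        refine Finset.sum_congr rfl fun m _ => ?_
        rw [Real.sqrt_mul (by positivity), Real.sqrt_div (by positivity)]
        have h1 : √(B : ℝ) ^ 2 = B := Real.sq_sqrt hB0.le
        have h2 : 0 < √(B : ℝ) := Real.sqrt_pos.2 hB0
        have h3 : 0 < √(T : ℝ) := Real.sqrt_pos.2 hT0
        nth_rewrite 1 [← h1]
        field_simp

end PolicyProcess

/-- Normal approximation of the estimation error. -/
theorem PolicyProcess.smallInProb_error_sub {Q : Measure (Obs 𝒳)} [IsProbabilityMeasure Q] {B : ℕ}
    {π : (ℕ → Obs 𝒳) → ℕ → 𝒳 → ℝ} {δ K : ℝ} (hπ : PolicyProcess Q B π δ K)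
    {e : 𝒳 → ℝ} {C σ : ℝ} (h : RegularScore Q (ipwScore e) C σ) {R : ℕ} {d : ℝ} (hd : 0 < d)
    (hsep : ∀ t, R ≤ t → ∀ᵐ s ∂seqLaw Q, d ≤ covNorm Q (gap (π s) t)) (hB : 0 < B) :
    SmallInProb (seqLaw Q) fun (T : ℕ) s =>
      √(T : ℝ) * (crammedEstimator e B s (π s) T - scoreMean Q (ipwScore e) (gap (π s) T)) -
        √(scoreVar Q (ipwScore e) (gap (π s) T) / B) * ((√((T * B : ℕ) : ℝ))⁻¹ *
          ∑ i ∈ Finset.range (T * B), stdScore Q (ipwScore e) B R π i s (s i)) := by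
  set ψ := ipwScore e with hψ
  obtain ⟨κ, hκ, hlow⟩ := hπ.exists_scoreVar_regGap_ge h hd hsep
  obtain ⟨ε, hε, hε0, hinc⟩ := hπ.exists_sqrt_scoreVar_increment_le h hd hsep
  have hB0 : (0 : ℝ) < B := by exact_mod_cast hB
  -- the first `R` batches
  let D : (ℕ → Obs 𝒳) → ℝ := fun s => ∑ i ∈ Finset.range (R * B),
    (centered Q ψ (gap (π s) (i / B)) (s i) - centered Q ψ (regGap (π s) R (i / B)) (s i))
  obtain ⟨M, hM, hmom⟩ := h.exists_moment_bounds
  have hint : ∀ (F : (ℕ → Obs 𝒳) → 𝒳 → ℝ) (i : ℕ),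
      Measurable (fun p : (ℕ → Obs 𝒳) × 𝒳 => F p.1 p.2) → DependsOn F (Set.Iio (i / B * B)) →
      (∀ s x, |F s x| ≤ 1) → Integrable (fun s => centered Q ψ (F s) (s i)) (seqLaw Q) := by
    intro F i hF hFd hFb
    have hFs : ∀ s, Measurable (F s) := fun s => hF.comp measurable_prodMk_left
    exact (integrable_of_condMean_le (Q := Q) (H := fun s o => centered Q ψ (F s) o) (c := M)
      (measurable_centered h.measurable hF) (hFd.postcomp fun f o => centered Q ψ f o)
      (Nat.div_mul_le_self i B)
      (ae_of_all _ fun s => (h.memLp_centered (hFs s) (hFb s)).integrable (by norm_num))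
      (ae_of_all _ fun s => (hmom _ (hFs s) (hFb s)).1)).2.1
  have hD : Integrable D (seqLaw Q) := integrable_finsetSum _ fun i _ =>
    (hint _ i (hπ.measurable_gap _) (hπ.dependsOn_gap _) fun s => hπ.abs_gap_le s _).sub
      (hint _ i (hπ.measurable_regGap R _) (hπ.dependsOn_regGap R _) fun s =>
        hπ.abs_regGap_le s R _)
  have small1 : SmallInProb (seqLaw Q) fun (T : ℕ) s => 1 / ((B : ℝ) * √(T : ℝ)) * D s := by
    have hlim : Tendsto (fun T : ℕ => 1 / (B : ℝ) * (√(T : ℝ))⁻¹ * ∫ s, |D s| ∂seqLaw Q) atTop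
        (𝓝 0) := by
      have h1 : Tendsto (fun n : ℕ => (√(n : ℝ))⁻¹) atTop (𝓝 0) :=
        tendsto_inv_atTop_zero.comp (Real.tendsto_sqrt_atTop.comp tendsto_natCast_atTop_atTop)
      simpa using (h1.const_mul (1 / (B : ℝ))).mul_const (∫ s, |D s| ∂seqLaw Q)
    refine smallInProb_of_integral hlim (Eventually.of_forall fun T => hD.const_mul _)
      (Eventually.of_forall fun T => ?_)
    simp_rw [abs_mul]
    rw [integral_const_mul, abs_of_nonneg (by positivity), one_div, mul_inv, one_div]
  have small2 := hπ.smallInProb_by_parts h hd hsep hB hε hε0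
  have small3 := hπ.smallInProb_excess h
  have small4 := hπ.smallInProb_last_update h
  -- The four negligible terms are the altered first batches, the remainder of the summation by
  -- parts, the unequal weights and the last update. For large `T` their sum is, almost surely,
  -- exactly the expression to be bounded.
  have hsum := ((small1.add (small2.mono (f := fun (T : ℕ) s => -(1 / ((B : ℝ) * √(T : ℝ)) *
      ∑ m ∈ Finset.range T,
        (∑ i ∈ Finset.range ((m + 1) * B), stdScore Q ψ B R π i s (s i)) *
          (√(scoreVar Q ψ (regGap (π s) R (m + 1))) - √(scoreVar Q ψ (regGap (π s) R m)))))
      (Eventually.of_forall fun T => ?_))).add small3).add (small4.const_mul (-1))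
  · refine hsum.mono ?_
    filter_upwards [eventually_ge_atTop (max R 1)] with T hT
    filter_upwards [hlow] with s hs
    have hTR : R ≤ T := (le_max_left _ _).trans hT
    have hT1 : 0 < T := (le_max_right _ _).trans hT
    have hT0 : (0 : ℝ) < T := by exact_mod_cast hT1
    have hTne : √(T : ℝ) ≠ 0 := (Real.sqrt_pos.2 hT0).ne'
    have hBne : √(B : ℝ) ≠ 0 := (Real.sqrt_pos.2 hB0).ne'
    have hTT : √(T : ℝ) ^ 2 = T := Real.sq_sqrt hT0.le
    have hBB : √(B : ℝ) ^ 2 = B := Real.sq_sqrt hB0.le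
    apply le_of_eq
    congr 1
    have e1 : ∑ i ∈ Finset.range (T * B), centered Q ψ (gap (π s) (i / B)) (s i) =
        D s + ∑ i ∈ Finset.range (T * B), centered Q ψ (regGap (π s) R (i / B)) (s i) := by
      rw [← sub_eq_iff_eq_add, ← Finset.sum_sub_distrib]
      refine (Finset.sum_subset (Finset.range_mono (Nat.mul_le_mul_right B hTR)) ?_).symm
      intro i _ hi
      have hi' : ¬ i / B < R := by
        rw [Finset.mem_range, not_lt] at hi
        rwa [not_lt, Nat.le_div_iff_mul_le hB]
      have : regGap (π s) R (i / B) = gap (π s) (i / B) := by funext x; simp [regGap, hi']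
      rw [this, sub_self]
    have e2 : ∑ i ∈ Finset.range (T * B), centered Q ψ (regGap (π s) R (i / B)) (s i) =
        ∑ i ∈ Finset.range (T * B), stdScore Q ψ B R π i s (s i) *
          √(scoreVar Q ψ (regGap (π s) R (i / B))) := by
      refine Finset.sum_congr rfl fun i _ => ?_
      rw [stdScore, div_mul_cancel₀ _ (Real.sqrt_pos.2 (hκ.trans_le (hs _))).ne']
    have e3 : regGap (π s) R T = gap (π s) T := by funext x; simp [regGap, hTR.not_gt]
    -- Summation by parts makes the conditional standard deviation at time `T` a common factor of
    -- the whole sum of standardized scores.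
    rw [hπ.crammedEstimator_sub_eq h hB s hT1, e1, e2,
      sum_range_mul_batch_by_parts B T (fun i => stdScore Q ψ B R π i s (s i))
        (fun m => √(scoreVar Q ψ (regGap (π s) R m))), e3, Real.sqrt_div' _ hB0.le, Nat.cast_mul,
      Real.sqrt_mul hT0.le]
    set U := ∑ i ∈ Finset.range (T * B), stdScore Q ψ B R π i s (s i)
    set E := ∑ m ∈ Finset.range T,
        (∑ i ∈ Finset.range ((m + 1) * B), stdScore Q ψ B R π i s (s i)) *
          (√(scoreVar Q ψ (regGap (π s) R (m + 1))) - √(scoreVar Q ψ (regGap (π s) R m)))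
    set X := ∑ i ∈ Finset.range (T * B), centered Q ψ (excess (π s) T (i / B)) (s i)
    set a := √(scoreVar Q ψ (gap (π s) T))
    set Y := scoreMean Q ψ (fun x => π s T x - π s (T - 1) x)
    have f1 : √(T : ℝ) * (1 / ((B : ℝ) * T)) = 1 / (B * √(T : ℝ)) := by
      nth_rewrite 2 [← hTT]
      field_simp
    have f2 : a / √(B : ℝ) * ((√(T : ℝ) * √(B : ℝ))⁻¹ * U) = 1 / (B * √(T : ℝ)) * (a * U) := by
      rw [show a / √(B : ℝ) * ((√(T : ℝ) * √(B : ℝ))⁻¹ * U) =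
        1 / (√(B : ℝ) ^ 2 * √(T : ℝ)) * (a * U) by field_simp, hBB]
    rw [f2]
    linear_combination (D s + (a * U - E)) * f1
  · filter_upwards [hinc] with s hs
    rw [abs_neg, abs_mul, abs_mul]
    refine mul_le_mul_of_nonneg_left ?_ (abs_nonneg _)
    refine (Finset.abs_sum_le_sum_abs _ _).trans (le_trans (Finset.sum_le_sum fun m _ => ?_)
      (le_abs_self _))
    rw [abs_mul]
    exact mul_le_mul_of_nonneg_left (hs m) (abs_nonneg _)

end Normal


/-! ### Consistency of the variance estimator -/

section Tail

variable {𝒳 : Type*} [MeasurableSpace 𝒳] {Q : Measure (Obs 𝒳)} [IsProbabilityMeasure Q]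

/-- A sequence of policies with summable increments is at tail-sum distance from its later terms. -/
theorem covNorm_sub_le_tail {p : ℕ → 𝒳 → ℝ} (hp : ∀ t, Measurable (p t))
    (hp1 : ∀ t x, p t x ∈ Set.Icc (0 : ℝ) 1) {f : ℕ → ℝ} (hf : Summable f) (hf0 : ∀ t, 0 ≤ f t)
    (hle : ∀ t, covNorm Q (fun x => p (t + 1) x - p t x) ≤ f t) {m n : ℕ} (hmn : m ≤ n) :
    covNorm Q (fun x => p n x - p m x) ≤ ∑' k, f (k + m) := by
  have hb : ∀ t u x, |p t x - p u x| ≤ 1 := fun t u x => by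
    rw [abs_le]
    constructor <;> linarith [(hp1 t x).1, (hp1 t x).2, (hp1 u x).1, (hp1 u x).2]
  obtain ⟨j, rfl⟩ := Nat.exists_eq_add_of_le hmn
  have hs : Summable fun k => f (k + m) := (summable_nat_add_iff m).2 hf
  refine le_trans ?_ (hs.sum_le_tsum (Finset.range j) fun k _ => hf0 _)
  have e : (fun x => p (m + j) x - p m x) =
      fun x => ∑ k ∈ Finset.range j, (p (k + m + 1) x - p (k + m) x) * 1 := by
    funext x
    have := Finset.sum_range_sub (fun k => p (k + m) x) j
    simp only [zero_add] at this
    rw [add_comm m j, ← this]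
    refine Finset.sum_congr rfl fun k _ => ?_
    rw [mul_one, add_right_comm]
  rw [e]
  refine (covNorm_sum_le (b := 1) (Finset.range j) (fun _ => (1 : ℝ)) (fun _ _ => zero_le_one)
    (fun k _ => (hp _).sub (hp _)) fun k _ x => hb _ _ x).trans ?_
  simp_rw [mul_one]
  exact Finset.sum_le_sum fun k _ => hle (k + m)

end Tail

/-- Reversing the order of summation turns this into a Cesàro mean. It reflects that late samples
are short and inaccurate, but few. -/
theorem tendsto_average_reflect {u : ℕ → ℝ} (hu : Tendsto u atTop (𝓝 0)) :
    Tendsto (fun T : ℕ => (T : ℝ)⁻¹ * ∑ m ∈ Finset.range T, u (T - m)) atTop (𝓝 0) := by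
  refine ((tendsto_add_atTop_iff_nat 1).2 hu).cesaro.congr fun T => ?_
  rw [← Finset.sum_range_reflect]
  congr 1
  refine Finset.sum_congr rfl fun m hm => ?_
  have := Finset.mem_range.1 hm
  congr 1
  omega

section Variance

variable {𝒳 : Type*} [MeasurableSpace 𝒳]

/-- Sample variance of the scores weighted by the policy gap after `m` batches. -/
noncomputable def gapVar (ψ : Obs 𝒳 → ℝ) (B : ℕ) (π : ℕ → 𝒳 → ℝ) (s : ℕ → Obs 𝒳) (T m : ℕ) : ℝ :=
  smpVar (Finset.Ico (m * B) (T * B)) fun i => ψ (s i) * gap π m (s i).1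

/-- Sample variance of the scores weighted by the excess weights after `m` batches. -/
noncomputable def excessVar (ψ : Obs 𝒳 → ℝ) (B : ℕ) (π : ℕ → 𝒳 → ℝ) (s : ℕ → Obs 𝒳)
    (T m : ℕ) : ℝ :=
  smpVar (Finset.Ico (m * B) (T * B)) fun i => ψ (s i) * excess π T m (s i).1

theorem nonempty_Ico_mul {B m T : ℕ} (hB : 0 < B) (hm : m < T) :
    (Finset.Ico (m * B) (T * B)).Nonempty :=
  Finset.nonempty_Ico.2 (Nat.mul_lt_mul_of_pos_right hm hB)

-- `abs_smpVar_add_sub_le` applied to every sample with one common `ε`, the telescoped part of the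
-- weight being the main term and the excess the perturbation.
omit [MeasurableSpace 𝒳] in
theorem abs_varEstimator_sub_le (e : 𝒳 → ℝ) {B : ℕ} (hB : 0 < B) (s : ℕ → Obs 𝒳)
    (π : ℕ → 𝒳 → ℝ) {T : ℕ} (hT : 0 < T) {ε : ℝ} (hε : 0 < ε) :
    |varEstimator e B s π T -
        1 / ((T : ℝ) * B) * ∑ m ∈ Finset.Ico 1 T, gapVar (ipwScore e) B π s T m| ≤
      ε * (1 / ((T : ℝ) * B) * ∑ m ∈ Finset.Ico 1 T, gapVar (ipwScore e) B π s T m) +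
        (1 + 1 / ε) * ((T : ℝ) / B * ∑ m ∈ Finset.Ico 1 T, excessVar (ipwScore e) B π s T m) := by
  have hT0 : (0 : ℝ) < T := by exact_mod_cast hT
  have hB0 : (0 : ℝ) < B := by exact_mod_cast hB
  have e1 : ∀ x : ℝ, 1 / ((T : ℝ) * B) * x = (T : ℝ) / B * ((1 / (T : ℝ)) ^ 2 * x) := fun x => by
    field_simp
  have hterm : ∀ m ∈ Finset.Ico 1 T,
      |sampleVar e B s π T (m + 1) - (1 / (T : ℝ)) ^ 2 * gapVar (ipwScore e) B π s T m| ≤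
        ε * ((1 / (T : ℝ)) ^ 2 * gapVar (ipwScore e) B π s T m) +
          (1 + 1 / ε) * excessVar (ipwScore e) B π s T m := by
    intro m hm
    have hmT := (Finset.mem_Ico.1 hm).2
    rw [sampleVar_eq_smpVar e B s π hmT, gapVar, ← smpVar_const_mul]
    exact abs_smpVar_add_sub_le _ _ (nonempty_Ico_mul hB hmT) hε
  rw [varEstimator_eq, e1, Finset.mul_sum (a := (1 / (T : ℝ)) ^ 2), ← mul_sub,
    ← Finset.sum_sub_distrib, abs_mul, abs_of_pos (div_pos hT0 hB0)]
  refine (mul_le_mul_of_nonneg_left ((Finset.abs_sum_le_sum_abs _ _).trans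
    (Finset.sum_le_sum hterm)) (div_pos hT0 hB0).le).trans_eq ?_
  rw [Finset.sum_add_distrib, ← Finset.mul_sum, ← Finset.mul_sum, ← Finset.mul_sum]
  ring

namespace PolicyProcess

variable {Q : Measure (Obs 𝒳)} [IsProbabilityMeasure Q] {B : ℕ}
  {π : (ℕ → Obs 𝒳) → ℕ → 𝒳 → ℝ} {δ K : ℝ} (hπ : PolicyProcess Q B π δ K)

include hπ

variable {ψ : Obs 𝒳 → ℝ} {C σ : ℝ} (h : RegularScore Q ψ C σ) (hB : 0 < B)

include h hB

theorem integral_sum_gapVar_le {T : ℕ} (hT : 0 < T) :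
    Integrable (fun s => 1 / ((T : ℝ) * B) * ∑ m ∈ Finset.Ico 1 T, gapVar ψ B (π s) s T m)
        (seqLaw Q) ∧
      ∫ s, 1 / ((T : ℝ) * B) * ∑ m ∈ Finset.Ico 1 T, gapVar ψ B (π s) s T m ∂seqLaw Q ≤
        2 * C / B := by
  have hT0 : (0 : ℝ) < T := by exact_mod_cast hT
  have hB0 : (0 : ℝ) < B := by exact_mod_cast hB
  have hC := h.const_nonneg
  have key := fun m (hm : m ∈ Finset.Ico 1 T) =>
    integral_smpVar_le h (hπ.measurable_gap m) (hπ.dependsOn_gap m)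
      (I := Finset.Ico (m * B) (T * B)) (fun i hi => (Finset.mem_Ico.1 hi).1)
      (nonempty_Ico_mul hB (Finset.mem_Ico.1 hm).2) (fun s => hπ.abs_gap_le s m)
      (ae_of_all _ fun s => h.scoreVar_le_const
        ((hπ.measurable_gap m).comp measurable_prodMk_left) (hπ.abs_gap_le s m))
  refine ⟨(integrable_finsetSum _ fun m hm => (key m hm).1).const_mul _, ?_⟩
  rw [integral_const_mul, integral_finsetSum]
  · refine (mul_le_mul_of_nonneg_left (Finset.sum_le_sum fun m hm => (key m hm).2)
      (by positivity)).trans ?_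
    rw [Finset.sum_const, Nat.card_Ico, nsmul_eq_mul, div_mul_eq_mul_div, one_mul,
      div_le_div_iff₀ (by positivity) hB0]
    have : ((T - 1 : ℕ) : ℝ) ≤ T := by exact_mod_cast Nat.sub_le T 1
    calc ((T - 1 : ℕ) : ℝ) * (2 * C) * B ≤ T * (2 * C) * B := by gcongr
      _ = _ := by ring
  · exact fun m hm => (key m hm).1

theorem integral_sum_excessVar_le (T : ℕ) :
    Integrable (fun s => (T : ℝ) / B * ∑ m ∈ Finset.Ico 1 T, excessVar ψ B (π s) s T m)
        (seqLaw Q) ∧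
      ∫ s, (T : ℝ) / B * ∑ m ∈ Finset.Ico 1 T, excessVar ψ B (π s) s T m ∂seqLaw Q ≤
        2 * C / B * (T * (∑ t ∈ Finset.Icc 1 (T - 1),
          K * (t : ℝ) ^ (-(1 + δ)) * (1 / ((T : ℝ) - t) - 1 / T)) *
          ∑ m ∈ Finset.range T, 1 / ((T : ℝ) - m)) := by
  have hB0 : (0 : ℝ) < B := by exact_mod_cast hB
  have hC := h.const_nonneg
  set ρ := ∑ t ∈ Finset.Icc 1 (T - 1),
    K * (t : ℝ) ^ (-(1 + δ)) * (1 / ((T : ℝ) - t) - 1 / T) with hρ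
  have hρ0 : 0 ≤ ρ := Finset.sum_nonneg fun t ht => by
    have h1 := (Finset.mem_Icc.1 ht)
    exact mul_nonneg (mul_nonneg hπ.const_nonneg (by positivity)) (weight_nonneg (by omega))
  have hinv : ∀ m ∈ Finset.range T, 0 ≤ 1 / ((T : ℝ) - m) := fun m hm => by
    have : (m : ℝ) < T := by exact_mod_cast Finset.mem_range.1 hm
    exact one_div_nonneg.2 (by linarith)
  have key := fun m (hm : m ∈ Finset.Ico 1 T) =>
    integral_smpVar_le h (hπ.measurable_excess T m) (hπ.dependsOn_excess T m)
      (I := Finset.Ico (m * B) (T * B)) (fun i hi => (Finset.mem_Ico.1 hi).1)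
      (nonempty_Ico_mul hB (Finset.mem_Ico.1 hm).2)
      (fun s => hπ.abs_excess_le (Finset.mem_Ico.1 hm).2 s)
      ((hπ.ae_scoreVar_excess_le h).mono fun s hs => hs T m (Finset.mem_Ico.1 hm).2)
  refine ⟨(integrable_finsetSum _ fun m hm => (key m hm).1).const_mul _, ?_⟩
  rw [integral_const_mul, integral_finsetSum]
  · refine (mul_le_mul_of_nonneg_left (Finset.sum_le_sum fun m hm => (key m hm).2)
      (by positivity)).trans ?_
    rw [← hρ, ← Finset.mul_sum, ← Finset.sum_mul]
    have : ∑ m ∈ Finset.Ico 1 T, 1 / ((T : ℝ) - m) ≤ ∑ m ∈ Finset.range T, 1 / ((T : ℝ) - m) :=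
      Finset.sum_le_sum_of_subset_of_nonneg
        (fun m hm => Finset.mem_range.2 (Finset.mem_Ico.1 hm).2) fun m hm _ => hinv m hm
    calc (T : ℝ) / B * (2 * ((∑ m ∈ Finset.Ico 1 T, 1 / ((T : ℝ) - m)) * (C * ρ)))
        ≤ (T : ℝ) / B * (2 * ((∑ m ∈ Finset.range T, 1 / ((T : ℝ) - m)) * (C * ρ))) := by gcongr
      _ = _ := by ring
  · exact fun m hm => (key m hm).1

/-- The sample variances are close to the conditional variances on average. -/
theorem smallInProb_average_gapVar_sub :
    SmallInProb (seqLaw Q) fun (T : ℕ) s => 1 / ((T : ℝ) * B) *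
      ∑ m ∈ Finset.Ico 1 T, (gapVar ψ B (π s) s T m - scoreVar Q ψ (gap (π s) m)) := by
  have hB0 : (0 : ℝ) < B := by exact_mod_cast hB
  have hC := h.const_nonneg
  obtain ⟨M, hM, hmom⟩ := h.exists_moment_bounds
  -- The sample that starts after `m` batches has `(T - m) * B` observations, so its mean error is
  -- this sequence at `k = T - m`.
  have hu : Tendsto (fun k : ℕ => (2 * √M + 4 * C) / √((k * B : ℕ) : ℝ)) atTop (𝓝 0) := by
    refine Tendsto.const_div_atTop (Real.tendsto_sqrt_atTop.comp
      (tendsto_natCast_atTop_atTop.comp (tendsto_id.atTop_mul_const' hB))) _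
  have hlim := (tendsto_average_reflect hu).const_mul (1 / (B : ℝ))
  rw [mul_zero] at hlim
  have key := fun (T m : ℕ) (hm : m ∈ Finset.Ico 1 T) =>
    integral_abs_smpVar_sub_le h (hπ.measurable_gap m) (hπ.dependsOn_gap m)
      (I := Finset.Ico (m * B) (T * B)) (fun i hi => (Finset.mem_Ico.1 hi).1)
      (nonempty_Ico_mul hB (Finset.mem_Ico.1 hm).2) (fun s => hπ.abs_gap_le s m)
      fun f hf hb => (hmom f hf hb).2.2
  refine smallInProb_of_integral hlim (Eventually.of_forall fun T =>
    (integrable_finsetSum _ fun m hm => (key T m hm).1).const_mul _)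
    (Eventually.of_forall fun T => ?_)
  have hle : ∫ s, |∑ m ∈ Finset.Ico 1 T, (gapVar ψ B (π s) s T m - scoreVar Q ψ (gap (π s) m))|
      ∂seqLaw Q ≤ ∑ m ∈ Finset.range T, (2 * √M + 4 * C) / √(((T - m) * B : ℕ) : ℝ) := by
    calc _ ≤ ∫ s, ∑ m ∈ Finset.Ico 1 T, |gapVar ψ B (π s) s T m - scoreVar Q ψ (gap (π s) m)|
          ∂seqLaw Q := by
          refine integral_mono (integrable_finsetSum _ fun m hm => (key T m hm).1).abs
            (integrable_finsetSum _ fun m hm => (key T m hm).1.abs)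
            fun s => Finset.abs_sum_le_sum_abs _ _
      _ = ∑ m ∈ Finset.Ico 1 T, ∫ s, |gapVar ψ B (π s) s T m - scoreVar Q ψ (gap (π s) m)|
          ∂seqLaw Q := integral_finsetSum _ fun m hm => (key T m hm).1.abs
      _ ≤ ∑ m ∈ Finset.Ico 1 T, (2 * √M + 4 * C) / √(((T - m) * B : ℕ) : ℝ) := by
          refine Finset.sum_le_sum fun m hm => (key T m hm).2.trans_eq ?_
          rw [Nat.card_Ico, Nat.sub_mul]
      _ ≤ _ := Finset.sum_le_sum_of_subset_of_nonneg
          (fun m hm => Finset.mem_range.2 (Finset.mem_Ico.1 hm).2) fun m _ _ => by positivity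
  simp_rw [abs_mul]
  rw [integral_const_mul, abs_of_nonneg (by positivity)]
  refine (mul_le_mul_of_nonneg_left hle (by positivity)).trans_eq ?_
  rw [one_div, mul_inv, one_div]
  ring

omit hB in
/-- The conditional variances converge on average. -/
theorem smallInProb_average_scoreVar_sub :
    SmallInProb (seqLaw Q) fun (T : ℕ) s => 1 / ((T : ℝ) * B) *
      ∑ m ∈ Finset.Ico 1 T, (scoreVar Q ψ (gap (π s) m) - scoreVar Q ψ (gap (π s) T)) := by
  have hC := h.const_nonneg
  set f : ℕ → ℝ := fun t => K * ((t : ℝ) + 1) ^ (-(1 + δ)) with hf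
  have hf0 : ∀ t, 0 ≤ f t := fun t => mul_nonneg hπ.const_nonneg (by positivity)
  have hfs : Summable f := by
    refine Summable.mul_left _ ?_
    have := (summable_nat_add_iff 1).2
      (Real.summable_nat_rpow (p := -(1 + δ)) |>.2 (by linarith [hπ.delta_pos]))
    simpa using this
  -- The policies at `m` and at `T` differ by at most a tail of the summable rate, uniformly in `T`,
  -- and the Cesàro means of these tails vanish. The reference is the policy at `T` itself, so the
  -- limit policy is not needed.
  have htail : Tendsto (fun m => ∑' k, f (k + m)) atTop (𝓝 0) := tendsto_sum_nat_add f
  have hlim := htail.cesaro.const_mul ((2 * C + 2 * (1 + C) ^ 2) / (B : ℝ))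
  rw [mul_zero] at hlim
  refine smallInProb_of_bound hlim (Eventually.of_forall fun T => ?_)
  filter_upwards [hπ.ae_stable] with s hs
  have hm : ∀ m, Measurable (gap (π s) m) := fun m =>
    (hπ.measurable_gap m).comp measurable_prodMk_left
  have hterm : ∀ m ∈ Finset.Ico 1 T, |scoreVar Q ψ (gap (π s) m) - scoreVar Q ψ (gap (π s) T)| ≤
      (2 * C + 2 * (1 + C) ^ 2) * ∑' k, f (k + m) := by
    intro m hmT
    rw [abs_sub_comm]
    refine (h.abs_scoreVar_sub_le (hm T) (hπ.abs_gap_le s T) (hm m)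
      (hπ.abs_gap_le s m)).trans ?_
    refine mul_le_mul_of_nonneg_left ?_ (by positivity)
    have e : (fun x => gap (π s) T x - gap (π s) m x) = fun x => π s T x - π s m x := by
      funext x
      simp [gap]
    rw [e]
    refine covNorm_sub_le_tail (hπ.measurable_apply s) (hπ.mem_Icc s) hfs hf0 (fun t => ?_)
      (Finset.mem_Ico.1 hmT).2.le
    have := hs (t + 1) (by omega)
    push_cast at this
    exact this
  rw [abs_mul, abs_of_nonneg (by positivity)]
  calc _ ≤ 1 / ((T : ℝ) * B) * ∑ m ∈ Finset.range T,
        (2 * C + 2 * (1 + C) ^ 2) * ∑' k, f (k + m) := by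
        refine mul_le_mul_of_nonneg_left ?_ (by positivity)
        refine (Finset.abs_sum_le_sum_abs _ _).trans ((Finset.sum_le_sum hterm).trans ?_)
        exact Finset.sum_le_sum_of_subset_of_nonneg
          (fun m hm => Finset.mem_range.2 (Finset.mem_Ico.1 hm).2) fun m _ _ =>
            mul_nonneg (by positivity) (tsum_nonneg fun k => hf0 _)
    _ = _ := by
        rw [← Finset.mul_sum, one_div, mul_inv]
        ring

end PolicyProcess

/-- Consistency of the variance estimator. -/
theorem PolicyProcess.smallInProb_varEstimator_sub {Q : Measure (Obs 𝒳)} [IsProbabilityMeasure Q]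
    {B : ℕ} {π : (ℕ → Obs 𝒳) → ℕ → 𝒳 → ℝ} {δ K : ℝ} (hπ : PolicyProcess Q B π δ K)
    {e : 𝒳 → ℝ} {C σ : ℝ} (h : RegularScore Q (ipwScore e) C σ) (hB : 0 < B) :
    SmallInProb (seqLaw Q) fun (T : ℕ) s =>
      varEstimator e B s (π s) T - scoreVar Q (ipwScore e) (gap (π s) T) / B := by
  have hB0 : (0 : ℝ) < B := by exact_mod_cast hB
  have hC := h.const_nonneg
  set w : ℕ → ℝ := fun T => T * (∑ t ∈ Finset.Icc 1 (T - 1),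
          K * (t : ℝ) ^ (-(1 + δ)) * (1 / ((T : ℝ) - t) - 1 / T)) *
          ∑ m ∈ Finset.range T, 1 / ((T : ℝ) - m) with hw
  have hw0 : Tendsto w atTop (𝓝 0) :=
    tendsto_weight_discrepancy hπ.delta_pos hπ.delta_le_one hπ.const_nonneg
  -- The excess part has mean at most `2C/B · w T ≤ ε²`, so that `(1 + 1/ε) ε² = ε² + ε` still
  -- vanishes. The summand `1 / (T + 1)` only keeps `ε` positive.
  set ε : ℕ → ℝ := fun T => √(|2 * C / B * w T| + 1 / ((T : ℝ) + 1)) with hε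
  have hε0 : ∀ T, 0 < ε T := fun T => Real.sqrt_pos.2 (by positivity)
  have hεlim : Tendsto ε atTop (𝓝 0) := by
    have h1 := ((hw0.const_mul (2 * C / (B : ℝ))).abs.add
      tendsto_one_div_add_atTop_nhds_zero_nat).sqrt
    rw [mul_zero, abs_zero, add_zero, Real.sqrt_zero] at h1
    exact h1
  have hεw : ∀ T, 2 * C / B * w T ≤ ε T ^ 2 := fun T => by
    rw [hε, Real.sq_sqrt (by positivity)]
    exact (le_abs_self _).trans (le_add_of_nonneg_right (by positivity))
  have hgap : ∀ s (T : ℕ), 0 ≤ 1 / ((T : ℝ) * B) *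
      ∑ m ∈ Finset.Ico 1 T, gapVar (ipwScore e) B (π s) s T m := fun s T =>
    mul_nonneg (by positivity) (Finset.sum_nonneg fun m hm =>
      smpVar_nonneg _ (nonempty_Ico_mul hB (Finset.mem_Ico.1 hm).2))
  have hexc : ∀ s (T : ℕ), 0 ≤ (T : ℝ) / B *
      ∑ m ∈ Finset.Ico 1 T, excessVar (ipwScore e) B (π s) s T m := fun s T =>
    mul_nonneg (by positivity) (Finset.sum_nonneg fun m hm =>
      smpVar_nonneg _ (nonempty_Ico_mul hB (Finset.mem_Ico.1 hm).2))
  have small1 : SmallInProb (seqLaw Q) fun (T : ℕ) s =>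
      ε T * (1 / ((T : ℝ) * B) * ∑ m ∈ Finset.Ico 1 T, gapVar (ipwScore e) B (π s) s T m) +
        (1 + 1 / ε T) *
          ((T : ℝ) / B * ∑ m ∈ Finset.Ico 1 T, excessVar (ipwScore e) B (π s) s T m) := by
    have hlim : Tendsto (fun T => ε T * (2 * C / B) + (ε T ^ 2 + ε T)) atTop (𝓝 0) := by
      simpa using (hεlim.mul_const (2 * C / (B : ℝ))).add ((hεlim.pow 2).add hεlim)
    have hi : ∀ T : ℕ, 0 < T → Integrable (fun s =>
      ε T * (1 / ((T : ℝ) * B) * ∑ m ∈ Finset.Ico 1 T, gapVar (ipwScore e) B (π s) s T m) +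
        (1 + 1 / ε T) *
          ((T : ℝ) / B * ∑ m ∈ Finset.Ico 1 T, excessVar (ipwScore e) B (π s) s T m))
        (seqLaw Q) := fun T hT =>
      ((hπ.integral_sum_gapVar_le h hB hT).1.const_mul _).add
        ((hπ.integral_sum_excessVar_le h hB T).1.const_mul _)
    refine smallInProb_of_integral hlim ((eventually_gt_atTop 0).mono hi) ?_
    filter_upwards [eventually_gt_atTop 0] with T hT
    have hnn : ∀ s, 0 ≤ ε T * (1 / ((T : ℝ) * B) * ∑ m ∈ Finset.Ico 1 T,
        gapVar (ipwScore e) B (π s) s T m) + (1 + 1 / ε T) *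
          ((T : ℝ) / B * ∑ m ∈ Finset.Ico 1 T, excessVar (ipwScore e) B (π s) s T m) := fun s =>
      add_nonneg (mul_nonneg (hε0 T).le (hgap s T))
        (mul_nonneg (by have := hε0 T; positivity) (hexc s T))
    simp_rw [fun s => abs_of_nonneg (hnn s)]
    rw [integral_add ((hπ.integral_sum_gapVar_le h hB hT).1.const_mul _)
      ((hπ.integral_sum_excessVar_le h hB T).1.const_mul _), integral_const_mul (ε T),
      integral_const_mul (1 + 1 / ε T)]
    refine add_le_add (mul_le_mul_of_nonneg_left (hπ.integral_sum_gapVar_le h hB hT).2 (hε0 T).le)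
      ((mul_le_mul_of_nonneg_left ((hπ.integral_sum_excessVar_le h hB T).2.trans (hεw T))
        (by have := hε0 T; positivity)).trans_eq ?_)
    have := (hε0 T).ne'
    field_simp
  have small2 : SmallInProb (seqLaw Q) fun (T : ℕ) s =>
      1 / ((T : ℝ) * B) * scoreVar Q (ipwScore e) (gap (π s) T) := by
    have hlim : Tendsto (fun T : ℕ => (T : ℝ)⁻¹ * (C / B)) atTop (𝓝 0) := by
      simpa using (tendsto_inv_atTop_nhds_zero_nat (𝕜 := ℝ)).mul_const (C / (B : ℝ))
    refine smallInProb_of_bound hlim (Eventually.of_forall fun T => ae_of_all _ fun s => ?_)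
    rw [abs_of_nonneg (mul_nonneg (by positivity) scoreVar_nonneg)]
    refine (mul_le_mul_of_nonneg_left (h.scoreVar_le_const
      ((hπ.measurable_gap T).comp measurable_prodMk_left) (hπ.abs_gap_le s T))
      (by positivity)).trans_eq ?_
    rw [one_div, mul_inv]
    ring
  have small3 : SmallInProb (seqLaw Q) fun (T : ℕ) s => varEstimator e B s (π s) T -
      1 / ((T : ℝ) * B) * ∑ m ∈ Finset.Ico 1 T, gapVar (ipwScore e) B (π s) s T m :=
    small1.mono ((eventually_gt_atTop 0).mono fun T hT => ae_of_all _ fun s =>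
      (abs_varEstimator_sub_le e hB s (π s) hT (hε0 T)).trans (le_abs_self _))
  -- The average runs over the `T - 1` indices of `Ico 1 T` but is divided by `T`; `small2` supplies
  -- the one missing copy of the conditional variance.
  refine (((small3.add (hπ.smallInProb_average_gapVar_sub h hB)).add
    (hπ.smallInProb_average_scoreVar_sub h)).add (small2.const_mul (-1))).mono ?_
  filter_upwards [eventually_gt_atTop 0] with T hT
  refine ae_of_all _ fun s => le_of_eq ?_
  congr 1
  have hT0 : (T : ℝ) ≠ 0 := by exact_mod_cast hT.ne'
  rw [Finset.sum_sub_distrib, Finset.sum_sub_distrib, Finset.sum_const, Nat.card_Ico, nsmul_eq_mul,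
    Nat.cast_sub hT]
  push_cast
  field_simp
  ring

end Variance


/-! ### Confidence intervals and the studentized statistic -/

section Coverage

theorem gaussianReal_real_Ici_neg (q : ℝ) :
    (gaussianReal 0 1).real (Set.Ici (-q)) = (gaussianReal 0 1).real (Set.Iic q) := by
  have h : (gaussianReal 0 1).map (fun x : ℝ => -x) = gaussianReal 0 1 := by
    rw [gaussianReal_map_neg, neg_zero]
  conv_rhs => rw [← h]
  rw [map_measureReal_apply measurable_neg measurableSet_Iic]
  congr 1
  ext x
  simp

/-- The mass of a symmetric interval around zero under the standard normal law. -/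
theorem gaussianReal_real_Icc_symm {α q : ℝ} (hα : α < 1)
    (hq : (gaussianReal 0 1).real (Set.Iic q) = 1 - α / 2) :
    0 ≤ q ∧ (gaussianReal 0 1).real (Set.Icc (-q) q) = 1 - α := by
  have hI := gaussianReal_real_Ici_neg q
  have hq0 : 0 ≤ q := by
    by_contra hneg
    push Not at hneg
    have hdisj : Disjoint (Set.Ici (-q)) (Set.Iic q) :=
      Set.disjoint_left.2 fun x hx hx' => by
        have h1 : -q ≤ x := hx
        have h2 : x ≤ q := hx'
        linarith
    have h1 := measureReal_union (μ := gaussianReal 0 1) hdisj measurableSet_Iic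
    have h2 : (gaussianReal 0 1).real (Set.Ici (-q) ∪ Set.Iic q) ≤ 1 := measureReal_le_one
    linarith
  refine ⟨hq0, ?_⟩
  have hc := measureReal_compl (μ := gaussianReal 0 1) (measurableSet_Ici (a := -q))
  rw [Set.compl_Ici, probReal_univ] at hc
  have hsub : Set.Iio (-q) ⊆ Set.Iic q := fun x hx => by
    have h1 : x < -q := hx
    exact (by linarith : x ≤ q)
  have hd := measureReal_sdiff (μ := gaussianReal 0 1) hsub measurableSet_Iio
  have e : Set.Iic q \ Set.Iio (-q) = Set.Icc (-q) q := by
    ext x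
    simp [and_comm]
  rw [e] at hd
  linarith

/-- Asymptotic coverage of the confidence interval attached to a studentized statistic. -/
theorem tendsto_coverage {Ω : Type*} [MeasurableSpace Ω] {μ : Measure Ω} [IsProbabilityMeasure μ]
    {est val sd : ℕ → Ω → ℝ}
    (hstat : TendstoInDistribution
      (fun (T : ℕ) ω => √(T : ℝ) * ((est T ω - val T ω) / sd T ω)) atTop (id : ℝ → ℝ)
      (fun _ => μ) (gaussianReal 0 1))
    (hsd : Tendsto (fun T => μ.real {ω | sd T ω ≤ 0}) atTop (𝓝 0))
    {α q : ℝ} (hα : α < 1) (hq : (gaussianReal 0 1).real (Set.Iic q) = 1 - α / 2) :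
    Tendsto (fun T : ℕ => μ.real {ω | val T ω ∈ Set.Icc (est T ω - q * sd T ω / √(T : ℝ))
      (est T ω + q * sd T ω / √(T : ℝ))}) atTop (𝓝 (1 - α)) := by
  obtain ⟨hq0, hmass⟩ := gaussianReal_real_Icc_symm hα hq
  have hnull : (gaussianReal 0 1) (frontier (Set.Icc (-q) q)) = 0 := by
    rw [frontier_Icc (by linarith)]
    have := nullSingletonClass_gaussianReal (μ := 0) (v := 1) one_ne_zero
    exact (Set.toFinite _).measure_zero _
  have hport := ProbabilityMeasure.tendsto_measure_of_null_frontier_of_tendsto' hstat.tendsto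
    (E := Set.Icc (-q) q) (by simpa using hnull)
  have hport' : Tendsto (fun T : ℕ => μ.real {ω | √(T : ℝ) * ((est T ω - val T ω) / sd T ω) ∈
      Set.Icc (-q) q}) atTop (𝓝 (1 - α)) := by
    simp only [ProbabilityMeasure.coe_mk, Measure.map_id] at hport
    have h1 := (ENNReal.tendsto_toReal (measure_ne_top _ _)).comp hport
    rw [← measureReal_def, hmass] at h1
    refine h1.congr fun T => ?_
    simp only [Function.comp_apply]
    rw [Measure.map_apply_of_aemeasurable (hstat.forall_aemeasurable T) measurableSet_Icc]
    rfl
  -- The two events can be compared only where the divisor is positive; the exceptional event has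
  -- vanishing probability and bounds the discrepancy in both directions.
  have hequiv : ∀ T : ℕ, 0 < T → ∀ ω, 0 < sd T ω →
      (val T ω ∈ Set.Icc (est T ω - q * sd T ω / √(T : ℝ)) (est T ω + q * sd T ω / √(T : ℝ)) ↔
        √(T : ℝ) * ((est T ω - val T ω) / sd T ω) ∈ Set.Icc (-q) q) := by
    intro T hT ω hω
    have hT0 : 0 < √(T : ℝ) := Real.sqrt_pos.2 (by exact_mod_cast hT)
    have e1 : √(T : ℝ) * ((est T ω - val T ω) / sd T ω) =
        (est T ω - val T ω) / (sd T ω / √(T : ℝ)) := by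
      field_simp
    have hp : 0 < sd T ω / √(T : ℝ) := div_pos hω hT0
    rw [e1, Set.mem_Icc, Set.mem_Icc, le_div_iff₀ hp, div_le_iff₀ hp, mul_div_assoc, neg_mul]
    constructor <;> rintro ⟨h1, h2⟩ <;> constructor <;> linarith
  refine (tendsto_of_tendsto_of_dist hport' (squeeze_zero' (Eventually.of_forall fun T =>
    dist_nonneg) ?_ hsd))
  filter_upwards [eventually_gt_atTop 0] with T hT
  have hle : ∀ s t : Set Ω, s ⊆ t ∪ {ω | sd T ω ≤ 0} →
      μ.real s ≤ μ.real t + μ.real {ω | sd T ω ≤ 0} := fun s t h =>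
    (measureReal_mono h).trans (measureReal_union_le _ _)
  rw [Real.dist_eq, abs_le]
  constructor
  · have := hle {ω | val T ω ∈ Set.Icc (est T ω - q * sd T ω / √(T : ℝ))
      (est T ω + q * sd T ω / √(T : ℝ))} {ω | √(T : ℝ) * ((est T ω - val T ω) / sd T ω) ∈
      Set.Icc (-q) q} fun ω hω => by
        by_cases h0 : 0 < sd T ω
        · exact Or.inl ((hequiv T hT ω h0).1 hω)
        · exact Or.inr (not_lt.1 h0)
    linarith
  · have := hle {ω | √(T : ℝ) * ((est T ω - val T ω) / sd T ω) ∈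
      Set.Icc (-q) q} {ω | val T ω ∈ Set.Icc (est T ω - q * sd T ω / √(T : ℝ))
      (est T ω + q * sd T ω / √(T : ℝ))} fun ω hω => by
        by_cases h0 : 0 < sd T ω
        · exact Or.inl ((hequiv T hT ω h0).2 hω)
        · exact Or.inr (not_lt.1 h0)
    linarith

end Coverage

section Studentized

/-- Only the difference `v2 - w2` appears, so a random `w2` without deterministic limit is harmless
as long as both variances are bounded below. -/
theorem abs_studentized_sub_le {κ x w2 v2 S : ℝ} (hκ : 0 < κ) (hw : κ ≤ w2) (hv : κ ≤ v2) :
    |x / √v2 - S| ≤ (√κ)⁻¹ * ((√κ)⁻¹ * |(v2 - w2) * S| + |x - √w2 * S|) := by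
  have h0 : 0 < √κ := Real.sqrt_pos.2 hκ
  have hle : √κ ≤ √v2 := Real.sqrt_le_sqrt hv
  have hv0 : 0 < √v2 := h0.trans_le hle
  have e : x / √v2 - S = ((√w2 - √v2) * S + (x - √w2 * S)) / √v2 := by
    field_simp
    ring
  rw [e, abs_div, abs_of_pos hv0, div_eq_inv_mul]
  refine mul_le_mul (inv_anti₀ h0 hle) ?_ (abs_nonneg _) (inv_nonneg.2 h0.le)
  refine (abs_add_le _ _).trans (add_le_add_left ?_ _)
  rw [abs_mul, abs_mul, ← mul_assoc, abs_sub_comm]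
  exact mul_le_mul_of_nonneg_right (abs_sqrt_sub_sqrt_le hκ hv hw) (abs_nonneg _)

variable {𝒳 : Type*} [MeasurableSpace 𝒳] {Q : Measure (Obs 𝒳)} [IsProbabilityMeasure Q] {B : ℕ}
    {π : (ℕ → Obs 𝒳) → ℕ → 𝒳 → ℝ} {δ K : ℝ} (hπ : PolicyProcess Q B π δ K)
    {e : 𝒳 → ℝ}

include hπ

theorem PolicyProcess.measurable_crammedEstimator (he : Measurable (ipwScore e)) (T : ℕ) :
    Measurable fun s => crammedEstimator e B s (π s) T := by
  unfold crammedEstimator stepEstimator gammaHat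
  refine Finset.measurable_fun_sum _ fun t _ => (Finset.measurable_fun_sum _ fun j _ =>
    (Finset.measurable_fun_sum _ fun i _ => ?_).const_mul _).const_mul _
  exact measurable_score_eval (F := fun s x => π s t x - π s (t - 1) x) he
    ((hπ.measurable t).sub (hπ.measurable (t - 1))) i

theorem PolicyProcess.measurable_varEstimator (he : Measurable (ipwScore e)) (T : ℕ) :
    Measurable fun s => varEstimator e B s (π s) T := by
  simp_rw [varEstimator_eq]
  refine (Finset.measurable_fun_sum _ fun m hm => ?_).const_mul _
  have hmT := (Finset.mem_Ico.1 hm).2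
  simp_rw [fun s => sampleVar_eq_smpVar e B s (π s) hmT]
  exact measurable_smpVar fun i _ =>
    ((measurable_score_eval he (hπ.measurable_gap m) i).const_mul _).add
      (measurable_score_eval he (hπ.measurable_excess T m) i)

theorem PolicyProcess.measurable_sdEstimator (he : Measurable (ipwScore e)) (T : ℕ) :
    Measurable fun s => sdEstimator e B s (π s) T := (hπ.measurable_varEstimator he T).sqrt

variable {C σ : ℝ} (h : RegularScore Q (ipwScore e) C σ) {R : ℕ} {d : ℝ} (hd : 0 < d)
    (hsep : ∀ t, R ≤ t → ∀ᵐ s ∂seqLaw Q, d ≤ covNorm Q (gap (π s) t)) (hB : 0 < B)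

include h hd hsep hB

/-- The factor 2 leaves room: an estimate within `κ` of this variance is itself at least `κ`. -/
theorem PolicyProcess.exists_scoreVar_gap_ge : ∃ κ : ℝ, 0 < κ ∧ ∀ᶠ T in atTop,
    ∀ᵐ s ∂seqLaw Q, 2 * κ ≤ scoreVar Q (ipwScore e) (gap (π s) T) / B := by
  obtain ⟨κ, hκ, hlow⟩ := hπ.exists_scoreVar_regGap_ge h hd hsep
  have hB0 : (0 : ℝ) < B := by exact_mod_cast hB
  refine ⟨κ / B / 2, by positivity, ?_⟩
  filter_upwards [eventually_ge_atTop R] with T hT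
  filter_upwards [hlow] with s hs
  have e3 : regGap (π s) R T = gap (π s) T := by funext x; simp [regGap, hT.not_gt]
  rw [mul_div_cancel₀ _ (two_ne_zero), ← e3]
  exact div_le_div_of_nonneg_right (hs T) hB0.le

theorem PolicyProcess.tendsto_sdEstimator_nonpos :
    Tendsto (fun T => (seqLaw Q).real {s | sdEstimator e B s (π s) T ≤ 0}) atTop (𝓝 0) := by
  obtain ⟨κ, hκ, hlow⟩ := hπ.exists_scoreVar_gap_ge h hd hsep hB
  refine squeeze_zero' (Eventually.of_forall fun T => measureReal_nonneg) ?_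
    (hπ.smallInProb_varEstimator_sub h hB κ hκ)
  filter_upwards [hlow] with T hT
  refine ENNReal.toReal_mono (measure_ne_top _ _) (measure_mono_ae ?_)
  filter_upwards [hT] with s hs hle
  have h1 : varEstimator e B s (π s) T ≤ 0 := Real.sqrt_eq_zero'.1
    (le_antisymm hle (Real.sqrt_nonneg _))
  change κ ≤ |_|
  exact le_trans (by linarith) (neg_le_abs _)

theorem PolicyProcess.tendstoInDistribution_studentized :
    TendstoInDistribution (fun (T : ℕ) s => √(T : ℝ) *
        ((crammedEstimator e B s (π s) T - scoreMean Q (ipwScore e) (gap (π s) T)) /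
          sdEstimator e B s (π s) T))
      atTop (id : ℝ → ℝ) (fun _ => seqLaw Q) (gaussianReal 0 1) := by
  obtain ⟨κ, hκ, hlow⟩ := hπ.exists_scoreVar_gap_ge h hd hsep hB
  have hvar := hπ.smallInProb_varEstimator_sub h hB
  have herr := hπ.smallInProb_error_sub h hd hsep hB
  have hS : ∀ T : ℕ, MemLp (fun s => (√((T * B : ℕ) : ℝ))⁻¹ *
      ∑ i ∈ Finset.range (T * B), stdScore Q (ipwScore e) B R π i s (s i)) 2 (seqLaw Q) ∧
      ∫ s, ((√((T * B : ℕ) : ℝ))⁻¹ * ∑ i ∈ Finset.range (T * B),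
        stdScore Q (ipwScore e) B R π i s (s i)) ^ 2 ∂seqLaw Q ≤ 1 := by
    intro T
    obtain ⟨h1, h2⟩ := hπ.sq_sum_stdScore_le h hd hsep (Finset.range (T * B))
    refine ⟨h1.const_mul _, ?_⟩
    simp_rw [mul_pow]
    rw [integral_const_mul, inv_pow, Real.sq_sqrt (Nat.cast_nonneg _)]
    rw [Finset.card_range] at h2
    exact (mul_le_mul_of_nonneg_left h2 (by positivity)).trans inv_mul_le_one
  -- The normalized sum is bounded in `L²`, so multiplying the error of the variance estimator by it
  -- keeps that error negligible.
  have hprod := hvar.mul_of_integral_sq_le (fun T => (hS T).1) (fun T => (hS T).2)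
  have hdom : SmallInProb (seqLaw Q) fun (T : ℕ) s => (√κ)⁻¹ * ((√κ)⁻¹ *
      |(varEstimator e B s (π s) T - scoreVar Q (ipwScore e) (gap (π s) T) / B) *
        ((√((T * B : ℕ) : ℝ))⁻¹ *
          ∑ i ∈ Finset.range (T * B), stdScore Q (ipwScore e) B R π i s (s i))| +
      |√(T : ℝ) * (crammedEstimator e B s (π s) T - scoreMean Q (ipwScore e) (gap (π s) T)) -
        √(scoreVar Q (ipwScore e) (gap (π s) T) / B) * ((√((T * B : ℕ) : ℝ))⁻¹ *
          ∑ i ∈ Finset.range (T * B), stdScore Q (ipwScore e) B R π i s (s i))|) := by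
    refine SmallInProb.const_mul _ (SmallInProb.add (SmallInProb.const_mul _ ?_) ?_)
    · exact hprod.mono (Eventually.of_forall fun T => ae_of_all _ fun s => (abs_abs _).le)
    · exact herr.mono (Eventually.of_forall fun T => ae_of_all _ fun s => (abs_abs _).le)
  refine tendstoInDistribution_of_tendstoInMeasure_sub _ _
    (hπ.tendstoInDistribution_stdScore h hd hsep hB) ?_ fun T => ?_
  · rw [tendstoInMeasure_iff_measureReal_norm]
    have key : SmallInProb (seqLaw Q) fun (T : ℕ) s => √(T : ℝ) *
        ((crammedEstimator e B s (π s) T - scoreMean Q (ipwScore e) (gap (π s) T)) /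
          sdEstimator e B s (π s) T) - (√((T * B : ℕ) : ℝ))⁻¹ *
        ∑ i ∈ Finset.range (T * B), stdScore Q (ipwScore e) B R π i s (s i) := by
      -- Where the variance error is below `κ`, both variances are at least `κ` and
      -- `abs_studentized_sub_le` applies; elsewhere the probability is negligible.
      refine SmallInProb.mono_of_small hκ hdom hvar ?_
      filter_upwards [hlow] with T hT
      filter_upwards [hT] with s hs hlt
      have h1 := (abs_lt.1 hlt).1
      rw [← mul_div_assoc]
      exact (abs_studentized_sub_le hκ (by linarith) (by linarith)).trans (le_abs_self _)
    intro ε hε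
    simpa using key ε hε
  · refine Measurable.aemeasurable (Measurable.const_mul (Measurable.div (Measurable.sub ?_ ?_) ?_) _)
    · exact hπ.measurable_crammedEstimator h.measurable T
    · exact measurable_scoreMean (F := fun s => gap (π s) T) h.measurable (hπ.measurable_gap T)
    · exact hπ.measurable_sdEstimator h.measurable T

end Studentized


/-! ### From the assumptions on the algorithm to the sequence space -/

section Limit

variable {𝒳 : Type*} [MeasurableSpace 𝒳] {P : Measure (PotUnit 𝒳)} [IsProbabilityMeasure P]

omit [IsProbabilityMeasure P] in
theorem policyDist_eq_integral_map {p q : 𝒳 → ℝ} (hp : Measurable p) (hq : Measurable q) :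
    policyDist P p q = ∫ x, |p x - q x| ∂P.map covariate :=
  (integral_map measurable_covariate.aemeasurable
    (hp.sub hq).abs.aestronglyMeasurable).symm

omit [IsProbabilityMeasure P] in
theorem policyDist_eq_covNorm {p q : 𝒳 → ℝ} (hp : Measurable p) (hq : Measurable q) :
    policyDist P p q = covNorm (P.map observe) fun x => p x - q x :=
  (integral_map measurable_observe.aemeasurable
    ((hp.sub hq).abs.comp measurable_fst).aestronglyMeasurable).symm

/-- Policies with summable increments converge to a limit policy. -/
theorem exists_limit_policy {p : ℕ → 𝒳 → ℝ} (hp : ∀ t, IsPolicy (p t)) {f : ℕ → ℝ}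
    (hf : Summable f) (hle : ∀ t, policyDist P (p (t + 1)) (p t) ≤ f t) :
    ∃ πinf, IsPolicy πinf ∧ ∀ n, policyDist P πinf (p n) ≤ ∑' m, f (n + m) := by
  set ν := P.map covariate
  have : IsProbabilityMeasure ν := Measure.isProbabilityMeasure_map measurable_covariate.aemeasurable
  have hi : ∀ t, Integrable (p t) ν := fun t => by
    refine Integrable.of_bound (hp t).1.aestronglyMeasurable 1 (ae_of_all _ fun x => ?_)
    rw [Real.norm_eq_abs, abs_of_nonneg ((hp t).2 x).1]
    exact ((hp t).2 x).2
  have hdist : ∀ t, dist ((hi t).toL1 (p t)) ((hi t.succ).toL1 (p t.succ)) ≤ f t := fun t => by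
    refine le_trans (le_of_eq ?_) (hle t)
    rw [policyDist_eq_integral_map (hp _).1 (hp _).1, dist_comm, L1.dist_eq_integral_dist]
    refine integral_congr_ae ?_
    filter_upwards [(hi t).coeFn_toL1, (hi t.succ).coeFn_toL1] with x h1 h2
    rw [h1, h2, Real.dist_eq]
  obtain ⟨g, hg⟩ := cauchySeq_tendsto_of_complete (cauchySeq_of_dist_le_of_summable f hdist hf)
  have hgm : Measurable g := (Lp.stronglyMeasurable g).measurable
  have hgi : Integrable g ν := L1.integrable_coeFn g
  -- The chosen representative of the `L¹` limit need not take values in `[0, 1]` everywhere.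
  -- Clipping repairs this and does not increase the distance to any policy.
  refine ⟨fun x => max 0 (min 1 (g x)), ⟨measurable_const.max (measurable_const.min hgm), fun x =>
    ⟨le_max_left _ _, max_le zero_le_one (min_le_left _ _)⟩⟩, fun n => ?_⟩
  rw [policyDist_eq_integral_map (measurable_const.max (measurable_const.min hgm)) (hp n).1]
  refine le_trans ?_ (dist_le_tsum_of_dist_le_of_tendsto f hdist hf hg n)
  rw [dist_comm, L1.dist_eq_integral_dist]
  refine le_trans (integral_mono_of_nonneg (ae_of_all _ fun x => abs_nonneg _)
    (hgi.sub (hi n)).abs (ae_of_all _ fun x => ?_)) (le_of_eq (integral_congr_ae ?_))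
  · obtain ⟨h0, h1⟩ := (hp n).2 x
    simp only [Pi.sub_apply]
    rcases le_total (g x) 0 with h | h
    · rw [min_eq_right (h.trans zero_le_one), max_eq_left h, abs_of_nonpos (by linarith),
        abs_of_nonpos (by linarith)]
      linarith
    · rcases le_total (g x) 1 with h' | h'
      · rw [min_eq_right h', max_eq_right h]
      · rw [min_eq_left h', max_eq_right zero_le_one, abs_of_nonneg (by linarith),
          abs_of_nonneg (by linarith)]
        linarith
  · filter_upwards [(hi n).coeFn_toL1] with x hx
    rw [hx, Real.dist_eq]
    rfl

end Limit

section Learned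

variable {𝒳 : Type*} [MeasurableSpace 𝒳] {A : (n : ℕ) → (Fin n → Obs 𝒳) → 𝒳 → ℝ} {π₀ : 𝒳 → ℝ}

theorem IsPolicy.abs_sub_le {p q : 𝒳 → ℝ} (hp : IsPolicy p) (hq : IsPolicy q) (x : 𝒳) :
    |p x - q x| ≤ 1 := by
  rw [abs_le]
  constructor <;> linarith [(hp.2 x).1, (hp.2 x).2, (hq.2 x).1, (hq.2 x).2]

theorem learned_mem_Icc (hπ₀ : IsPolicy π₀) (hA : IsLearningAlgorithm A) (B : ℕ)
    (s : ℕ → Obs 𝒳) (t : ℕ) (x : 𝒳) : learned A π₀ B s t x ∈ Set.Icc (0 : ℝ) 1 := by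
  unfold learned
  split_ifs
  · exact hπ₀.2 x
  · exact hA.mem_Icc _ _ x

theorem measurable_learned (hπ₀ : IsPolicy π₀) (hA : IsLearningAlgorithm A) (B t : ℕ) :
    Measurable fun p : (ℕ → Obs 𝒳) × 𝒳 => learned A π₀ B p.1 t p.2 := by
  unfold learned
  split_ifs
  · exact hπ₀.1.comp measurable_snd
  · refine (hA.measurable (t * B)).comp (Measurable.prodMk ?_ measurable_snd)
    exact measurable_pi_lambda _ fun i => (measurable_pi_apply _).comp measurable_fst

theorem isPolicy_learned (hπ₀ : IsPolicy π₀) (hA : IsLearningAlgorithm A) (B : ℕ)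
    (s : ℕ → Obs 𝒳) (t : ℕ) : IsPolicy (learned A π₀ B s t) :=
  ⟨(measurable_learned hπ₀ hA B t).comp measurable_prodMk_left, learned_mem_Icc hπ₀ hA B s t⟩

omit [MeasurableSpace 𝒳] in
theorem dependsOn_learned (A : (n : ℕ) → (Fin n → Obs 𝒳) → 𝒳 → ℝ) (π₀ : 𝒳 → ℝ) (B t : ℕ) :
    DependsOn (fun s => learned A π₀ B s t) (Set.Iio (t * B)) := by
  intro s s' h
  simp only [learned]
  split_ifs
  · rfl
  · congr 1
    funext i
    exact h i i.2

theorem valueDiff_eq_scoreMean {P : Measure (PotUnit 𝒳)} [StandardBorelSpace 𝒳]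
    [IsProbabilityMeasure P] {e : 𝒳 → ℝ} (he : IsPropensityScore P e)
    (hs : StrongIgnorability P e) (h4 : FourthMoment P) {p q : 𝒳 → ℝ} (hp : IsPolicy p)
    (hq : IsPolicy q) :
    valueDiff P p q = scoreMean (P.map observe) (ipwScore e) fun x => p x - q x := by
  have hY : ∀ d, Integrable (potOutcome d) P := fun d => (h4 d).integrable (by norm_num)
  have hmul : ∀ (d : Bool) (r : 𝒳 → ℝ), Measurable r → (∀ x, r x ∈ Set.Icc (0 : ℝ) 1) →
      Integrable (fun w => potOutcome d w * r (covariate w)) P := fun d r hr hr1 =>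
    (hY d).mul_bdd (c := 1) (hr.comp measurable_covariate).aestronglyMeasurable
      (ae_of_all _ fun w => by
        rw [Real.norm_eq_abs, abs_of_nonneg (hr1 _).1]
        exact (hr1 _).2)
  have hval : ∀ r : 𝒳 → ℝ, IsPolicy r → Integrable (fun w => potOutcome true w * r (covariate w) +
      potOutcome false w * (1 - r (covariate w))) P := fun r hr =>
    (hmul true r hr.1 hr.2).add (hmul false (fun x => 1 - r x) (measurable_const.sub hr.1)
      fun x => ⟨by linarith [(hr.2 x).2], by linarith [(hr.2 x).1]⟩)
  rw [scoreMean, integral_ipwScore_mul (f := fun x => p x - q x) he hs h4 (hp.1.sub hq.1)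
      (hp.abs_sub_le hq), valueDiff, policyValue, policyValue, ← integral_sub (hval p hp) (hval q hq)]
  refine integral_congr_ae (ae_of_all _ fun w => ?_)
  simp only
  ring

end Learned

section Transfer

variable {𝒳 : Type*} [MeasurableSpace 𝒳] {P : Measure (PotUnit 𝒳)} [IsProbabilityMeasure P]
  {Ω : Type*} [MeasurableSpace Ω] {μ : Measure Ω} [IsProbabilityMeasure μ]

omit [IsProbabilityMeasure P] [IsProbabilityMeasure μ] in
/-- The observed data of i.i.d. units are an i.i.d. sequence. -/
theorem hasLaw_observations {W : ℕ → Ω → PotUnit 𝒳} (hind : iIndepFun W μ)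
    (hlaw : ∀ i, HasLaw (W i) P μ) :
    HasLaw (fun ω i => observe (W i ω)) (seqLaw (P.map observe)) μ := by
  have hae : ∀ i, AEMeasurable (fun ω => observe (W i ω)) μ := fun i =>
    measurable_observe.comp_aemeasurable (hlaw i).aemeasurable
  have hlaw' : ∀ i, HasLaw (fun ω => observe (W i ω)) (P.map observe) μ := fun i =>
    ⟨hae i, by
      rw [← (hlaw i).map_eq, AEMeasurable.map_map_of_aemeasurable
        measurable_observe.aemeasurable (hlaw i).aemeasurable]
      rfl⟩
  exact (hind.comp (fun _ => observe) fun _ => measurable_observe).hasLaw_infinitePi hlaw'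
    (aemeasurable_pi_iff.2 hae)

omit [IsProbabilityMeasure μ] in
theorem _root_.MeasureTheory.TendstoInDistribution.comp_hasLaw {S : Type*} [MeasurableSpace S]
    {ν : Measure S} [IsProbabilityMeasure ν] [IsProbabilityMeasure μ] {z : Ω → S}
    (hz : HasLaw z ν μ) {X : ℕ → S → ℝ} {γ : Measure ℝ} [IsProbabilityMeasure γ]
    (h : TendstoInDistribution X atTop (id : ℝ → ℝ) (fun _ => ν) γ) :
    TendstoInDistribution (fun n ω => X n (z ω)) atTop (id : ℝ → ℝ) (fun _ => μ) γ := by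
  have hX : ∀ n, AEMeasurable (X n) (μ.map z) := fun n => by
    rw [hz.map_eq]
    exact h.forall_aemeasurable n
  refine ⟨fun n => (hX n).comp_aemeasurable hz.aemeasurable, aemeasurable_id,
    h.tendsto.congr fun n => ?_⟩
  apply Subtype.ext
  change ν.map (X n) = μ.map (X n ∘ z)
  rw [← AEMeasurable.map_map_of_aemeasurable (hX n) hz.aemeasurable, hz.map_eq]

variable {A : (n : ℕ) → (Fin n → Obs 𝒳) → 𝒳 → ℝ} {π₀ : 𝒳 → ℝ} {z : Ω → ℕ → Obs 𝒳}

-- The stabilization bound starts only at some time and lives on `Ω`. Enlarging the constant covers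
-- the earlier steps, and measurability of the policy distance in the data carries almost sure
-- bounds to the sequence space.
omit [IsProbabilityMeasure P] [IsProbabilityMeasure μ] in
theorem exists_policyProcess_learned [IsProbabilityMeasure (P.map observe)]
    (hπ₀ : IsPolicy π₀) (hA : IsLearningAlgorithm A) (B : ℕ)
    (hz : HasLaw z (seqLaw (P.map observe)) μ)
    (hst : Stabilization μ P fun ω => learned A π₀ B (z ω)) :
    ∃ δ K : ℝ, PolicyProcess (P.map observe) B (learned A π₀ B) δ K := by
  obtain ⟨δ, R, K, hδ, hR, hK, hle⟩ := hst
  -- Lowering the exponent to `min δ 1` is harmless. The summand `R ^ 2` covers `t < R`, where the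
  -- distance is at most one and `t ^ (1 + min δ 1) ≤ R ^ 2`.
  refine ⟨min δ 1, K + (R : ℝ) ^ (2 : ℝ), lt_min hδ one_pos, min_le_right _ _, by positivity,
    learned_mem_Icc hπ₀ hA B, measurable_learned hπ₀ hA B, dependsOn_learned A π₀ B,
    fun t ht => ?_⟩
  have hpol := isPolicy_learned hπ₀ hA B
  have ht1 : (1 : ℝ) ≤ t := by exact_mod_cast ht
  have ht0 : (0 : ℝ) < t := by linarith
  have hmeas : Measurable fun s => covNorm (P.map observe) fun x =>
      learned A π₀ B s t x - learned A π₀ B s (t - 1) x :=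
    measurable_covNorm (F := fun s x => learned A π₀ B s t x - learned A π₀ B s (t - 1) x)
      ((measurable_learned hπ₀ hA B t).sub (measurable_learned hπ₀ hA B (t - 1)))
  rw [← hz.map_eq, ae_map_iff hz.aemeasurable (measurableSet_le hmeas measurable_const)]
  have hR2 : (0 : ℝ) ≤ (R : ℝ) ^ (2 : ℝ) := by positivity
  rw [Real.rpow_neg ht0.le]
  rcases lt_or_ge t R with htR | htR
  · refine ae_of_all _ fun ω => ?_
    have h1 : covNorm (P.map observe) (fun x => learned A π₀ B (z ω) t x -
        learned A π₀ B (z ω) (t - 1) x) ≤ 1 :=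
      covNorm_le ((hpol _ t).1.sub (hpol _ (t - 1)).1)
        ((hpol _ t).abs_sub_le (hpol _ (t - 1)))
    refine h1.trans ?_
    rw [← div_eq_mul_inv, one_le_div (by positivity)]
    calc (t : ℝ) ^ (1 + min δ 1) ≤ (t : ℝ) ^ (2 : ℝ) :=
          Real.rpow_le_rpow_of_exponent_le ht1 (by linarith [min_le_right δ 1])
      _ ≤ (R : ℝ) ^ (2 : ℝ) := Real.rpow_le_rpow ht0.le (by exact_mod_cast htR.le) (by norm_num)
      _ ≤ _ := by linarith
  · filter_upwards [hle t htR] with ω hω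
    rw [policyDist_eq_covNorm (hpol _ t).1 (hpol _ (t - 1)).1] at hω
    rw [← div_eq_mul_inv, le_div_iff₀ (by positivity), mul_comm]
    refine (mul_le_mul_of_nonneg_right (Real.rpow_le_rpow_of_exponent_le ht1
      (add_le_add_right (min_le_left δ 1) 1)) covNorm_nonneg).trans (hω.trans (by linarith))

omit [IsProbabilityMeasure μ] in
/-- The learned policies are eventually bounded away from the baseline policy. -/
theorem exists_gap_learned_ge [IsProbabilityMeasure (P.map observe)]
    (hπ₀ : IsPolicy π₀) (hA : IsLearningAlgorithm A) {B : ℕ}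
    (hz : HasLaw z (seqLaw (P.map observe)) μ) {δ K : ℝ}
    (hπ : PolicyProcess (P.map observe) B (learned A π₀ B) δ K)
    (hlim : LimitDiffers μ P π₀ fun ω => learned A π₀ B (z ω)) :
    ∃ (R : ℕ) (d : ℝ), 0 < d ∧ ∀ t, R ≤ t → ∀ᵐ s ∂seqLaw (P.map observe),
      d ≤ covNorm (P.map observe) (gap (learned A π₀ B s) t) := by
  obtain ⟨M, hM, hdiff⟩ := hlim
  have hpol := isPolicy_learned hπ₀ hA B
  set f : ℕ → ℝ := fun t => K * ((t : ℝ) + 1) ^ (-(1 + δ)) with hf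
  have hfs : Summable f := by
    refine Summable.mul_left _ ?_
    have := (summable_nat_add_iff 1).2
      (Real.summable_nat_rpow (p := -(1 + δ)) |>.2 (by linarith [hπ.delta_pos]))
    simpa using this
  have htail : Tendsto (fun n => ∑' m, f (n + m)) atTop (𝓝 0) := by
    simpa only [add_comm] using tendsto_sum_nat_add f
  -- From `R` on, the tail bound puts the learned policy within `M / 2` of the limit policy, so half
  -- of the separation `M` from the baseline survives.
  obtain ⟨R, hR⟩ := eventually_atTop.1 (htail.eventually (gt_mem_nhds (half_pos hM)))
  refine ⟨R, M / 2, half_pos hM, fun t ht => ?_⟩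
  rw [← hz.map_eq, ae_map_iff hz.aemeasurable (measurableSet_le measurable_const
    (measurable_covNorm (F := fun s => gap (learned A π₀ B s) t) (hπ.measurable_gap t)))]
  have hst := hπ.ae_stable
  rw [← hz.map_eq] at hst
  filter_upwards [ae_of_ae_map hz.aemeasurable hst, hdiff] with ω hω hd
  -- The separation assumption speaks about every limit policy, so one has to be exhibited before it
  -- says anything.
  obtain ⟨πinf, hinf, hinf'⟩ := exists_limit_policy (P := P) (hpol (z ω)) hfs fun u => by
    rw [policyDist_eq_covNorm (hpol _ _).1 (hpol _ _).1]
    have := hω (u + 1) (by omega)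
    push_cast at this
    exact this
  have hM' := hd πinf ⟨hinf, squeeze_zero (fun u => integral_nonneg fun w => abs_nonneg _)
    hinf' htail⟩
  have h1 := (hinf' t).trans_lt (hR t ht)
  rw [policyDist_eq_covNorm hπ₀.1 hinf.1] at hM'
  rw [policyDist_eq_covNorm hinf.1 (hpol _ t).1, covNorm_sub_comm] at h1
  have h2 := covNorm_add_le (Q := P.map observe) (f := fun x => π₀ x - learned A π₀ B (z ω) t x)
    (g := fun x => learned A π₀ B (z ω) t x - πinf x) (hπ₀.1.sub (hpol (z ω) t).1)
    (hπ₀.abs_sub_le (hpol (z ω) t)) ((hpol (z ω) t).1.sub hinf.1) ((hpol (z ω) t).abs_sub_le hinf)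
  simp only [sub_add_sub_cancel] at h2
  have h3 : covNorm (P.map observe) (gap (learned A π₀ B (z ω)) t) =
      covNorm (P.map observe) fun x => π₀ x - learned A π₀ B (z ω) t x := by
    rw [covNorm_sub_comm]
    rfl
  rw [h3]
  linarith

end Transfer

end Cram

theorem corollary1
    -- covariate space, and the population law of `(X, D, Y(0), Y(1))`
    {𝒳 : Type*} [MeasurableSpace 𝒳] [StandardBorelSpace 𝒳]
    (P : Measure (Cram.PotUnit 𝒳)) [IsProbabilityMeasure P]
    -- an i.i.d. sequence of units drawn from the population
    {Ω : Type*} [MeasurableSpace Ω] (μ : Measure Ω) [IsProbabilityMeasure μ]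
    (W : ℕ → Ω → Cram.PotUnit 𝒳) (hW_indep : iIndepFun W μ) (hW_law : ∀ i, HasLaw (W i) P μ)
    -- the known propensity score, the baseline policy, the learning algorithm, the batch size
    (e : 𝒳 → ℝ) (he : Cram.IsPropensityScore P e)
    (π₀ : 𝒳 → ℝ) (hπ₀ : Cram.IsPolicy π₀)
    (A : (n : ℕ) → (Fin n → Cram.Obs 𝒳) → 𝒳 → ℝ) (hA : Cram.IsLearningAlgorithm A)
    (B : ℕ) (hB : 0 < B)
    -- the observed data and the learned policies
    (z : Ω → ℕ → Cram.Obs 𝒳) (hz : z = fun ω i => Cram.observe (W i ω))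
    (πhat : Ω → ℕ → 𝒳 → ℝ) (hπhat : πhat = fun ω => Cram.learned A π₀ B (z ω))
    -- the assumptions
    (h_ignorable : Cram.StrongIgnorability P e)
    (h_stable : Cram.Stabilization μ P πhat)
    (h_limit : Cram.LimitDiffers μ P π₀ πhat)
    (h_bounded : Cram.BoundedCondMoments P)
    (h_fourth : Cram.FourthMoment P) :
    -- the studentized statistic is asymptotically standard normal
    TendstoInDistribution
      (fun (T : ℕ) (ω : Ω) => √(T : ℝ) *
        ((Cram.crammedEstimator e B (z ω) (πhat ω) T - Cram.valueDiff P (πhat ω T) π₀) /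
          Cram.sdEstimator e B (z ω) (πhat ω) T))
      atTop (id : ℝ → ℝ) (fun _ => μ) (gaussianReal 0 1) ∧
    -- the resulting confidence intervals have asymptotically correct coverage
    ∀ α : ℝ, 0 < α → α < 1 → ∀ q : ℝ, (gaussianReal 0 1).real (Set.Iic q) = 1 - α / 2 →
      Tendsto
        (fun T : ℕ => μ.real {ω | Cram.valueDiff P (πhat ω T) π₀ ∈ Set.Icc
          (Cram.crammedEstimator e B (z ω) (πhat ω) T -
            q * Cram.sdEstimator e B (z ω) (πhat ω) T / √(T : ℝ))
          (Cram.crammedEstimator e B (z ω) (πhat ω) T +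
            q * Cram.sdEstimator e B (z ω) (πhat ω) T / √(T : ℝ))})
        atTop (𝓝 (1 - α)) := by
  have : IsProbabilityMeasure (P.map Cram.observe) :=
    Measure.isProbabilityMeasure_map Cram.measurable_observe.aemeasurable
  have hlaw : HasLaw z (Cram.seqLaw (P.map Cram.observe)) μ := by
    rw [hz]
    exact Cram.hasLaw_observations hW_indep hW_law
  subst hπhat
  obtain ⟨C, σ, hψ⟩ := Cram.exists_regularScore he h_ignorable h_bounded h_fourth
  obtain ⟨δ, K, hπ⟩ := Cram.exists_policyProcess_learned hπ₀ hA B hlaw h_stable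
  obtain ⟨R, d, hd, hsep⟩ := Cram.exists_gap_learned_ge hπ₀ hA hlaw hπ h_limit
  have hval : ∀ ω T, Cram.valueDiff P (Cram.learned A π₀ B (z ω) T) π₀ =
      Cram.scoreMean (P.map Cram.observe) (Cram.ipwScore e)
        (Cram.gap (Cram.learned A π₀ B (z ω)) T) := fun ω T =>
    Cram.valueDiff_eq_scoreMean he h_ignorable h_fourth (Cram.isPolicy_learned hπ₀ hA B (z ω) T) hπ₀
  -- The statistic and its divisor depend on `ω` only through the observed sequence, whose law is
  -- the product measure, so the results on the sequence space transfer.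
  have hstat := (hπ.tendstoInDistribution_studentized hψ hd hsep hB).comp_hasLaw hlaw
  have hsd : Tendsto (fun T => μ.real {ω | Cram.sdEstimator e B (z ω)
      (Cram.learned A π₀ B (z ω)) T ≤ 0}) atTop (𝓝 0) := by
    refine (hπ.tendsto_sdEstimator_nonpos hψ hd hsep hB).congr fun T => ?_
    rw [measureReal_def, measureReal_def, ← hlaw.measure_eq
      (measurableSet_le (hπ.measurable_sdEstimator hψ.measurable T) measurable_const)]
  simp_rw [hval]
  exact ⟨hstat, fun α _ hα q hq => Cram.tendsto_coverage hstat hsd hα hq⟩
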